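/- Let $(\mathbb X,\mathcal X)$ be a measurable space and $\alpha$ a $\sigma$-finite measure on it. Let $\mathcal C$ be the algebra of bounded measurable functions $\varphi:\mathbb X\to\mathbb C$ with $\alpha(\{\varphi\neq 0\})<\infty$. Let $\mathbf M$ be the space of $s$-finite measures on $\mathbb X$ with the $\sigma$-algebra generated by the maps $\mu\mapsto\mu(B)$, $B\in\mathcal X$, and let $\rho_\alpha$ be the law of the Gamma random measure, i.e. the probability measure on $\mathbf M$ under which $\mu(B_1),\dots,\mu(B_n)$ are independent for all disjoint $B_1,\dots,B_n\in\mathcal X$, and, for every $B\in\mathcal X$, $\mu(B)$ is Gamma distributed with shape $\alpha(B)$ and scale $1$ if $0<\alpha(B)<\infty$, while $\mu(B)=0$ a.s. if $\alpha(B)=0$ and $\mu(B)=\infty$ a.s. if $\alpha(B)=\infty$. Write $\mu(f)=\int f\,d\mu$ and $\alpha(f)=\int f\,d\alpha$. Let $\mathbb D$ be the space of functions $F(\mu)=P(\mu(f_1),\dots,\mu(f_n))$ with $n\in\mathbb N$, $f_1,\dots,f_n\in\mathcal C$ and $P$ a complex polynomial in $n$ variables (identified when they agree $\rho_\alpha$-a.e.).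 For $F\in\mathbb D$ let $$\frac{\delta F}{\delta\mu(x)}(\mu)=\frac{d}{dt}F(\mu+t\delta_x)\Big|_{t=0},\qquad \frac{\delta^2F}{\delta\mu(x)^2}(\mu)=\frac{d^2}{dt^2}F(\mu+t\delta_x)\Big|_{t=0}$$ (derivatives from the right), and for $\varphi\in\mathcal C$ let $$K^-(\varphi)F(\mu)=\int\overline{\varphi(x)}\,\frac{\delta^2F}{\delta\mu(x)^2}(\mu)\,\mu(dx)+\int\overline{\varphi(x)}\,\frac{\delta F}{\delta\mu(x)}(\mu)\,\alpha(dx),$$ $$K^+(\varphi)F(\mu)=\int\varphi(x)\,\frac{\delta^2F}{\delta\mu(x)^2}(\mu)\,\mu(dx)+\int\varphi(x)\,\frac{\delta F}{\delta\mu(x)}(\mu)\,(\alpha-2\mu)(dx)+(\mu(\varphi)-\alpha(\varphi))F(\mu),$$ $$K^0(\varphi)F(\mu)=-\int\varphi(x)\,\frac{\delta^2F}{\delta\mu(x)^2}(\mu)\,\mu(dx)-\int\varphi(x)\,\frac{\delta F}{\delta\mu(x)}(\mu)\,(\alpha-\mu)(dx)+\tfrac12\alpha(\varphi)F(\mu).$$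 Then $\mathbb D\subset L^2(\mathbf M,\rho_\alpha)$, the formulas give well-defined linear operators $K^\pm(\varphi),K^0(\varphi):\mathbb D\to\mathbb D$, and these form a Fock representation in $L^2(\mathbf M,\rho_\alpha)$ of the $su(1,1)$ current algebra with vacuum $\Psi=\mathbf 1$, the constant function $1$. That is: 1. $\mathbb D$ is dense in $L^2(\mathbf M,\rho_\alpha)$; 2. $K^+(\varphi)$ and $K^0(\varphi)$ are linear in $\varphi$, and $K^-(\varphi)$ is antilinear in $\varphi$; 3. on $\mathbb D$, for all $\varphi,\theta\in\mathcal C$, $[K^-(\varphi),K^+(\theta)]=2K^0(\overline\varphi\theta)$, $[K^0(\varphi),K^+(\theta)]=K^+(\varphi\theta)$, $[K^0(\varphi),K^-(\theta)]=-K^-(\overline\varphi\theta)$, and $[K^\#(\varphi),K^\#(\theta)]=0$ for $\#\in\{0,+,-\}$; 4. $\langle F,K^0(\varphi)G\rangle=\langle K^0(\overline\varphi)F,G\rangle$ and $\langle F,K^+(\varphi)G\rangle=\langle K^-(\varphi)F,G\rangle$ for all $F,G\in\mathbb D$ and $\varphi\in\mathcal C$, where $\langle F,G\rangle=\int\overline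 F\,G\,d\rho_\alpha$; 5. $\Psi\in\mathbb D$, $\|\Psi\|=1$, and $K^-(\varphi)\Psi=0$ for all $\varphi\in\mathcal C$; 6. the linear combinations of $\Psi$ and the vectors $K^+(\varphi_1)\cdots K^+(\varphi_n)\Psi$, with $n\in\mathbb N$ and $\varphi_1,\dots,\varphi_n\in\mathcal C$, are dense in $L^2(\mathbf M,\rho_\alpha)$. Moreover, for all $\ell\in\mathbb N$, disjoint $B_1,\dots,B_\ell\in\mathcal X$ with $0<\alpha(B_i)<\infty$, and $n_1,\dots,n_\ell\in\mathbb N_0$, $$K^+(\mathbf 1_{B_1})^{n_1}\cdots K^+(\mathbf 1_{B_\ell})^{n_\ell}\mathbf 1(\mu)=\prod_{i=1}^\ell\mathscr L_{n_i}^{(\alpha(B_i)-1)}(\mu(B_i))\qquad\text{for }\rho_\alpha\text{-almost all }\mu\in\mathbf M.$$ Here, for $\beta>0$, $\mathscr L_n^{(\beta-1)}(x)=\sum_{j=0}^n(-1)^{n+j}\binom nj(\beta+j)(\beta+j+1)\cdots(\beta+n-1)\,x^j$, $n\in\mathbb N_0$, are the monic Laguerre polynomials, i.e. the polynomials of degree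 $n$ with leading coefficient $1$ that are orthogonal with respect to $x^{\beta-1}e^{-x}\,dx$ on $(0,\infty)$. -/

import Mathlib

open MeasureTheory ProbabilityTheory Set
open scoped ENNReal ComplexConjugate

namespace GammaCurrent

noncomputable section

/-! ### Test functions -/

/-- The algebra `𝒞` of test functions: bounded measurable functions `φ : X → ℂ` such that
`{x | φ x ≠ 0}` has finite `α`-measure, with the pointwise operations; `star` is pointwise complex
conjugation. -/
def testFunctions {X : Type*} [MeasurableSpace X] (α : Measure X) :
    NonUnitalStarSubalgebra ℂ (X → ℂ) where
  carrier := {φ | Measurable φ ∧ (∃ C : ℝ, ∀ x, ‖φ x‖ ≤ C) ∧ α {x | φ x ≠ 0} < ∞}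
  add_mem' := by
    rintro f g ⟨hf, ⟨C, hC⟩, hf0⟩ ⟨hg, ⟨D, hD⟩, hg0⟩
    refine ⟨hf.add hg, ⟨C + D, fun x => (norm_add_le _ _).trans (add_le_add (hC x) (hD x))⟩, ?_⟩
    refine (measure_mono (t := {x | f x ≠ 0} ∪ {x | g x ≠ 0}) ?_).trans_lt
      (measure_union_lt_top hf0 hg0)
    intro x hx
    by_contra h
    simp_all
  zero_mem' := ⟨measurable_const, ⟨0, by simp⟩, by simp⟩
  mul_mem' := by
    rintro f g ⟨hf, ⟨C, hC⟩, hf0⟩ ⟨hg, ⟨D, hD⟩, -⟩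
    refine ⟨hf.mul hg, ⟨C * D, fun x => ?_⟩, ?_⟩
    · simp only [Pi.mul_apply, norm_mul]
      exact mul_le_mul (hC x) (hD x) (norm_nonneg _) ((norm_nonneg _).trans (hC x))
    · refine (measure_mono ?_).trans_lt hf0
      intro x hx
      simp_all
  smul_mem' := by
    rintro c f ⟨hf, ⟨C, hC⟩, hf0⟩
    refine ⟨hf.const_smul c, ⟨‖c‖ * C, fun x => ?_⟩, ?_⟩
    · simp only [Pi.smul_apply, norm_smul]
      exact mul_le_mul_of_nonneg_left (hC x) (norm_nonneg _)
    · refine (measure_mono ?_).trans_lt hf0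
      intro x hx
      simp_all
  star_mem' := by
    rintro f ⟨hf, ⟨C, hC⟩, hf0⟩
    refine ⟨Complex.continuous_conj.measurable.comp hf, ⟨C, fun x => ?_⟩, ?_⟩
    · simpa using hC x
    · simpa using hf0

/-- The indicator function of a measurable set of finite `α`-measure, as a test function. -/
def indicatorTest {X : Type*} [MeasurableSpace X] (α : Measure X) (B : Set X)
    (hB : MeasurableSet B) (hα : α B < ∞) : testFunctions α :=
  ⟨B.indicator (fun _ => (1 : ℂ)), measurable_const.indicator hB,
    ⟨1, fun x => by by_cases hx : x ∈ B <;> simp [hx]⟩, by simpa using hα⟩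

/-! ### Fock representations of the `su(1,1)` current algebra -/

/-- `kp φ`, `km φ`, `k0 φ` (raising, lowering, neutral operators, indexed by the test functions)
form a Fock representation of the `su(1,1)` current algebra in the Hilbert space `H`, with common
domain `D` (which they map to itself) and vacuum `Ψ`. The inner product is antilinear in its
first argument. -/
structure IsFockRepresentation {X : Type*} [MeasurableSpace X] (α : Measure X)
    {H : Type*} [NormedAddCommGroup H] [InnerProductSpace ℂ H] [CompleteSpace H]
    (D : Submodule ℂ H) (kp km k0 : testFunctions α → Module.End ℂ D) (Ψ : D) : Prop where
  dense_domain : Dense (D : Set H)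
  raising_add : ∀ φ θ, kp (φ + θ) = kp φ + kp θ
  raising_smul : ∀ (c : ℂ) φ, kp (c • φ) = c • kp φ
  neutral_add : ∀ φ θ, k0 (φ + θ) = k0 φ + k0 θ
  neutral_smul : ∀ (c : ℂ) φ, k0 (c • φ) = c • k0 φ
  lowering_add : ∀ φ θ, km (φ + θ) = km φ + km θ
  lowering_smul : ∀ (c : ℂ) φ, km (c • φ) = conj c • km φ
  comm_lowering_raising : ∀ φ θ, km φ * kp θ - kp θ * km φ = (2 : ℂ) • k0 (star φ * θ)
  comm_neutral_raising : ∀ φ θ, k0 φ * kp θ - kp θ * k0 φ = kp (φ * θ)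
  comm_neutral_lowering : ∀ φ θ, k0 φ * km θ - km θ * k0 φ = -km (star φ * θ)
  comm_raising : ∀ φ θ, kp φ * kp θ - kp θ * kp φ = 0
  comm_lowering : ∀ φ θ, km φ * km θ - km θ * km φ = 0
  comm_neutral : ∀ φ θ, k0 φ * k0 θ - k0 θ * k0 φ = 0
  adjoint_neutral : ∀ φ (f g : D), inner ℂ (f : H) (k0 φ g : H) = inner ℂ (k0 (star φ) f : H) (g : H)
  adjoint_raising : ∀ φ (f g : D), inner ℂ (f : H) (kp φ g : H) = inner ℂ (km φ f : H) (g : H)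
  norm_vacuum : ‖(Ψ : H)‖ = 1
  lowering_vacuum : ∀ φ, km φ Ψ = 0
  /-- The vacuum is cyclic; the empty list of test functions gives `Ψ` itself. -/
  cyclic : Dense (Submodule.span ℂ
    {v : H | ∃ l : List (testFunctions α), v = ((l.map kp).prod Ψ : D)} : Set H)

/-! ### Random measures -/

/-- The space `𝐌` of `s`-finite measures on `X`. As a subtype of `Measure X` it carries the
`σ`-algebra generated by the maps `μ ↦ μ B`, `B` measurable. -/
abbrev SFiniteMeasure (X : Type*) [MeasurableSpace X] : Type _ := {μ : Measure X // SFinite μ}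

/-- The measure `μ + t δ_x` for `t ≥ 0` (for `t < 0` this is `μ`). -/
def addDirac {X : Type*} [MeasurableSpace X] (μ : SFiniteMeasure X) (x : X) (t : ℝ) :
    SFiniteMeasure X :=
  ⟨μ.1 + t.toNNReal • Measure.dirac x, by
    have := μ.2
    infer_instance⟩

/-- The probability measure `ρ` is the law `ρ_α` of the Gamma random measure: masses of disjoint sets are independent, and
`μ(B)` has the Gamma distribution with shape `α(B)` and scale `1`, understood as the point mass at
`0` or `∞` if `α(B)` is `0` or `∞`. -/
structure IsGammaLaw {X : Type*} [MeasurableSpace X] (α : Measure X)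
    (ρ : Measure (SFiniteMeasure X)) : Prop where
  indep : ∀ (n : ℕ) (B : Fin n → Set X), (∀ i, MeasurableSet (B i)) →
    Pairwise (fun i j => Disjoint (B i) (B j)) →
    iIndepFun (fun i (μ : SFiniteMeasure X) => μ.1 (B i)) ρ
  map_eq_gamma : ∀ B : Set X, MeasurableSet B → α B ≠ 0 → α B ≠ ∞ →
    ρ.map (fun μ => μ.1 B) = (gammaMeasure (α B).toReal 1).map ENNReal.ofReal
  eq_zero : ∀ B : Set X, MeasurableSet B → α B = 0 → ∀ᵐ μ ∂ρ, μ.1 B = 0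
  eq_top : ∀ B : Set X, MeasurableSet B → α B = ∞ → ∀ᵐ μ ∂ρ, μ.1 B = ∞

/-! ### Polynomial functionals and functional derivatives -/

/-- Polynomials in the variables `μ ↦ μ(f) = ∫ f dμ`, `f` a test function; every multivariate
polynomial involves finitely many variables, see `mem_polyFunctionals_iff`. -/
def polyFunctionals {X : Type*} [MeasurableSpace X] (α : Measure X) :
    Subalgebra ℂ (SFiniteMeasure X → ℂ) :=
  (MvPolynomial.aeval
    (fun (f : testFunctions α) (μ : SFiniteMeasure X) => ∫ x, (f : X → ℂ) x ∂μ.1)).range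

theorem aeval_fun_eq {σ S : Type*} (g : σ → S → ℂ) (P : MvPolynomial σ ℂ) :
    MvPolynomial.aeval g P = fun s => MvPolynomial.eval (fun i => g i s) P := by
  induction P using MvPolynomial.induction_on with
  | C a => funext μ; simp
  | add p q hp hq => funext μ; simp [hp, hq]
  | mul_X p i hp => funext μ; simp [hp]

theorem mem_polyFunctionals_iff {X : Type*} [MeasurableSpace X] (α : Measure X)
    (F : SFiniteMeasure X → ℂ) :
    F ∈ polyFunctionals α ↔ ∃ (n : ℕ) (f : Fin n → testFunctions α) (P : MvPolynomial (Fin n) ℂ),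
      F = fun μ => MvPolynomial.eval (fun i => ∫ x, (f i : X → ℂ) x ∂μ.1) P := by
  constructor
  · rintro ⟨P, rfl⟩
    obtain ⟨n, f, -, Q, rfl⟩ := MvPolynomial.exists_fin_rename P
    exact ⟨n, f, Q, by simp [MvPolynomial.aeval_rename, aeval_fun_eq, Function.comp_def]⟩
  · rintro ⟨n, f, P, rfl⟩
    exact ⟨MvPolynomial.rename f P,
      by simp [MvPolynomial.aeval_rename, aeval_fun_eq, Function.comp_def]⟩

/-- `δF/δμ(x) (μ)`, the (right) derivative of `t ↦ F(μ + t δ_x)` at `t = 0`. -/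
def funcDeriv {X : Type*} [MeasurableSpace X] (F : SFiniteMeasure X → ℂ) (x : X)
    (μ : SFiniteMeasure X) : ℂ :=
  derivWithin (fun t : ℝ => F (addDirac μ x t)) (Ici 0) 0

/-- `δ²F/δμ(x)² (μ)`, the (right) second derivative of `t ↦ F(μ + t δ_x)` at `t = 0`. -/
def funcDeriv2 {X : Type*} [MeasurableSpace X] (F : SFiniteMeasure X → ℂ) (x : X)
    (μ : SFiniteMeasure X) : ℂ :=
  iteratedDerivWithin 2 (fun t : ℝ => F (addDirac μ x t)) (Ici 0) 0

/-- The expression for the lowering operator `K⁻(φ)`. -/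
def loweringExpr {X : Type*} [MeasurableSpace X] (α : Measure X) (φ : testFunctions α)
    (F : SFiniteMeasure X → ℂ) (μ : SFiniteMeasure X) : ℂ :=
  (∫ x, conj ((φ : X → ℂ) x) * funcDeriv2 F x μ ∂μ.1)
    + ∫ x, conj ((φ : X → ℂ) x) * funcDeriv F x μ ∂α

/-- The expression for the raising operator `K⁺(φ)`. -/
def raisingExpr {X : Type*} [MeasurableSpace X] (α : Measure X) (φ : testFunctions α)
    (F : SFiniteMeasure X → ℂ) (μ : SFiniteMeasure X) : ℂ :=
  (∫ x, (φ : X → ℂ) x * funcDeriv2 F x μ ∂μ.1)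
    + ((∫ x, (φ : X → ℂ) x * funcDeriv F x μ ∂α) - 2 * ∫ x, (φ : X → ℂ) x * funcDeriv F x μ ∂μ.1)
    + ((∫ x, (φ : X → ℂ) x ∂μ.1) - ∫ x, (φ : X → ℂ) x ∂α) * F μ

/-- The expression for the neutral operator `K⁰(φ)`. -/
def neutralExpr {X : Type*} [MeasurableSpace X] (α : Measure X) (φ : testFunctions α)
    (F : SFiniteMeasure X → ℂ) (μ : SFiniteMeasure X) : ℂ :=
  -(∫ x, (φ : X → ℂ) x * funcDeriv2 F x μ ∂μ.1)
    - ((∫ x, (φ : X → ℂ) x * funcDeriv F x μ ∂α) - ∫ x, (φ : X → ℂ) x * funcDeriv F x μ ∂μ.1)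
    + (1 / 2 : ℂ) * (∫ x, (φ : X → ℂ) x ∂α) * F μ

/-! ### The domain in `L²(𝐌, ρ)` -/

/-- The space `𝔻` of (classes of) polynomial functionals in `L²(𝐌, ρ)`. -/
def polyDomain {X : Type*} [MeasurableSpace X] (α : Measure X) (ρ : Measure (SFiniteMeasure X)) :
    Submodule ℂ (Lp ℂ 2 ρ) where
  carrier := {v | ∃ F ∈ polyFunctionals α, v =ᵐ[ρ] F}
  add_mem' := by
    rintro u v ⟨F, hF, huF⟩ ⟨G, hG, hvG⟩
    exact ⟨F + G, add_mem hF hG, (Lp.coeFn_add u v).trans (huF.add hvG)⟩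
  zero_mem' := ⟨0, zero_mem _, Lp.coeFn_zero ℂ 2 ρ⟩
  smul_mem' := by
    rintro c v ⟨F, hF, hvF⟩
    exact ⟨c • F, Subalgebra.smul_mem _ hF c, (Lp.coeFn_smul c v).trans (hvF.const_smul c)⟩

/-- The vacuum: the constant function `1`. -/
def vacuum {X : Type*} [MeasurableSpace X] (α : Measure X) (ρ : Measure (SFiniteMeasure X))
    [IsFiniteMeasure ρ] : polyDomain α ρ :=
  ⟨Lp.const 2 ρ 1, 1, one_mem _, Lp.coeFn_const 2 ρ (1 : ℂ)⟩

/-- The operator `T` on `𝔻` is given by the expression `A`: whenever the polynomial functional `F`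
represents `v ∈ 𝔻`, the function `A F` represents `T v`. -/
def IsGivenBy {X : Type*} [MeasurableSpace X] {α : Measure X} {ρ : Measure (SFiniteMeasure X)}
    (T : Module.End ℂ (polyDomain α ρ))
    (A : (SFiniteMeasure X → ℂ) → SFiniteMeasure X → ℂ) : Prop :=
  ∀ F ∈ polyFunctionals α, ∀ v : polyDomain α ρ,
    (v : Lp ℂ 2 ρ) =ᵐ[ρ] F → (T v : Lp ℂ 2 ρ) =ᵐ[ρ] A F

/-! ### Monic Laguerre polynomials -/

/-- The monic Laguerre polynomial `ℒ_n^{(a)} = (-1)^n n! L_n^{(a)}`, where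
`L_n^{(a)}(x) = ((a+1)_n / n!) ∑_{j ≤ n} ((-n)_j / (a+1)_j) x^j / j!`. Here
`(a+1)_n / (a+1)_j` is written as `(a+1+j)_{n-j}`, and `(-n)_j / j! = (-1)^j (n choose j)`. -/
def monicLaguerre (a : ℝ) (n : ℕ) : Polynomial ℝ :=
  ∑ j ∈ Finset.range (n + 1), Polynomial.C
    ((-1) ^ (n + j) * (n.choose j : ℝ) * (ascPochhammer ℝ (n - j)).eval (a + 1 + j)) *
      Polynomial.X ^ j

end

end GammaCurrent

/-! All three currents are built from multiplication `M_φ` by `μ(φ)`, the first order operator `D_φ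
F = ∫ φ δF/δμ dμ`, and the second order operator `L_φ F = ∫ φ δ²F/δμ² dμ + ∫ φ δF/δμ dα`, namely
`K⁺(φ) = L_φ - 2 D_φ + M_φ - α(φ)`, `K⁻(φ) = L_φ̄` and `K⁰(φ) = D_φ - L_φ + α(φ)/2`.

Algebra. In the polynomial ring with one formal variable `X_g` per test function, `D` and `L` are
determined by `D 1 = L 1 = 0` and the commutators `[D_φ, X_g] = X_{φg}`, `[L_φ, X_g] = 2 D_{φg} +
α(φg)`. Induction over products of variables gives `[D_θ, L_φ] = -L_{θφ}`, and that the `D`s commute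
among themselves, as do the `L`s (`scaleDeriv_lowerOp`, `scaleDeriv_comm`, `lowerOp_comm`). The
current algebra relations follow from these identities alone, using only that the test functions
form a commutative semigroup.

Probability. The law enters the adjoint relations through one integration by parts formula, `E(D_φ
P) = E((μ(φ) - α(φ)) P)` (`IsGammaLaw.integrationByParts`). For step functions it is the moment
recursion `E Y^{k+1} = (β + k) E Y^k` of independent Gamma variables; dominated convergence gives
the general case. Since the carré du champ `∫ φ δF δG dμ` is symmetric, the formula makes `K⁺(φ)`
the transpose of `L_φ` and `K⁰(φ)` its own transpose. An operator with a transpose preserves the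
polynomials that vanish almost everywhere, so `D`, `L` and `M` descend to classes in `L²`. This
gives well-definedness on `𝔻`, and only after this passage is the dependence on `φ` linear, as
`X_{f+g}` and `X_f + X_g` are different formal polynomials.

Density. The masses have exponential moments, so a function of `L²` orthogonal to all polynomials is
orthogonal to every `exp(i μ(f))` with `f` real, hence zero by uniqueness of characteristic
functions of finite families of masses. For cyclicity, `K⁺(g) P` equals `X_g P` plus terms of degree
at most `deg P`, so the vectors created from the vacuum span all of `𝔻`.

Laguerre polynomials. For `φ = 1_B` with `β = α(B)`, idempotency of `φ` reduces `K⁺(φ)` on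
polynomials in `μ(B)` to `p ↦ x p'' + (β - 2x) p' + (x - β) p`, which sends each monic Laguerre
polynomial to the next. For disjoint sets `K⁺(1_A)` commutes with multiplication by `μ(B)`, so the
product splits. -/

namespace GammaCurrent

noncomputable section

/-! ### Formal polynomials and the operators on them -/

open MvPolynomial

section Formal

variable {σ : Type*} [CommSemigroup σ]

/-- The derivation `X_g ↦ X_{φ g}` of the formal polynomials; it corresponds to
`F ↦ ∫ φ(x) δF/δμ(x) μ(dx)`. -/
def scaleDeriv (φ : σ) : Derivation ℂ (MvPolynomial σ ℂ) (MvPolynomial σ ℂ) :=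
  mkDerivation ℂ fun g => X (φ * g)

/-- The universal derivation `P ↦ (∂_g P)_g`. -/
def gradient (σ : Type*) : Derivation ℂ (MvPolynomial σ ℂ) (σ →₀ MvPolynomial σ ℂ) :=
  mkDerivation ℂ fun g => Finsupp.single g 1

/-- `(w_g)_g ↦ ∑_g X_{φ g} w_g`. -/
def contract (φ : σ) : (σ →₀ MvPolynomial σ ℂ) →ₗ[ℂ] MvPolynomial σ ℂ :=
  Finsupp.lsum ℂ fun g => LinearMap.mulLeft ℂ (X (φ * g))

/-- `(w_g)_g ↦ ∑_g (D_{φ g} w_g + a(φ g) w_g)`, with `D` the derivations `scaleDeriv`. -/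
def divergence (a : σ → ℂ) (φ : σ) : (σ →₀ MvPolynomial σ ℂ) →ₗ[ℂ] MvPolynomial σ ℂ :=
  Finsupp.lsum ℂ fun g => (scaleDeriv (φ * g) : MvPolynomial σ ℂ →ₗ[ℂ] MvPolynomial σ ℂ)
    + a (φ * g) • LinearMap.id

/-- The second order operator corresponding to
`F ↦ ∫ φ(x) δ²F/δμ(x)² μ(dx) + ∫ φ(x) δF/δμ(x) α(dx)`. -/
def lowerOp (a : σ → ℂ) (φ : σ) : MvPolynomial σ ℂ →ₗ[ℂ] MvPolynomial σ ℂ :=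
  divergence a φ ∘ₗ (gradient σ : MvPolynomial σ ℂ →ₗ[ℂ] σ →₀ MvPolynomial σ ℂ)

/-- The bilinear form `∑_g D_{φ g} F ∂_g G`. -/
def carreDuChamp (φ : σ) (F G : MvPolynomial σ ℂ) : MvPolynomial σ ℂ :=
  (gradient σ G).sum fun g w => scaleDeriv (φ * g) F * w

@[simp] lemma scaleDeriv_X (φ g : σ) : scaleDeriv φ (X g) = X (φ * g) := mkDerivation_X _ _ _

omit [CommSemigroup σ] in
@[simp] lemma gradient_X (g : σ) : gradient σ (X g) = Finsupp.single g 1 := mkDerivation_X _ _ _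

lemma scaleDeriv_X_mul (φ g : σ) (P : MvPolynomial σ ℂ) :
    scaleDeriv φ (X g * P) = X g * scaleDeriv φ P + X (φ * g) * P := by
  rw [Derivation.leibniz, scaleDeriv_X, smul_eq_mul, smul_eq_mul, mul_comm P]

omit [CommSemigroup σ] in
lemma gradient_X_mul (g : σ) (P : MvPolynomial σ ℂ) :
    gradient σ (X g * P) = (X g : MvPolynomial σ ℂ) • gradient σ P + Finsupp.single g P := by
  rw [Derivation.leibniz, gradient_X]
  simp

@[simp] lemma contract_single (φ g : σ) (w : MvPolynomial σ ℂ) :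
    contract φ (Finsupp.single g w) = X (φ * g) * w := by
  simp [contract]

@[simp] lemma divergence_single (a : σ → ℂ) (φ g : σ) (w : MvPolynomial σ ℂ) :
    divergence a φ (Finsupp.single g w) = scaleDeriv (φ * g) w + C (a (φ * g)) * w := by
  simp [divergence, smul_eq_C_mul]

omit [CommSemigroup σ] in
/-- Two linear operators on polynomials agree if they agree at `1` and the agreement passes from
`P` to `X_g P`. -/
lemma eq_of_one_of_X_mul {M : Type*} [AddCommGroup M] [Module ℂ M]
    {S T : MvPolynomial σ ℂ →ₗ[ℂ] M} (h1 : S 1 = T 1)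
    (hX : ∀ g P, S P = T P → S (X g * P) = T (X g * P)) (P : MvPolynomial σ ℂ) : S P = T P := by
  induction P using MvPolynomial.induction_on with
  | C c =>
    have : (C c : MvPolynomial σ ℂ) = c • 1 := by rw [smul_eq_C_mul, mul_one]
    rw [this, map_smul, map_smul, h1]
  | add p q hp hq => rw [map_add, map_add, hp, hq]
  | mul_X p g hp => rw [mul_comm]; exact hX g p hp

lemma contract_smul (φ g : σ) (w : σ →₀ MvPolynomial σ ℂ) :
    contract φ ((X g : MvPolynomial σ ℂ) • w) = X g * contract φ w := by
  induction w using Finsupp.induction_linear with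
  | zero => simp
  | add u v hu hv => rw [smul_add, map_add, map_add, hu, hv, mul_add]
  | single h w => rw [Finsupp.smul_single, contract_single, contract_single, smul_eq_mul]; ring

lemma contract_gradient (φ : σ) (P : MvPolynomial σ ℂ) :
    contract φ (gradient σ P) = scaleDeriv φ P := by
  refine eq_of_one_of_X_mul (S := contract φ ∘ₗ (gradient σ).toLinearMap)
    (T := (scaleDeriv φ).toLinearMap) (by simp) (fun g P h => ?_) P
  simp only [LinearMap.comp_apply, Derivation.coeFn_coe] at h ⊢
  rw [gradient_X_mul, map_add, contract_smul, h, contract_single, scaleDeriv_X_mul]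

/-- Each `D_{φh}` is a derivation, so moving `X_g` past it costs `X_{φhg} w_h`; these terms add up
to the contraction. -/
lemma divergence_smul (a : σ → ℂ) (φ g : σ) (w : σ →₀ MvPolynomial σ ℂ) :
    divergence a φ ((X g : MvPolynomial σ ℂ) • w)
      = X g * divergence a φ w + contract (φ * g) w := by
  induction w using Finsupp.induction_linear with
  | zero => simp
  | add u v hu hv => rw [smul_add, map_add, map_add, map_add, hu, hv]; ring
  | single h w =>
    rw [Finsupp.smul_single, divergence_single, divergence_single, contract_single, smul_eq_mul,
      scaleDeriv_X_mul, mul_right_comm φ h g]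
    ring

@[simp] lemma lowerOp_one (a : σ → ℂ) (φ : σ) : lowerOp a φ 1 = 0 := by
  simp [lowerOp]

/-- The commutator of `L_φ` with `X_g`. The factor 2 has two sources: the derivation in the
divergence hitting `X_g`, and the new gradient component at `g`. With `lowerOp_one` this determines
`L_φ`. -/
lemma lowerOp_X_mul (a : σ → ℂ) (φ g : σ) (P : MvPolynomial σ ℂ) :
    lowerOp a φ (X g * P)
      = X g * lowerOp a φ P + 2 * scaleDeriv (φ * g) P + C (a (φ * g)) * P := by
  simp only [lowerOp, LinearMap.comp_apply, Derivation.coeFn_coe]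
  rw [gradient_X_mul, map_add, divergence_smul, divergence_single, contract_gradient]
  ring

lemma scaleDeriv_comm (φ θ : σ) (P : MvPolynomial σ ℂ) :
    scaleDeriv φ (scaleDeriv θ P) = scaleDeriv θ (scaleDeriv φ P) := by
  refine eq_of_one_of_X_mul (S := (scaleDeriv φ).toLinearMap ∘ₗ (scaleDeriv θ).toLinearMap)
    (T := (scaleDeriv θ).toLinearMap ∘ₗ (scaleDeriv φ).toLinearMap) (by simp) (fun g P h => ?_) P
  simp only [LinearMap.comp_apply, Derivation.coeFn_coe] at h ⊢
  rw [scaleDeriv_X_mul, scaleDeriv_X_mul, map_add, map_add, scaleDeriv_X_mul, scaleDeriv_X_mul,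
    scaleDeriv_X_mul, scaleDeriv_X_mul, h, mul_left_comm]
  ring

omit [CommSemigroup σ] in
lemma C_mul_eq_smul (c : ℂ) (P : MvPolynomial σ ℂ) : C c * P = c • P := (smul_eq_C_mul P c).symm

omit [CommSemigroup σ] in
lemma two_mul_eq_smul (P : MvPolynomial σ ℂ) : 2 * P = (2 : ℂ) • P := by
  rw [smul_eq_C_mul, map_ofNat]

/-- The relation `[D_θ, L_φ] = -L_{θφ}`: `D` behaves like a degree operator and `L` lowers the
degree by one. It is the source of `[K⁰, K⁻]`. -/
lemma scaleDeriv_lowerOp (a : σ → ℂ) (φ θ : σ) (P : MvPolynomial σ ℂ) :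
    scaleDeriv θ (lowerOp a φ P) = lowerOp a φ (scaleDeriv θ P) - lowerOp a (θ * φ) P := by
  refine eq_of_one_of_X_mul (S := (scaleDeriv θ).toLinearMap ∘ₗ lowerOp a φ)
    (T := lowerOp a φ ∘ₗ (scaleDeriv θ).toLinearMap - lowerOp a (θ * φ)) (by simp)
    (fun g P h => ?_) P
  simp only [LinearMap.comp_apply, LinearMap.sub_apply, Derivation.coeFn_coe] at h ⊢
  rw [scaleDeriv_X_mul, map_add, lowerOp_X_mul, lowerOp_X_mul, lowerOp_X_mul, lowerOp_X_mul]
  simp only [C_mul_eq_smul, two_mul_eq_smul]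
  rw [map_add, map_add, Derivation.map_smul, Derivation.map_smul, scaleDeriv_X_mul, h,
    scaleDeriv_comm θ (φ * g),
    mul_left_comm φ θ g, mul_assoc θ φ g]
  ring

/-- Expanding both orders on `X_g P` leaves cross terms `D L`; `scaleDeriv_lowerOp` turns them into
`L D` up to the same `L_{φθg}`, after which everything is symmetric in `φ` and `θ`. -/
lemma lowerOp_comm (a : σ → ℂ) (φ θ : σ) (P : MvPolynomial σ ℂ) :
    lowerOp a φ (lowerOp a θ P) = lowerOp a θ (lowerOp a φ P) := by
  refine eq_of_one_of_X_mul (S := lowerOp a φ ∘ₗ lowerOp a θ)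
    (T := lowerOp a θ ∘ₗ lowerOp a φ) (by simp) (fun g P h => ?_) P
  simp only [LinearMap.comp_apply] at h ⊢
  rw [lowerOp_X_mul, lowerOp_X_mul]
  simp only [C_mul_eq_smul, two_mul_eq_smul]
  rw [map_add, map_add, map_smul, map_smul, map_add, map_add, map_smul, map_smul, lowerOp_X_mul,
    lowerOp_X_mul]
  simp only [C_mul_eq_smul, two_mul_eq_smul]
  rw [h, scaleDeriv_lowerOp, scaleDeriv_lowerOp, mul_right_comm θ g φ, mul_right_comm φ g θ,
    mul_comm θ φ]
  simp only [smul_sub]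
  ring

/-! ### Transposes with respect to a functional satisfying integration by parts -/

lemma carreDuChamp_add_right (φ : σ) (F G H : MvPolynomial σ ℂ) :
    carreDuChamp φ F (G + H) = carreDuChamp φ F G + carreDuChamp φ F H := by
  classical
  rw [carreDuChamp, map_add, Finsupp.sum_add_index' (by simp) (by intros; ring)]
  rfl

lemma carreDuChamp_smul_right (φ : σ) (c : ℂ) (F G : MvPolynomial σ ℂ) :
    carreDuChamp φ F (c • G) = c • carreDuChamp φ F G := by
  rw [carreDuChamp, Derivation.map_smul, Finsupp.sum_smul_index' (by simp), carreDuChamp,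
    Finsupp.smul_sum]
  simp

lemma carreDuChamp_X_mul_right (φ g : σ) (F G : MvPolynomial σ ℂ) :
    carreDuChamp φ F (X g * G) = X g * carreDuChamp φ F G + scaleDeriv (φ * g) F * G := by
  classical
  rw [carreDuChamp, gradient_X_mul, Finsupp.sum_add_index' (by simp) (by intros; ring),
    Finsupp.sum_single_index (by simp), Finsupp.sum_smul_index' (by simp), carreDuChamp,
    Finsupp.mul_sum]
  simp only [smul_eq_mul, mul_left_comm]

lemma carreDuChamp_add_left (φ : σ) (F G H : MvPolynomial σ ℂ) :
    carreDuChamp φ (F + G) H = carreDuChamp φ F H + carreDuChamp φ G H := by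
  simp [carreDuChamp, add_mul, Finsupp.sum_add]

lemma carreDuChamp_smul_left (φ : σ) (c : ℂ) (F G : MvPolynomial σ ℂ) :
    carreDuChamp φ (c • F) G = c • carreDuChamp φ F G := by
  rw [carreDuChamp, carreDuChamp, Finsupp.smul_sum]
  simp

lemma carreDuChamp_X_mul_left (φ g : σ) (F G : MvPolynomial σ ℂ) :
    carreDuChamp φ (X g * F) G = X g * carreDuChamp φ F G + F * scaleDeriv (φ * g) G := by
  rw [← contract_gradient, contract, carreDuChamp, carreDuChamp, Finsupp.coe_lsum, Finsupp.mul_sum,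
    Finsupp.mul_sum, ← Finsupp.sum_add]
  refine Finsupp.sum_congr fun h _ => ?_
  rw [scaleDeriv_X_mul, LinearMap.mulLeft_apply, mul_right_comm φ h g]
  ring

/-- `carreDuChamp` as a bilinear map. -/
def carreDuChampₗ (φ : σ) : MvPolynomial σ ℂ →ₗ[ℂ] MvPolynomial σ ℂ →ₗ[ℂ] MvPolynomial σ ℂ :=
  LinearMap.mk₂ ℂ (carreDuChamp φ) (carreDuChamp_add_left φ) (carreDuChamp_smul_left φ)
    (carreDuChamp_add_right φ) (carreDuChamp_smul_right φ)

lemma carreDuChamp_one_right (φ : σ) (F : MvPolynomial σ ℂ) : carreDuChamp φ F 1 = 0 := by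
  simp [carreDuChamp]

lemma carreDuChamp_one_left (φ : σ) (F : MvPolynomial σ ℂ) : carreDuChamp φ 1 F = 0 := by
  simp [carreDuChamp]

/-- The form stands for `∫ φ(x) δF/δμ(x) δG/δμ(x) μ(dx)`, whose symmetry is hidden in the one-sided
formal definition. It makes the second order part of `L_φ` its own transpose. -/
lemma carreDuChamp_comm (φ : σ) (F G : MvPolynomial σ ℂ) :
    carreDuChamp φ F G = carreDuChamp φ G F := by
  refine eq_of_one_of_X_mul (S := carreDuChampₗ φ F) (T := (carreDuChampₗ φ).flip F)
    ?_ (fun g P h => ?_) G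
  · simp [carreDuChampₗ, carreDuChamp_one_left, carreDuChamp_one_right]
  · simp only [carreDuChampₗ, LinearMap.mk₂_apply, LinearMap.flip_apply] at h ⊢
    rw [carreDuChamp_X_mul_left, carreDuChamp_X_mul_right, h]
    ring

/-- Integration by parts for the functional `E`: it characterizes the Gamma measure. -/
def IntegrationByParts (a : σ → ℂ) (E : MvPolynomial σ ℂ →ₗ[ℂ] ℂ) : Prop :=
  ∀ φ P, E (scaleDeriv φ P) = E ((X φ - C (a φ)) * P)

variable {a : σ → ℂ} {E : MvPolynomial σ ℂ →ₗ[ℂ] ℂ}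

/-- Apply the integration by parts hypothesis to the product `F G`: the transpose of `D_φ` is `X_φ -
a(φ) - D_φ`. -/
lemma IntegrationByParts.scaleDeriv_mul (hE : IntegrationByParts a E) (φ : σ)
    (F G : MvPolynomial σ ℂ) :
    E (scaleDeriv φ F * G) = E (F * ((X φ - C (a φ)) * G - scaleDeriv φ G)) := by
  have h := hE φ (F * G)
  rw [Derivation.leibniz, map_add, smul_eq_mul, smul_eq_mul, mul_comm G] at h
  rw [mul_sub, map_sub, mul_left_comm F, ← h]
  ring

/-- Transposing each `D_{φg}` produces `-a(φg)`, which cancels the constant built into the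
divergence. -/
lemma IntegrationByParts.mul_divergence (hE : IntegrationByParts a E) (φ : σ)
    (F : MvPolynomial σ ℂ) (w : σ →₀ MvPolynomial σ ℂ) :
    E (F * divergence a φ w)
      = E (F * contract φ w) - E (w.sum fun g u => scaleDeriv (φ * g) F * u) := by
  classical
  induction w using Finsupp.induction_linear with
  | zero => simp
  | add u v hu hv =>
    rw [map_add, mul_add, map_add, hu, hv, map_add, mul_add, map_add,
      Finsupp.sum_add_index' (by simp) (by intros; ring), map_add]
    ring
  | single g u =>
    rw [divergence_single, contract_single, Finsupp.sum_single_index (by simp),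
      hE.scaleDeriv_mul, ← map_sub]
    congr 1
    ring

lemma IntegrationByParts.mul_lowerOp (hE : IntegrationByParts a E) (φ : σ)
    (F G : MvPolynomial σ ℂ) :
    E (F * lowerOp a φ G) = E (F * scaleDeriv φ G) - E (carreDuChamp φ F G) := by
  rw [lowerOp, LinearMap.comp_apply, Derivation.coeFn_coe, hE.mul_divergence, contract_gradient]
  rfl

/-- The transpose of the lowering operator is the raising operator. -/
lemma IntegrationByParts.lowerOp_mul (hE : IntegrationByParts a E) (φ : σ)
    (F G : MvPolynomial σ ℂ) :
    E (lowerOp a φ F * G)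
      = E (F * (lowerOp a φ G - 2 * scaleDeriv φ G + (X φ - C (a φ)) * G)) := by
  have h1 := hE.mul_lowerOp φ G F
  have h2 := hE.mul_lowerOp φ F G
  have h3 := hE.scaleDeriv_mul φ F G
  -- By symmetry the carré du champ terms of `h1` and `h2` cancel, so the two transposes differ only
  -- in first order terms, which `h3` evaluates.
  rw [carreDuChamp_comm] at h1
  rw [mul_sub F, map_sub] at h3
  rw [mul_comm, h1, mul_comm G, h3, mul_add, mul_sub F, map_add, map_sub, h2, mul_left_comm F 2,
    two_mul_eq_smul, map_smul, smul_eq_mul]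
  ring

/-! ### The length filtration -/

/-- The polynomials of degree at most `n`. -/
def degreeLE (σ : Type*) (n : ℕ) : Submodule ℂ (MvPolynomial σ ℂ) :=
  Submodule.span ℂ {P | ∃ l : List σ, l.length ≤ n ∧ P = (l.map X).prod}

omit [CommSemigroup σ] in
lemma degreeLE_mono : Monotone (degreeLE σ) := fun _ _ h =>
  Submodule.span_mono fun _ ⟨l, hl, hP⟩ => ⟨l, hl.trans h, hP⟩

omit [CommSemigroup σ] in
lemma X_mul_mem_degreeLE (g : σ) {n : ℕ} {P : MvPolynomial σ ℂ} (hP : P ∈ degreeLE σ n) :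
    X g * P ∈ degreeLE σ (n + 1) := by
  induction hP using Submodule.span_induction with
  | mem P h =>
    obtain ⟨l, hl, rfl⟩ := h
    exact Submodule.subset_span ⟨g :: l, by simpa using hl, by simp⟩
  | zero => simp
  | add p q _ _ hp hq => rw [mul_add]; exact add_mem hp hq
  | smul c p _ hp => rw [mul_smul_comm]; exact Submodule.smul_mem _ c hp

omit [CommSemigroup σ] in
lemma exists_mem_degreeLE (P : MvPolynomial σ ℂ) : ∃ n, P ∈ degreeLE σ n := by
  induction P using MvPolynomial.induction_on with
  | C c =>
    refine ⟨0, ?_⟩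
    rw [← mul_one (C c), ← smul_eq_C_mul]
    exact Submodule.smul_mem _ c (Submodule.subset_span ⟨[], by simp, by simp⟩)
  | add p q hp hq =>
    obtain ⟨m, hm⟩ := hp
    obtain ⟨n, hn⟩ := hq
    exact ⟨max m n, add_mem (degreeLE_mono (le_max_left _ _) hm)
      (degreeLE_mono (le_max_right _ _) hn)⟩
  | mul_X p g hp =>
    obtain ⟨n, hn⟩ := hp
    exact ⟨n + 1, by rw [mul_comm]; exact X_mul_mem_degreeLE g hn⟩

lemma scaleDeriv_mem_degreeLE (φ : σ) {n : ℕ} {P : MvPolynomial σ ℂ} (hP : P ∈ degreeLE σ n) :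
    scaleDeriv φ P ∈ degreeLE σ n := by
  induction hP using Submodule.span_induction with
  | mem P h =>
    obtain ⟨l, hl, rfl⟩ := h
    refine degreeLE_mono hl ?_
    clear hl
    induction l with
    | nil => simp
    | cons g l ih =>
      rw [List.map_cons, List.prod_cons, scaleDeriv_X_mul]
      exact add_mem (X_mul_mem_degreeLE g ih)
        (X_mul_mem_degreeLE _ (Submodule.subset_span ⟨l, le_rfl, rfl⟩))
  | zero => simp
  | add p q _ _ hp hq => rw [map_add]; exact add_mem hp hq
  | smul c p _ hp => rw [Derivation.map_smul]; exact Submodule.smul_mem _ c hp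

/-- `L_φ` in fact lowers the degree by one; for cyclicity it suffices that it does not raise it. -/
lemma lowerOp_mem_degreeLE (a : σ → ℂ) (φ : σ) {n : ℕ} {P : MvPolynomial σ ℂ}
    (hP : P ∈ degreeLE σ n) : lowerOp a φ P ∈ degreeLE σ n := by
  induction hP using Submodule.span_induction with
  | mem P h =>
    obtain ⟨l, hl, rfl⟩ := h
    refine degreeLE_mono hl ?_
    clear hl
    induction l with
    | nil => simp
    | cons g l ih =>
      have hm : (l.map (X : σ → MvPolynomial σ ℂ)).prod ∈ degreeLE σ l.length :=
        Submodule.subset_span ⟨l, le_rfl, rfl⟩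
      have hle : l.length ≤ l.length + 1 := Nat.le_succ _
      rw [List.map_cons, List.prod_cons, lowerOp_X_mul, two_mul_eq_smul, C_mul_eq_smul]
      exact add_mem (add_mem (X_mul_mem_degreeLE g ih) (Submodule.smul_mem _ _
        (degreeLE_mono hle (scaleDeriv_mem_degreeLE _ hm))))
        (Submodule.smul_mem _ _ (degreeLE_mono hle hm))
  | zero => simp
  | add p q _ _ hp hq => rw [map_add]; exact add_mem hp hq
  | smul c p _ hp => rw [map_smul]; exact Submodule.smul_mem _ c hp

end Formal

end

end GammaCurrent

namespace GammaCurrent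

noncomputable section

/-! ### Moments of the Gamma distribution -/

lemma integrableOn_pow_mul_gammaWeight {β : ℝ} (hβ : 0 < β) (k : ℕ) :
    IntegrableOn (fun x : ℝ => x ^ k * (x ^ (β - 1) * Real.exp (-x))) (Ioi 0) := by
  have h := Real.GammaIntegral_convergent (s := β + k) (by positivity)
  refine h.congr_fun (fun x hx => ?_) measurableSet_Ioi
  have hx : (0 : ℝ) < x := hx
  simp only
  rw [show β + k - 1 = k + (β - 1) by ring, Real.rpow_add hx, Real.rpow_natCast]
  ring

lemma integral_pow_mul_gammaWeight {β : ℝ} (hβ : 0 < β) (k : ℕ) :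
    ∫ x in Ioi (0 : ℝ), x ^ k * (x ^ (β - 1) * Real.exp (-x)) = Real.Gamma (β + k) := by
  rw [Real.Gamma_eq_integral (by positivity)]
  refine setIntegral_congr_fun measurableSet_Ioi fun x hx => ?_
  have hx : (0 : ℝ) < x := hx
  rw [show β + k - 1 = k + (β - 1) by ring, Real.rpow_add hx, Real.rpow_natCast]
  ring

/-- The density lives on `[0, ∞)`; discarding the null set `{0}` puts it on the domain of Euler's
integral. -/
lemma gammaMeasure_one_eq (a : ℝ) :
    gammaMeasure a 1 = (volume.restrict (Ioi 0)).withDensity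
      (fun x => ENNReal.ofReal ((Real.Gamma a)⁻¹ * (x ^ (a - 1) * Real.exp (-x)))) := by
  rw [gammaMeasure, ← Measure.restrict_congr_set Ioi_ae_eq_Ici.symm,
    ← withDensity_indicator measurableSet_Ici]
  congr 1
  ext x
  by_cases hx : 0 ≤ x
  · rw [gammaPDF_of_nonneg hx, indicator_of_mem (mem_Ici.2 hx)]
    simp [mul_assoc]
  · rw [gammaPDF_of_neg (not_le.1 hx), indicator_of_notMem (by simpa using hx)]

lemma measurable_gammaDensity (a : ℝ) :
    Measurable fun x : ℝ => ENNReal.ofReal ((Real.Gamma a)⁻¹ * (x ^ (a - 1) * Real.exp (-x))) := by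
  fun_prop

lemma gammaDensity_nonneg {a x : ℝ} (ha : 0 < a) (hx : 0 < x) :
    0 ≤ (Real.Gamma a)⁻¹ * (x ^ (a - 1) * Real.exp (-x)) := by
  have := Real.Gamma_pos_of_pos ha
  positivity

lemma integrable_gammaMeasure_iff {a : ℝ} (ha : 0 < a) {f : ℝ → ℝ} :
    Integrable f (gammaMeasure a 1) ↔
      IntegrableOn (fun x => (Real.Gamma a)⁻¹ * (x ^ (a - 1) * Real.exp (-x)) * f x) (Ioi 0) := by
  rw [gammaMeasure_one_eq, integrable_withDensity_iff_integrable_smul' (measurable_gammaDensity a)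
    (by simp), IntegrableOn]
  refine integrable_congr ?_
  filter_upwards [ae_restrict_mem measurableSet_Ioi] with x hx
  rw [ENNReal.toReal_ofReal (gammaDensity_nonneg ha hx), smul_eq_mul]

lemma integral_gammaMeasure {a : ℝ} (ha : 0 < a) (f : ℝ → ℝ) :
    ∫ x, f x ∂gammaMeasure a 1
      = ∫ x in Ioi (0 : ℝ), (Real.Gamma a)⁻¹ * (x ^ (a - 1) * Real.exp (-x)) * f x := by
  rw [gammaMeasure_one_eq, integral_withDensity_eq_integral_toReal_smul (measurable_gammaDensity a)
    (by simp)]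
  refine setIntegral_congr_fun measurableSet_Ioi fun x hx => ?_
  rw [ENNReal.toReal_ofReal (gammaDensity_nonneg ha hx), smul_eq_mul]

lemma integral_pow_gammaMeasure {a : ℝ} (ha : 0 < a) (k : ℕ) :
    ∫ x, x ^ k ∂gammaMeasure a 1 = Real.Gamma (a + k) / Real.Gamma a := by
  rw [integral_gammaMeasure ha, ← integral_pow_mul_gammaWeight ha, div_eq_inv_mul,
    ← integral_const_mul]
  congr 1 with x
  ring

/-- The functional equation of the Gamma function. Integration by parts for the random measure rests
on this recursion. -/
lemma integral_pow_succ_gammaMeasure {a : ℝ} (ha : 0 < a) (k : ℕ) :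
    ∫ x, x ^ (k + 1) ∂gammaMeasure a 1 = (a + k) * ∫ x, x ^ k ∂gammaMeasure a 1 := by
  rw [integral_pow_gammaMeasure ha, integral_pow_gammaMeasure ha, Nat.cast_succ, ← add_assoc,
    Real.Gamma_add_one (by positivity)]
  ring

lemma integrable_exp_gammaMeasure {a : ℝ} (ha : 0 < a) {t : ℝ} (ht : t < 1) :
    Integrable (fun x => Real.exp (t * x)) (gammaMeasure a 1) := by
  rw [integrable_gammaMeasure_iff ha]
  have h := integrableOn_rpow_mul_exp_neg_mul_rpow (s := a - 1) (p := 1) (b := 1 - t) (by linarith)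
    one_pos (by linarith)
  refine IntegrableOn.congr_fun (h.const_mul (Real.Gamma a)⁻¹) (fun x hx => ?_) measurableSet_Ioi
  simp only [Real.rpow_one]
  rw [show -(1 - t) * x = -x + t * x by ring, Real.exp_add]
  ring

lemma ae_nonneg_gammaMeasure (a : ℝ) : ∀ᵐ x ∂gammaMeasure a 1, 0 ≤ x := by
  rw [gammaMeasure_one_eq]
  refine (withDensity_absolutelyContinuous _ _).ae_le ?_
  filter_upwards [ae_restrict_mem measurableSet_Ioi] with x hx using le_of_lt hx

/-! ### Masses of sets of finite control measure -/

variable {X : Type*} [MeasurableSpace X] {α : Measure X} {ρ : Measure (SFiniteMeasure X)}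

/-- The mass `μ(B)` as a real number. -/
def mass (B : Set X) (μ : SFiniteMeasure X) : ℝ := (μ.1 B).toReal

lemma measurable_apply {B : Set X} (hB : MeasurableSet B) :
    Measurable fun μ : SFiniteMeasure X => μ.1 B :=
  (Measure.measurable_coe hB).comp measurable_subtype_coe

lemma measurable_mass {B : Set X} (hB : MeasurableSet B) :
    Measurable (mass B : SFiniteMeasure X → ℝ) :=
  (measurable_apply hB).ennreal_toReal

namespace IsGammaLaw

lemma map_mass (hρ : IsGammaLaw α ρ) {B : Set X} (hB : MeasurableSet B) (h0 : α B ≠ 0)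
    (hfin : α B ≠ ∞) : ρ.map (mass B) = gammaMeasure (α B).toReal 1 := by
  have h := hρ.map_eq_gamma B hB h0 hfin
  have h1 : ρ.map (mass B) = (ρ.map (fun μ => μ.1 B)).map ENNReal.toReal :=
    (Measure.map_map ENNReal.measurable_toReal (measurable_apply hB)).symm
  rw [h1, h, Measure.map_map ENNReal.measurable_toReal ENNReal.measurable_ofReal]
  conv_rhs => rw [← Measure.map_id (μ := gammaMeasure (α B).toReal 1)]
  refine Measure.map_congr ?_
  filter_upwards [ae_nonneg_gammaMeasure _] with x hx using ENNReal.toReal_ofReal hx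

lemma ae_lt_top (hρ : IsGammaLaw α ρ) {B : Set X} (hB : MeasurableSet B) (hfin : α B ≠ ∞) :
    ∀ᵐ μ ∂ρ, μ.1 B < ∞ := by
  by_cases h0 : α B = 0
  · filter_upwards [hρ.eq_zero B hB h0] with μ hμ
    simp [hμ]
  · have h := hρ.map_eq_gamma B hB h0 hfin
    have h2 : ∀ᵐ x ∂(ρ.map fun μ => μ.1 B), x < ∞ := by
      rw [h, ae_map_iff ENNReal.measurable_ofReal.aemeasurable measurableSet_Iio]
      simp
    exact ae_of_ae_map (measurable_apply hB).aemeasurable h2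

lemma ae_mass_eq_zero (hρ : IsGammaLaw α ρ) {B : Set X} (hB : MeasurableSet B) (h0 : α B = 0) :
    mass B =ᵐ[ρ] 0 := by
  filter_upwards [hρ.eq_zero B hB h0] with μ hμ
  simp [mass, hμ]

lemma integrable_exp_mass [IsFiniteMeasure ρ] (hρ : IsGammaLaw α ρ) {B : Set X}
    (hB : MeasurableSet B) (hfin : α B ≠ ∞) {t : ℝ} (ht : t < 1) :
    Integrable (fun μ => Real.exp (t * mass B μ)) ρ := by
  by_cases h0 : α B = 0
  · refine (integrable_const (1 : ℝ)).congr ?_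
    filter_upwards [hρ.ae_mass_eq_zero hB h0] with μ hμ
    simp [hμ]
  · have h := integrable_exp_gammaMeasure (ENNReal.toReal_pos h0 hfin) ht
    rw [← hρ.map_mass hB h0 hfin] at h
    exact h.comp_measurable (measurable_mass hB)

/-- Exponential moments in a neighbourhood of `0` give moments of every order. -/
lemma memLp_mass [IsFiniteMeasure ρ] (hρ : IsGammaLaw α ρ) {B : Set X} (hB : MeasurableSet B)
    (hfin : α B ≠ ∞) (n : ℕ) : MemLp (mass B) n ρ := by
  have h : (0 : ℝ) ∈ interior (integrableExpSet (mass B) ρ) := by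
    refine mem_interior.2 ⟨Iio 1, fun t ht => hρ.integrable_exp_mass hB hfin ht, isOpen_Iio, ?_⟩
    simp
  exact_mod_cast memLp_of_mem_interior_integrableExpSet h n

lemma integral_mass_pow_succ [IsProbabilityMeasure ρ] (hρ : IsGammaLaw α ρ) {B : Set X}
    (hB : MeasurableSet B) (hfin : α B ≠ ∞) (k : ℕ) :
    ∫ μ, mass B μ ^ (k + 1) ∂ρ = ((α B).toReal + k) * ∫ μ, mass B μ ^ k ∂ρ := by
  by_cases h0 : α B = 0
  · have h := hρ.ae_mass_eq_zero hB h0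
    have h1 : ∀ j : ℕ, ∫ μ, mass B μ ^ j ∂ρ = 0 ^ j := fun j => by
      rw [integral_congr_ae (g := fun _ => (0 : ℝ) ^ j) (h.mono fun μ hμ => by simp [hμ])]
      simp
    rw [h1, h1, h0]
    rcases k with _ | k <;> simp
  · have h : ∀ j : ℕ, ∫ μ, mass B μ ^ j ∂ρ = ∫ x, x ^ j ∂gammaMeasure (α B).toReal 1 := fun j => by
      rw [← hρ.map_mass hB h0 hfin, integral_map (measurable_mass hB).aemeasurable
        (by fun_prop)]
    rw [h, h, integral_pow_succ_gammaMeasure (ENNReal.toReal_pos h0 hfin)]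

end IsGammaLaw

end

end GammaCurrent

namespace GammaCurrent

noncomputable section

/-! ### Evaluation of formal polynomials and integrability -/

open MvPolynomial Filter Topology

variable {X : Type*} [MeasurableSpace X] {α : Measure X} {ρ : Measure (SFiniteMeasure X)}

lemma testFunctions_measurable (f : testFunctions α) : Measurable (f : X → ℂ) := f.2.1

lemma testFunctions_bounded (f : testFunctions α) : ∃ C : ℝ, 0 ≤ C ∧ ∀ x, ‖(f : X → ℂ) x‖ ≤ C := by
  obtain ⟨C, hC⟩ := f.2.2.1
  exact ⟨max C 0, le_max_right _ _, fun x => (hC x).trans (le_max_left _ _)⟩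

lemma testFunctions_measurableSet (f : testFunctions α) :
    MeasurableSet {x | (f : X → ℂ) x ≠ 0} :=
  (testFunctions_measurable f (measurableSet_singleton 0)).compl

lemma testFunctions_support_lt_top (f : testFunctions α) : α {x | (f : X → ℂ) x ≠ 0} < ∞ :=
  f.2.2.2

/-- A bounded measurable function is integrable if it vanishes outside a set of finite measure. -/
lemma integrable_of_bounded_of_support {f : X → ℂ} (hf : Measurable f) {C : ℝ}
    (hC : ∀ x, ‖f x‖ ≤ C) {ν : Measure X} {s : Set X} (hs : ν s < ∞) (h0 : ∀ x ∉ s, f x = 0) :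
    Integrable f ν := by
  rw [← integrableOn_iff_integrable_of_support_subset (s := s)
    (fun x hx => by_contra fun h => hx (h0 x h))]
  exact Measure.integrableOn_of_bounded hs.ne hf.aestronglyMeasurable (ae_of_all _ hC)

lemma integrable_of_support_lt_top (f : testFunctions α) {ν : Measure X}
    (h : ν {x | (f : X → ℂ) x ≠ 0} < ∞) : Integrable (f : X → ℂ) ν := by
  obtain ⟨C, -, hC⟩ := testFunctions_bounded f
  exact integrable_of_bounded_of_support (testFunctions_measurable f) hC h (by simp)

lemma integrable_testFunctions (f : testFunctions α) : Integrable (f : X → ℂ) α :=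
  integrable_of_support_lt_top f (testFunctions_support_lt_top f)

/-- The integral `α(f)` with respect to the control measure. -/
def controlMean (α : Measure X) (f : testFunctions α) : ℂ := ∫ x, (f : X → ℂ) x ∂α

/-- The random variable `μ ↦ μ(f)`. -/
def pairing (f : testFunctions α) (μ : SFiniteMeasure X) : ℂ := ∫ x, (f : X → ℂ) x ∂μ.1

/-- The polynomial functional given by a formal polynomial. -/
def evalPoly (P : MvPolynomial (testFunctions α) ℂ) (μ : SFiniteMeasure X) : ℂ :=
  eval (fun g => pairing g μ) P

@[simp] lemma evalPoly_X (f : testFunctions α) (μ : SFiniteMeasure X) :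
    evalPoly (MvPolynomial.X f) μ = pairing f μ := by simp [evalPoly]

@[simp] lemma evalPoly_C (c : ℂ) (μ : SFiniteMeasure X) :
    evalPoly (C c : MvPolynomial (testFunctions α) ℂ) μ = c := by simp [evalPoly]

@[simp] lemma evalPoly_one (μ : SFiniteMeasure X) :
    evalPoly (1 : MvPolynomial (testFunctions α) ℂ) μ = 1 := by simp [evalPoly]

@[simp] lemma evalPoly_zero (μ : SFiniteMeasure X) :
    evalPoly (0 : MvPolynomial (testFunctions α) ℂ) μ = 0 := by simp [evalPoly]

@[simp] lemma evalPoly_add (P Q : MvPolynomial (testFunctions α) ℂ) (μ : SFiniteMeasure X) :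
    evalPoly (P + Q) μ = evalPoly P μ + evalPoly Q μ := by simp [evalPoly]

@[simp] lemma evalPoly_sub (P Q : MvPolynomial (testFunctions α) ℂ) (μ : SFiniteMeasure X) :
    evalPoly (P - Q) μ = evalPoly P μ - evalPoly Q μ := by simp [evalPoly]

@[simp] lemma evalPoly_mul (P Q : MvPolynomial (testFunctions α) ℂ) (μ : SFiniteMeasure X) :
    evalPoly (P * Q) μ = evalPoly P μ * evalPoly Q μ := by simp [evalPoly]

@[simp] lemma evalPoly_pow (P : MvPolynomial (testFunctions α) ℂ) (n : ℕ) (μ : SFiniteMeasure X) :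
    evalPoly (P ^ n) μ = evalPoly P μ ^ n := by simp [evalPoly]

@[simp] lemma evalPoly_smul (c : ℂ) (P : MvPolynomial (testFunctions α) ℂ)
    (μ : SFiniteMeasure X) : evalPoly (c • P) μ = c * evalPoly P μ := by
  simp [evalPoly]

lemma mem_polyFunctionals_iff_evalPoly (F : SFiniteMeasure X → ℂ) :
    F ∈ polyFunctionals α ↔ ∃ P : MvPolynomial (testFunctions α) ℂ, F = evalPoly P := by
  constructor
  · rintro ⟨P, rfl⟩
    exact ⟨P, aeval_fun_eq _ P⟩
  · rintro ⟨P, rfl⟩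
    exact ⟨P, aeval_fun_eq _ P⟩

/-- Domination by a mass transfers the moments of masses to all `μ(f)` and supplies the majorants
for dominated convergence. -/
lemma norm_pairing_le (f : testFunctions α) {C : ℝ} (hC : ∀ x, ‖(f : X → ℂ) x‖ ≤ C) {s : Set X}
    (h0 : ∀ x ∉ s, (f : X → ℂ) x = 0) {μ : SFiniteMeasure X} (hs : μ.1 s < ∞) :
    ‖pairing f μ‖ ≤ C * mass s μ := by
  rw [pairing, ← setIntegral_eq_integral_of_forall_compl_eq_zero h0]
  exact norm_setIntegral_le_of_norm_le_const hs fun x _ => hC x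

namespace IsGammaLaw

lemma ae_support_lt_top (hρ : IsGammaLaw α ρ) (f : testFunctions α) :
    ∀ᵐ μ ∂ρ, μ.1 {x | (f : X → ℂ) x ≠ 0} < ∞ :=
  hρ.ae_lt_top (testFunctions_measurableSet f) (testFunctions_support_lt_top f).ne

end IsGammaLaw

/-! ### Simple functions of finite support -/

section Simple

variable {σ : Type*} [Fintype σ]

/-- A function of a simple function that vanishes off a set of finite measure, as a test
function. -/
def simpleTest {E : Type*} [Zero E] (G : SimpleFunc X E) (hG : α {x | G x ≠ 0} < ∞) (h : E → ℂ)
    (h0 : h 0 = 0) : testFunctions α :=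
  ⟨fun x => h (G x), by
    refine ⟨(G.map h).measurable, ?_, ?_⟩
    · obtain ⟨C, hC⟩ := (G.map h).exists_forall_norm_le
      exact ⟨C, hC⟩
    · refine (measure_mono fun x hx => ?_).trans_lt hG
      intro hx0
      exact hx (by simp [hx0, h0])⟩

/-- The integral of a function of a simple function of finite support. -/
lemma integral_comp_simpleFunc {E : Type*} [Zero E] [DecidableEq E] (G : SimpleFunc X E) (h : E → ℂ)
    (h0 : h 0 = 0) {ν : Measure X} (hν : ν {x | G x ≠ 0} < ∞) :
    ∫ x, h (G x) ∂ν
      = ∑ y ∈ G.range.filter (· ≠ 0), ((ν (G ⁻¹' {y})).toReal : ℂ) * h y := by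
  have h1 : (fun x => h (G x))
      = fun x => ∑ y ∈ G.range.filter (· ≠ 0), (G ⁻¹' {y}).indicator (fun _ => h y) x := by
    funext x
    by_cases hx : G x = 0
    · rw [hx, h0, Finset.sum_eq_zero]
      intro y hy
      rw [indicator_of_notMem]
      intro hxy
      exact (Finset.mem_filter.1 hy).2 (hxy.symm.trans hx)
    · rw [Finset.sum_eq_single_of_mem (G x) (by simp [hx])]
      · simp
      · intro y _ hy
        rw [indicator_of_notMem]
        exact fun hxy => hy hxy.symm
  rw [h1, integral_finsetSum]
  · refine Finset.sum_congr rfl fun y _ => ?_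
    rw [integral_indicator_const _ (G.measurableSet_fiber y)]
    simp [measureReal_def]
  · intro y hy
    refine (integrable_indicator_iff (G.measurableSet_fiber y)).2 (integrableOn_const ?_)
    refine (lt_of_le_of_lt (measure_mono fun x hx => ?_) hν).ne
    have hx : G x = y := hx
    rw [mem_ofPred_eq, hx]
    exact (Finset.mem_filter.1 hy).2

/-- Finitely many test functions can be approximated simultaneously by simple functions. -/
lemma exists_simple_approx (f : σ → testFunctions α) :
    ∃ (G : ℕ → SimpleFunc X (σ → ℂ)) (K : ℝ) (s : Set X), 0 ≤ K ∧ MeasurableSet s ∧ α s < ∞ ∧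
      (∀ m x, ‖G m x‖ ≤ K) ∧ (∀ m, ∀ x ∉ s, G m x = 0) ∧ (∀ i, ∀ x ∉ s, (f i : X → ℂ) x = 0) ∧
      ∀ x, Tendsto (fun m => G m x) atTop (𝓝 fun i => (f i : X → ℂ) x) := by
  classical
  have hmeas : Measurable fun x i => (f i : X → ℂ) x :=
    measurable_pi_lambda _ fun i => testFunctions_measurable (f i)
  choose K hK0 hK using fun i => testFunctions_bounded (f i)
  have hKle : ∀ i, K i ≤ ∑ j, K j := fun i =>
    Finset.single_le_sum (fun j _ => hK0 j) (Finset.mem_univ i)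
  have hKnn : 0 ≤ ∑ j, K j := Finset.sum_nonneg fun j _ => hK0 j
  set s : Set X := ⋃ i, {x | (f i : X → ℂ) x ≠ 0} with hs
  have hsm : MeasurableSet s := MeasurableSet.iUnion fun i => testFunctions_measurableSet (f i)
  have hs0 : ∀ i, ∀ x ∉ s, (f i : X → ℂ) x = 0 := fun i x hx => by
    by_contra h
    exact hx (mem_iUnion.2 ⟨i, h⟩)
  have hst : StronglyMeasurable fun x i => (f i : X → ℂ) x := hmeas.stronglyMeasurable
  -- Cutting off outside the common support keeps every approximant supported on the finite-measure
  -- set `s`.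
  refine ⟨fun m => SimpleFunc.piecewise s hsm (hst.approxBounded (∑ j, K j) m)
      (SimpleFunc.const X 0), ∑ j, K j, s, hKnn, hsm, ?_, fun m x => ?_, fun m x hx => ?_, hs0,
      fun x => ?_⟩
  · exact (measure_iUnion_fintype_le α _).trans_lt
      (ENNReal.sum_lt_top.2 fun i _ => testFunctions_support_lt_top (f i))
  · by_cases hx : x ∈ s
    · simpa [hx] using hst.norm_approxBounded_le hKnn m x
    · simpa [hx] using hKnn
  · simp [hx]
  · by_cases hx : x ∈ s
    · simp only [SimpleFunc.coe_piecewise, hx, piecewise_eq_of_mem]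
      exact hst.tendsto_approxBounded_of_norm_le
        ((pi_norm_le_iff_of_nonneg hKnn).2 fun i => (hK i x).trans (hKle i))
    · simp only [SimpleFunc.coe_piecewise, hx, not_false_eq_true, piecewise_eq_of_notMem,
        SimpleFunc.const_zero, SimpleFunc.coe_zero, Pi.zero_apply]
      rw [show (fun i => (f i : X → ℂ) x) = 0 from funext fun i => hs0 i x hx]
      exact tendsto_const_nhds

end Simple

namespace IsGammaLaw

/-- Where `μ(s)` is finite, hence almost surely, `μ(f)` is a limit of finite linear combinations of
masses. Where it is infinite the integral need not be such a limit. -/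
lemma aestronglyMeasurable_pairing (hρ : IsGammaLaw α ρ) (f : testFunctions α) :
    AEStronglyMeasurable (pairing f : SFiniteMeasure X → ℂ) ρ := by
  classical
  obtain ⟨G, K, s, hK, hsm, hs, hGK, hG0, hf0, hlim⟩ := exists_simple_approx fun _ : Unit => f
  refine aestronglyMeasurable_of_tendsto_ae atTop
    (f := fun m μ => ∑ y ∈ (G m).range.filter (· ≠ 0), (mass (G m ⁻¹' {y}) μ : ℂ) * y ())
    (fun m => ?_) ?_
  · refine Measurable.aestronglyMeasurable (Finset.measurable_fun_sum _ fun y _ => ?_)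
    exact (Complex.measurable_ofReal.comp (measurable_mass ((G m).measurableSet_fiber y))).mul_const _
  · filter_upwards [hρ.ae_lt_top hsm hs.ne] with μ hμ
    have h1 : ∀ m, ∑ y ∈ (G m).range.filter (· ≠ 0), (mass (G m ⁻¹' {y}) μ : ℂ) * y ()
        = ∫ x, G m x () ∂μ.1 := fun m => by
      refine (integral_comp_simpleFunc (G m) (fun y => y ()) rfl ?_).symm
      exact (measure_mono fun x hx => by_contra fun h => absurd (hG0 m x h) hx).trans_lt hμ
    simp_rw [h1]
    refine tendsto_integral_of_dominated_convergence (s.indicator fun _ => K) (fun m => ?_)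
      ((integrable_indicator_iff hsm).2 (integrableOn_const hμ.ne)) (fun m => ae_of_all _ fun x => ?_)
      (ae_of_all _ fun x => ?_)
    · exact ((G m).map fun y => y ()).measurable.aestronglyMeasurable
    · by_cases hx : x ∈ s
      · rw [indicator_of_mem hx]
        exact (norm_le_pi_norm _ _).trans (hGK m x)
      · simp [hx, hG0 m x hx]
    · exact (continuous_apply ()).continuousAt.tendsto.comp (hlim x)

variable [IsProbabilityMeasure ρ]

lemma memLp_pairing (hρ : IsGammaLaw α ρ) (f : testFunctions α) (n : ℕ) :
    MemLp (pairing f : SFiniteMeasure X → ℂ) n ρ := by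
  obtain ⟨K, -, hK⟩ := testFunctions_bounded f
  refine ((hρ.memLp_mass (testFunctions_measurableSet f)
    (testFunctions_support_lt_top f).ne n).const_mul K).mono' (hρ.aestronglyMeasurable_pairing f) ?_
  filter_upwards [hρ.ae_support_lt_top f] with μ hμ
  exact norm_pairing_le f hK (by simp) hμ

end IsGammaLaw

lemma holderTriple_two_mul (n : ℕ) :
    ENNReal.HolderTriple ((2 * n : ℕ) : ℝ≥0∞) ((2 * n : ℕ) : ℝ≥0∞) (n : ℝ≥0∞) := by
  constructor
  rw [← two_mul, Nat.cast_mul, ENNReal.mul_inv (by simp) (by simp), ← mul_assoc,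
    Nat.cast_ofNat, ENNReal.mul_inv_cancel (by simp) (by simp), one_mul]

/-- Hölder's inequality with exponents `2n, 2n, n`: functions with moments of all orders are closed
under products, unlike a single `Lᵖ`. -/
lemma memLp_mul_of_forall {Ω 𝕜 : Type*} [MeasurableSpace Ω] [RCLike 𝕜] {P : Measure Ω} {f g : Ω → 𝕜}
    (hf : ∀ n : ℕ, MemLp f n P) (hg : ∀ n : ℕ, MemLp g n P) (n : ℕ) :
    MemLp (fun ω => f ω * g ω) n P :=
  have := holderTriple_two_mul n
  (hg (2 * n)).mul (hf (2 * n))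

namespace IsGammaLaw

variable [IsProbabilityMeasure ρ]

lemma memLp_evalPoly (hρ : IsGammaLaw α ρ) (P : MvPolynomial (testFunctions α) ℂ) (n : ℕ) :
    MemLp (evalPoly P) n ρ := by
  induction P using MvPolynomial.induction_on generalizing n with
  | C c =>
    have h : evalPoly (C c : MvPolynomial (testFunctions α) ℂ) = fun _ => c :=
      funext fun μ => by rw [evalPoly_C]
    rw [h]
    exact memLp_const c
  | add p q hp hq =>
    have h : evalPoly (p + q) = evalPoly p + evalPoly q :=
      funext fun μ => by rw [evalPoly_add, Pi.add_apply]
    rw [h]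
    exact (hp n).add (hq n)
  | mul_X p g hp =>
    have h : evalPoly (p * MvPolynomial.X g) = fun μ => evalPoly p μ * pairing g μ :=
      funext fun μ => by rw [evalPoly_mul, evalPoly_X]
    rw [h]
    exact memLp_mul_of_forall hp (hρ.memLp_pairing g) n

lemma integrable_evalPoly (hρ : IsGammaLaw α ρ) (P : MvPolynomial (testFunctions α) ℂ) :
    Integrable (evalPoly P) ρ :=
  memLp_one_iff_integrable.1 (by exact_mod_cast hρ.memLp_evalPoly P 1)

/-- The expectation of the polynomial functionals. -/
def expectation (hρ : IsGammaLaw α ρ) : MvPolynomial (testFunctions α) ℂ →ₗ[ℂ] ℂ where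
  toFun P := ∫ μ, evalPoly P μ ∂ρ
  map_add' P Q := by
    simp only [evalPoly_add]
    exact integral_add (hρ.integrable_evalPoly P) (hρ.integrable_evalPoly Q)
  map_smul' c P := by
    simp only [evalPoly_smul, RingHom.id_apply, smul_eq_mul]
    exact integral_const_mul c _

end IsGammaLaw

end

end GammaCurrent

namespace GammaCurrent

noncomputable section

open MvPolynomial Filter Topology

/-! ### Integration by parts for finitely many independent Gamma variables -/

section Finite

variable {ι : Type*} [Fintype ι]

/-- The Euler-type derivation `∑ c_i y_i ∂_i`. -/
def eulerDeriv (c : ι → ℂ) : Derivation ℂ (MvPolynomial ι ℂ) (MvPolynomial ι ℂ) :=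
  mkDerivation ℂ fun i => C (c i) * X i

omit [Fintype ι] in
@[simp] lemma eulerDeriv_X (c : ι → ℂ) (i : ι) : eulerDeriv c (X i) = C (c i) * X i :=
  mkDerivation_X _ _ _

lemma eulerDeriv_monomial (c : ι → ℂ) (m : ι →₀ ℕ) (r : ℂ) :
    eulerDeriv c (monomial m r) = C (∑ i, c i * m i) * monomial m r := by
  have key : eulerDeriv c (monomial m 1) = C (∑ i, c i * m i) * monomial m 1 := by
    classical
    induction m using Finsupp.induction_linear with
    | zero => simp
    | add u v hu hv =>
      rw [show (monomial (u + v) (1 : ℂ)) = monomial u 1 * monomial v 1 by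
        rw [monomial_mul, one_mul], Derivation.leibniz, hu, hv, smul_eq_mul, smul_eq_mul]
      simp only [Finsupp.add_apply, Nat.cast_add, mul_add, Finset.sum_add_distrib, C_add]
      ring
    | single i k =>
      rw [Finset.sum_eq_single i (by intro j _ hj; simp [hj]) (by simp), Finsupp.single_eq_same,
        ← X_pow_eq_monomial, Derivation.leibniz_pow, eulerDeriv_X]
      rcases k with _ | k
      · simp
      · simp only [Nat.add_sub_cancel, smul_eq_mul, nsmul_eq_mul, C_mul, pow_succ]
        rw [map_natCast]
        ring
  have h : monomial m r = r • monomial m (1 : ℂ) := by rw [smul_monomial, smul_eq_mul, mul_one]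
  rw [h, Derivation.map_smul, key, mul_smul_comm]

variable {Ω : Type*} [MeasurableSpace Ω] {P : Measure Ω} [IsProbabilityMeasure P] {Y : ι → Ω → ℝ}
  {a : ι → ℝ}

omit [Fintype ι] in
lemma memLp_eval_of_forall (hL : ∀ i, ∀ n : ℕ, MemLp (Y i) n P) (Q : MvPolynomial ι ℂ) (n : ℕ) :
    MemLp (fun ω => eval (fun i => (Y i ω : ℂ)) Q) n P := by
  induction Q using MvPolynomial.induction_on generalizing n with
  | C c => simpa using memLp_const c
  | add p q hp hq => 
    simp only [map_add]
    exact (hp n).add (hq n)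
  | mul_X p i hp =>
    simp only [map_mul, eval_X]
    exact memLp_mul_of_forall hp (fun n => (hL i n).ofReal) n

omit [Fintype ι] in
lemma integrable_eval_of_forall (hL : ∀ i, ∀ n : ℕ, MemLp (Y i) n P) (Q : MvPolynomial ι ℂ) :
    Integrable (fun ω => eval (fun i => (Y i ω : ℂ)) Q) P :=
  memLp_one_iff_integrable.1 (by exact_mod_cast memLp_eval_of_forall hL Q 1)

omit [IsProbabilityMeasure P] in
-- By independence the moment is a product of one-variable moments; multiplication by `X_j` changes
-- only the `j`-th factor, by the recursion.
lemma integral_X_mul_monomial (hY : iIndepFun Y P) (hL : ∀ i, ∀ n : ℕ, MemLp (Y i) n P)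
    (hrec : ∀ i (k : ℕ), ∫ ω, Y i ω ^ (k + 1) ∂P = (a i + k) * ∫ ω, Y i ω ^ k ∂P)
    (m : ι →₀ ℕ) (r : ℂ) (j : ι) :
    ∫ ω, eval (fun i => (Y i ω : ℂ)) (X j * monomial m r) ∂P
      = (a j + m j) * ∫ ω, eval (fun i => (Y i ω : ℂ)) (monomial m r) ∂P := by
  classical
  have hmeas : ∀ i, AEStronglyMeasurable (Y i) P := fun i => (hL i 0).aestronglyMeasurable
  have hprod : ∀ u : ι →₀ ℕ, ∫ ω, eval (fun i => (Y i ω : ℂ)) (monomial u r) ∂P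
      = r * ∏ i, ((∫ ω, Y i ω ^ u i ∂P : ℝ) : ℂ) := fun u => by
    have hfun : (fun ω => eval (fun i => (Y i ω : ℂ)) (monomial u r))
        = fun ω => r * ((∏ i, Y i ω ^ u i : ℝ) : ℂ) := by
      funext ω
      rw [eval_monomial, Finsupp.prod_fintype _ _ (by simp)]
      push_cast
      rfl
    have h2 := (hY.comp (fun i x => x ^ u i) fun i => by fun_prop).integral_fun_prod_eq_prod_integral
      fun i => ((continuous_pow (u i)).comp_aestronglyMeasurable (hmeas i))
    simp only [Function.comp_apply] at h2
    rw [hfun, integral_const_mul, integral_complex_ofReal, h2]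
    push_cast
    rfl
  rw [X, monomial_mul, one_mul, hprod, hprod, ← Finset.mul_prod_erase Finset.univ _ (Finset.mem_univ j),
    ← Finset.mul_prod_erase Finset.univ (fun i => ((∫ ω, Y i ω ^ m i ∂P : ℝ) : ℂ))
      (Finset.mem_univ j)]
  have h3 : ∏ i ∈ Finset.univ.erase j,
        ((∫ ω, Y i ω ^ ((Finsupp.single j 1 + m : ι →₀ ℕ) i) ∂P : ℝ) : ℂ)
      = ∏ i ∈ Finset.univ.erase j, ((∫ ω, Y i ω ^ m i ∂P : ℝ) : ℂ) := by
    refine Finset.prod_congr rfl fun i hi => ?_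
    simp [(Finset.ne_of_mem_erase hi)]
  rw [h3, Finsupp.add_apply, Finsupp.single_eq_same, add_comm 1, hrec]
  push_cast
  ring

/-- On a monomial the left side carries the eigenvalue `∑ c_i m_i`, and the right side `∑ c_i (a_i +
m_i) - ∑ c_i a_i`. -/
lemma integral_eulerDeriv (hY : iIndepFun Y P) (hL : ∀ i, ∀ n : ℕ, MemLp (Y i) n P)
    (hrec : ∀ i (k : ℕ), ∫ ω, Y i ω ^ (k + 1) ∂P = (a i + k) * ∫ ω, Y i ω ^ k ∂P)
    (c : ι → ℂ) (Q : MvPolynomial ι ℂ) :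
    ∫ ω, eval (fun i => (Y i ω : ℂ)) (eulerDeriv c Q) ∂P
      = ∫ ω, eval (fun i => (Y i ω : ℂ)) ((∑ i, C (c i) * X i - C (∑ i, c i * a i)) * Q) ∂P := by
  induction Q using MvPolynomial.induction_on' with
  | add p q hp hq =>
    simp only [map_add, mul_add]
    rw [integral_add (integrable_eval_of_forall hL _) (integrable_eval_of_forall hL _),
      integral_add (integrable_eval_of_forall hL _) (integrable_eval_of_forall hL _), hp, hq]
  | monomial m r =>
    have h1 : (∑ i, C (c i) * X i - C (∑ i, c i * a i)) * monomial m r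
        = ∑ i, C (c i) * (X i * monomial m r) - C (∑ i, c i * (a i : ℂ)) * monomial m r := by
      rw [sub_mul, Finset.sum_mul]
      simp only [mul_assoc]
    rw [h1, eulerDeriv_monomial]
    simp only [map_sub, map_sum, map_mul, eval_C]
    simp only [← map_mul]
    rw [integral_sub (integrable_finsetSum _ fun i _ =>
        (integrable_eval_of_forall hL _).const_mul _)
        ((integrable_eval_of_forall hL _).const_mul _),
      integral_finsetSum _ fun i _ => (integrable_eval_of_forall hL _).const_mul _]
    simp only [integral_const_mul, integral_X_mul_monomial hY hL hrec]
    simp only [← mul_assoc, ← Finset.sum_mul, ← sub_mul, ← Finset.sum_sub_distrib]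
    congr 1
    refine Finset.sum_congr rfl fun i _ => ?_
    ring

end Finite

end

end GammaCurrent

namespace GammaCurrent

noncomputable section

open MvPolynomial Filter Topology

/-! ### Integration by parts for step functions -/

variable {X : Type*} [MeasurableSpace X] {α : Measure X} {ρ : Measure (SFiniteMeasure X)}

section Step

variable {E : Type*} [Zero E]

/-- The test function is a function of the simple function `G`, vanishing where `G` does. -/
def IsStep (G : SimpleFunc X E) (g : testFunctions α) : Prop :=
  ∃ h : E → ℂ, h 0 = 0 ∧ ∀ x, (g : X → ℂ) x = h (G x)

lemma IsStep.mul {G : SimpleFunc X E} {f g : testFunctions α} (hf : IsStep G f) (hg : IsStep G g) :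
    IsStep G (f * g) := by
  obtain ⟨h, h0, hh⟩ := hf
  obtain ⟨k, -, hk⟩ := hg
  refine ⟨fun y => h y * k y, by simp [h0], fun x => ?_⟩
  change (f : X → ℂ) x * (g : X → ℂ) x = _
  rw [hh, hk]

open Classical in
/-- The nonzero values of a simple function. -/
abbrev nonzeroRange (G : SimpleFunc X E) : Finset E := G.range.filter (· ≠ 0)

lemma mem_nonzeroRange {G : SimpleFunc X E} {y : E} :
    y ∈ nonzeroRange G ↔ y ∈ G.range ∧ y ≠ 0 := by
  classical
  exact Finset.mem_filter

lemma exists_eq_of_mem_nonzeroRange (G : SimpleFunc X E) (y : nonzeroRange G) : ∃ x, G x = y := by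
  obtain ⟨x, hx⟩ := SimpleFunc.mem_range.1 (mem_nonzeroRange.1 y.2).1
  exact ⟨x, hx⟩

/-- A point at which the simple function takes the given value. -/
def fiberPoint (G : SimpleFunc X E) (y : nonzeroRange G) : X :=
  (exists_eq_of_mem_nonzeroRange G y).choose

lemma apply_fiberPoint (G : SimpleFunc X E) (y : nonzeroRange G) : G (fiberPoint G y) = y :=
  (exists_eq_of_mem_nonzeroRange G y).choose_spec

/-- The fiber of a simple function over a nonzero value. -/
def fiber (G : SimpleFunc X E) (y : nonzeroRange G) : Set X := G ⁻¹' {(y : E)}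

lemma measurableSet_fiber (G : SimpleFunc X E) (y : nonzeroRange G) : MeasurableSet (fiber G y) :=
  G.measurableSet_fiber y

lemma measure_fiber_lt_top (G : SimpleFunc X E) {ν : Measure X} (hG : ν {x | G x ≠ 0} < ∞)
    (y : nonzeroRange G) : ν (fiber G y) < ∞ := by
  refine (measure_mono fun x hx => ?_).trans_lt hG
  have hx : G x = y := hx
  rw [mem_ofPred_eq, hx]
  exact (mem_nonzeroRange.1 y.2).2

lemma pairwise_disjoint_fiber (G : SimpleFunc X E) :
    Pairwise fun y z : nonzeroRange G => Disjoint (fiber G y) (fiber G z) := by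
  intro y z hyz
  refine Set.disjoint_left.2 fun x hx hx' => hyz (Subtype.ext ?_)
  exact (show G x = y from hx).symm.trans hx'

lemma IsStep.integral {G : SimpleFunc X E} {g : testFunctions α} (hg : IsStep G g) {ν : Measure X}
    (hν : ν {x | G x ≠ 0} < ∞) :
    ∫ x, (g : X → ℂ) x ∂ν
      = ∑ y : nonzeroRange G, ((ν (fiber G y)).toReal : ℂ) * (g : X → ℂ) (fiberPoint G y) := by
  classical
  obtain ⟨h, h0, hh⟩ := hg
  simp_rw [hh, apply_fiberPoint]
  rw [integral_comp_simpleFunc G h h0 hν]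
  refine Eq.trans ?_ (Finset.sum_coe_sort (nonzeroRange G)
    fun y => ((ν (G ⁻¹' {y})).toReal : ℂ) * h y).symm
  congr!

/-- Polynomials in step functions as polynomials in the masses of the fibers. -/
def fiberPoly (G : SimpleFunc X E) :
    MvPolynomial (testFunctions α) ℂ →ₐ[ℂ] MvPolynomial (nonzeroRange G) ℂ :=
  aeval fun g => ∑ y, C ((g : X → ℂ) (fiberPoint G y)) * MvPolynomial.X y

/-- Evaluation at a point of each fiber is multiplicative, so `X_{φg}` becomes `∑ φ(y) g(y) X_y`,
which is the Euler derivation applied to `∑ g(y) X_y`. -/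
lemma fiberPoly_scaleDeriv (G : SimpleFunc X E) (φ : testFunctions α)
    (P : MvPolynomial (testFunctions α) ℂ) :
    fiberPoly G (scaleDeriv φ P)
      = eulerDeriv (fun y => (φ : X → ℂ) (fiberPoint G y)) (fiberPoly G P) := by
  refine eq_of_one_of_X_mul (S := (fiberPoly G).toLinearMap ∘ₗ (scaleDeriv φ).toLinearMap)
    (T := (eulerDeriv fun y => (φ : X → ℂ) (fiberPoint G y)).toLinearMap ∘ₗ
      (fiberPoly G).toLinearMap) (by simp) (fun g P h => ?_) P
  simp only [LinearMap.comp_apply, Derivation.coeFn_coe, AlgHom.toLinearMap_apply] at h ⊢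
  rw [scaleDeriv_X_mul, map_add, map_mul, map_mul, map_mul, Derivation.leibniz, h, smul_eq_mul,
    smul_eq_mul, mul_comm (fiberPoly G P)]
  congr 2
  simp only [fiberPoly, aeval_X, map_sum]
  refine Finset.sum_congr rfl fun y _ => ?_
  rw [Derivation.leibniz, eulerDeriv_X, ← algebraMap_eq, Derivation.map_algebraMap, smul_eq_mul,
    smul_zero, add_zero, algebraMap_eq, ← mul_assoc, ← C_mul, mul_comm ((g : X → ℂ) _)]
  rfl

/-- The polynomials in step functions. -/
def stepPolys (α : Measure X) (G : SimpleFunc X E) :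
    Subalgebra ℂ (MvPolynomial (testFunctions α) ℂ) :=
  Algebra.adjoin ℂ (MvPolynomial.X '' {g | IsStep G g})

lemma X_mem_stepPolys {G : SimpleFunc X E} {g : testFunctions α} (hg : IsStep G g) :
    (MvPolynomial.X g : MvPolynomial (testFunctions α) ℂ) ∈ stepPolys α G :=
  Algebra.subset_adjoin ⟨g, hg, rfl⟩

lemma scaleDeriv_mem_stepPolys {G : SimpleFunc X E} {φ : testFunctions α} (hφ : IsStep G φ)
    {P : MvPolynomial (testFunctions α) ℂ} (hP : P ∈ stepPolys α G) :
    scaleDeriv φ P ∈ stepPolys α G := by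
  induction hP using Algebra.adjoin_induction with
  | mem P h =>
    obtain ⟨g, hg, rfl⟩ := h
    rw [scaleDeriv_X]
    exact X_mem_stepPolys (hφ.mul hg)
  | algebraMap r => simp
  | add p q _ _ hp hq => rw [map_add]; exact add_mem hp hq
  | mul p q hp' hq' hp hq =>
    rw [Derivation.leibniz]
    exact add_mem (mul_mem hp' hq) (mul_mem hq' hp)

lemma evalPoly_eq_eval_fiberPoly {G : SimpleFunc X E} {P : MvPolynomial (testFunctions α) ℂ}
    (hP : P ∈ stepPolys α G) {μ : SFiniteMeasure X} (hμ : μ.1 {x | G x ≠ 0} < ∞) :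
    evalPoly P μ = eval (fun y => (mass (fiber G y) μ : ℂ)) (fiberPoly G P) := by
  induction hP using Algebra.adjoin_induction with
  | mem P h =>
    obtain ⟨g, hg, rfl⟩ := h
    rw [evalPoly_X, pairing, hg.integral hμ]
    simp only [fiberPoly, aeval_X, map_sum, map_mul, eval_C, eval_X]
    exact Finset.sum_congr rfl fun y _ => mul_comm _ _
  | algebraMap r =>
    rw [AlgHom.commutes, algebraMap_eq, algebraMap_eq, evalPoly_C, eval_C]
  | add p q _ _ hp hq => rw [evalPoly_add, map_add, map_add, hp, hq]
  | mul p q _ _ hp hq => rw [evalPoly_mul, map_mul, map_mul, hp, hq]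

/-- Polynomials in step functions are polynomials in the masses of the disjoint fibers, so the
identity is the finite-dimensional `integral_eulerDeriv`. -/
lemma IsGammaLaw.integral_scaleDeriv_step [IsProbabilityMeasure ρ] (hρ : IsGammaLaw α ρ)
    {G : SimpleFunc X E} (hG : α {x | G x ≠ 0} < ∞) {φ : testFunctions α} (hφ : IsStep G φ)
    {P : MvPolynomial (testFunctions α) ℂ} (hP : P ∈ stepPolys α G) :
    ∫ μ, evalPoly (scaleDeriv φ P) μ ∂ρ
      = ∫ μ, evalPoly ((MvPolynomial.X φ - C (controlMean α φ)) * P) μ ∂ρ := by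
  have hGm : MeasurableSet {x | G x ≠ 0} := G.measurableSet_preimage {0}ᶜ
  have hae := hρ.ae_lt_top hGm hG.ne
  have hR : (MvPolynomial.X φ - C (controlMean α φ)) * P ∈ stepPolys α G :=
    mul_mem (sub_mem (X_mem_stepPolys hφ) (Subalgebra.algebraMap_mem _ _)) hP
  rw [integral_congr_ae (hae.mono fun μ hμ =>
      evalPoly_eq_eval_fiberPoly (scaleDeriv_mem_stepPolys hφ hP) hμ),
    integral_congr_ae (hae.mono fun μ hμ => evalPoly_eq_eval_fiberPoly hR hμ),
    fiberPoly_scaleDeriv]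
  have hind : iIndepFun (fun y : nonzeroRange G => (mass (fiber G y) : SFiniteMeasure X → ℝ)) ρ := by
    -- Independence is given for families indexed by `Fin n`, hence the reindexing and `precomp`.
    let e := Fintype.equivFin (nonzeroRange G)
    have h := hρ.indep _ (fun i => fiber G (e.symm i)) (fun i => measurableSet_fiber G _)
      (fun i j hij => pairwise_disjoint_fiber G (e.symm.injective.ne hij))
    have h2 := (h.comp (fun _ => ENNReal.toReal) fun _ => ENNReal.measurable_toReal).precomp
      e.injective
    simp only [Equiv.symm_apply_apply] at h2
    exact h2
  rw [integral_eulerDeriv hind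
    (fun y n => hρ.memLp_mass (measurableSet_fiber G y) (measure_fiber_lt_top G hG y).ne n)
    (fun y k => hρ.integral_mass_pow_succ (measurableSet_fiber G y)
      (measure_fiber_lt_top G hG y).ne k)]
  have h1 : fiberPoly G (MvPolynomial.X φ - C (controlMean α φ) : MvPolynomial (testFunctions α) ℂ)
      = ∑ y, C ((φ : X → ℂ) (fiberPoint G y)) * MvPolynomial.X y
        - C (∑ y, (φ : X → ℂ) (fiberPoint G y) * ((α (fiber G y)).toReal : ℂ)) := by
    rw [map_sub, ← algebraMap_eq, AlgHom.commutes, algebraMap_eq, controlMean, hφ.integral hG]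
    simp only [mul_comm ((φ : X → ℂ) _)]
    simp only [fiberPoly, aeval_X]
  rw [map_mul, h1]

end Step

end

end GammaCurrent

namespace GammaCurrent

noncomputable section

open MvPolynomial Filter Topology

/-! ### Integration by parts for all polynomial functionals -/

variable {X : Type*} [MeasurableSpace X] {α : Measure X} {ρ : Measure (SFiniteMeasure X)}

/-- Almost everywhere convergence of polynomial functionals with a dominating function that has
moments of all orders. -/
structure DominatedConvergence (ρ : Measure (SFiniteMeasure X))
    (P : ℕ → MvPolynomial (testFunctions α) ℂ) (Q : MvPolynomial (testFunctions α) ℂ) : Prop where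
  tendsto : ∀ᵐ μ ∂ρ, Tendsto (fun m => evalPoly (P m) μ) atTop (𝓝 (evalPoly Q μ))
  bound : ∃ g : SFiniteMeasure X → ℝ, (∀ n : ℕ, MemLp g n ρ) ∧
    ∀ m, ∀ᵐ μ ∂ρ, ‖evalPoly (P m) μ‖ ≤ g μ

namespace DominatedConvergence

variable {P P' : ℕ → MvPolynomial (testFunctions α) ℂ} {Q Q' : MvPolynomial (testFunctions α) ℂ}

lemma add (h : DominatedConvergence ρ P Q) (h' : DominatedConvergence ρ P' Q') :
    DominatedConvergence ρ (fun m => P m + P' m) (Q + Q') where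
  tendsto := by
    filter_upwards [h.tendsto, h'.tendsto] with μ hμ hμ'
    simpa only [evalPoly_add] using hμ.add hμ'
  bound := by
    obtain ⟨g, hg, hPg⟩ := h.bound
    obtain ⟨g', hg', hPg'⟩ := h'.bound
    refine ⟨fun μ => g μ + g' μ, fun n => (hg n).add (hg' n), fun m => ?_⟩
    filter_upwards [hPg m, hPg' m] with μ hμ hμ'
    rw [evalPoly_add]
    exact (norm_add_le _ _).trans (add_le_add hμ hμ')

lemma mul (h : DominatedConvergence ρ P Q) (h' : DominatedConvergence ρ P' Q') :
    DominatedConvergence ρ (fun m => P m * P' m) (Q * Q') where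
  tendsto := by
    filter_upwards [h.tendsto, h'.tendsto] with μ hμ hμ'
    simpa only [evalPoly_mul] using hμ.mul hμ'
  bound := by
    obtain ⟨g, hg, hPg⟩ := h.bound
    obtain ⟨g', hg', hPg'⟩ := h'.bound
    refine ⟨fun μ => g μ * g' μ, memLp_mul_of_forall hg hg', fun m => ?_⟩
    filter_upwards [hPg m, hPg' m] with μ hμ hμ'
    rw [evalPoly_mul, norm_mul]
    exact mul_le_mul hμ hμ' (norm_nonneg _) ((norm_nonneg _).trans hμ)

lemma const [IsFiniteMeasure ρ] {c : ℕ → ℂ} {d : ℂ} (h : Tendsto c atTop (𝓝 d)) :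
    DominatedConvergence ρ (fun m => (C (c m) : MvPolynomial (testFunctions α) ℂ)) (C d) where
  tendsto := ae_of_all _ fun μ => by simpa only [evalPoly_C] using h
  bound := by
    obtain ⟨K, hK⟩ := (Metric.isBounded_range_of_tendsto c h).exists_norm_le
    refine ⟨fun _ => K, fun n => memLp_const K, fun m => ae_of_all _ fun μ => ?_⟩
    rw [evalPoly_C]
    exact hK _ ⟨m, rfl⟩

lemma tendsto_integral [IsProbabilityMeasure ρ] (hρ : IsGammaLaw α ρ)
    (h : DominatedConvergence ρ P Q) :
    Tendsto (fun m => ∫ μ, evalPoly (P m) μ ∂ρ) atTop (𝓝 (∫ μ, evalPoly Q μ ∂ρ)) := by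
  obtain ⟨g, hg, hPg⟩ := h.bound
  have hg1 : Integrable g ρ := memLp_one_iff_integrable.1 (by exact_mod_cast hg 1)
  exact tendsto_integral_of_dominated_convergence g
    (fun m => (hρ.integrable_evalPoly (P m)).aestronglyMeasurable) hg1 hPg h.tendsto

end DominatedConvergence

/-- Bounded convergence on a set of finite measure. -/
lemma tendsto_integral_of_bounded {g : ℕ → testFunctions α} {g' : testFunctions α} {K : ℝ}
    {s : Set X} (hs : MeasurableSet s) (hK : ∀ m x, ‖(g m : X → ℂ) x‖ ≤ K)
    (h0 : ∀ m, ∀ x ∉ s, (g m : X → ℂ) x = 0)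
    (hlim : ∀ x, Tendsto (fun m => (g m : X → ℂ) x) atTop (𝓝 ((g' : X → ℂ) x)))
    {ν : Measure X} (hν : ν s < ∞) :
    Tendsto (fun m => ∫ x, (g m : X → ℂ) x ∂ν) atTop (𝓝 (∫ x, (g' : X → ℂ) x ∂ν)) := by
  refine tendsto_integral_of_dominated_convergence (s.indicator fun _ => K)
    (fun m => (testFunctions_measurable (g m)).aestronglyMeasurable)
    ((integrable_indicator_iff hs).2 (integrableOn_const hν.ne)) (fun m => ae_of_all _ fun x => ?_)
    (ae_of_all _ hlim)
  by_cases hx : x ∈ s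
  · rw [indicator_of_mem hx]
    exact hK m x
  · simp [hx, h0 m x hx]

namespace IsGammaLaw

variable [IsProbabilityMeasure ρ]

lemma dominatedConvergence_X (hρ : IsGammaLaw α ρ) {g : ℕ → testFunctions α}
    {g' : testFunctions α} {K : ℝ} {s : Set X} (hs : MeasurableSet s) (hαs : α s < ∞)
    (hK : ∀ m x, ‖(g m : X → ℂ) x‖ ≤ K) (h0 : ∀ m, ∀ x ∉ s, (g m : X → ℂ) x = 0)
    (hlim : ∀ x, Tendsto (fun m => (g m : X → ℂ) x) atTop (𝓝 ((g' : X → ℂ) x))) :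
    DominatedConvergence ρ (fun m => MvPolynomial.X (g m)) (MvPolynomial.X g') where
  tendsto := by
    filter_upwards [hρ.ae_lt_top hs hαs.ne] with μ hμ
    simp only [evalPoly_X]
    exact tendsto_integral_of_bounded hs hK h0 hlim hμ
  bound := by
    refine ⟨fun μ => K * mass s μ, fun n => (hρ.memLp_mass hs hαs.ne n).const_mul K, fun m => ?_⟩
    filter_upwards [hρ.ae_lt_top hs hαs.ne] with μ hμ
    rw [evalPoly_X]
    exact norm_pairing_le (g m) (hK m) (h0 m) hμ

/-- Both sides are continuous under dominated convergence, so the step function case suffices; the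
dominating functions have all moments, hence products of convergent sequences remain under control.
-/
theorem integrationByParts (hρ : IsGammaLaw α ρ) :
    IntegrationByParts (controlMean α) hρ.expectation := by
  intro φ P
  obtain ⟨n, f, -, Q, rfl⟩ := exists_fin_rename P
  -- A single vector-valued simple function approximates `φ` (at `none`) together with all the `f
  -- i`, so that all approximants are steps over the same partition.
  obtain ⟨G, K, s, hK, hsm, hs, hGK, hG0, -, hlim⟩ :=
    exists_simple_approx fun o : Option (Fin n) => o.elim φ f
  have hG : ∀ m, α {x | G m x ≠ 0} < ∞ := fun m =>
    (measure_mono fun x hx => by_contra fun h => absurd (hG0 m x h) hx).trans_lt hs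
  let F : ℕ → Option (Fin n) → testFunctions α := fun m o =>
    simpleTest (G m) (hG m) (fun y => y o) rfl
  have hstep : ∀ m o, IsStep (G m) (F m o) := fun m o => ⟨fun y => y o, rfl, fun x => rfl⟩
  have hFK : ∀ m o x, ‖(F m o : X → ℂ) x‖ ≤ K := fun m o x =>
    (norm_le_pi_norm (G m x) o).trans (hGK m x)
  have hF0 : ∀ m o, ∀ x ∉ s, (F m o : X → ℂ) x = 0 := fun m o x hx => by
    change G m x o = 0
    rw [hG0 m x hx]
    rfl
  have hFlim : ∀ o x, Tendsto (fun m => (F m o : X → ℂ) x) atTop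
      (𝓝 (((o.elim φ f : testFunctions α) : X → ℂ) x)) := fun o x =>
    (continuous_apply o).continuousAt.tendsto.comp (hlim x)
  have hX : ∀ o, DominatedConvergence ρ (fun m => MvPolynomial.X (F m o))
      (MvPolynomial.X (o.elim φ f)) := fun o =>
    hρ.dominatedConvergence_X hsm hs (fun m => hFK m o) (fun m => hF0 m o) (hFlim o)
  have hXX : ∀ i, DominatedConvergence ρ (fun m => MvPolynomial.X (F m none * F m (some i)))
      (MvPolynomial.X (φ * f i)) := fun i =>
    hρ.dominatedConvergence_X hsm hs
      (fun m x => (norm_mul_le _ _).trans (mul_le_mul (hFK m none x) (hFK m (some i) x)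
        (norm_nonneg _) hK))
      (fun m x hx => mul_eq_zero_of_left (hF0 m none x hx) _)
      (fun x => (hFlim none x).mul (hFlim (some i) x))
  -- Both convergences are proved together, since the product rule for the derivation also involves
  -- the undifferentiated polynomial.
  have hP : ∀ R : MvPolynomial (Fin n) ℂ,
      DominatedConvergence ρ (fun m => rename (fun i => F m (some i)) R) (rename f R) ∧
      DominatedConvergence ρ
        (fun m => scaleDeriv (F m none) (rename (fun i => F m (some i)) R))
        (scaleDeriv φ (rename f R)) := fun R => by
    induction R using MvPolynomial.induction_on with
    | C c =>
      have h0 : ∀ ψ : testFunctions α, scaleDeriv ψ (C c) = C 0 := fun ψ => by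
        rw [← algebraMap_eq, Derivation.map_algebraMap, map_zero]
      simp only [rename_C, h0]
      exact ⟨DominatedConvergence.const tendsto_const_nhds,
        DominatedConvergence.const tendsto_const_nhds⟩
    | add p q hp hq =>
      simp only [map_add]
      exact ⟨hp.1.add hq.1, hp.2.add hq.2⟩
    | mul_X p i hp =>
      simp only [map_mul, rename_X, Derivation.leibniz, scaleDeriv_X, smul_eq_mul]
      exact ⟨hp.1.mul (hX (some i)), (hp.1.mul (hXX i)).add ((hX (some i)).mul hp.2)⟩
  have hmem : ∀ m, ∀ R : MvPolynomial (Fin n) ℂ,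
      rename (fun i => F m (some i)) R ∈ stepPolys α (G m) := fun m R => by
    induction R using MvPolynomial.induction_on with
    | C c =>
      rw [rename_C]
      exact Subalgebra.algebraMap_mem _ _
    | add p q hp hq => rw [map_add]; exact add_mem hp hq
    | mul_X p i hp =>
      rw [map_mul, rename_X]
      exact mul_mem hp (X_mem_stepPolys (hstep m _))
  have hc : DominatedConvergence ρ
      (fun m => (C (-controlMean α (F m none)) : MvPolynomial (testFunctions α) ℂ))
      (C (-controlMean α φ)) :=
    DominatedConvergence.const (tendsto_integral_of_bounded hsm (fun m => hFK m none)
      (fun m => hF0 m none) (hFlim none) hs).neg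
  have hl := (hP Q).2.tendsto_integral hρ
  have hr := (((hX none).add hc).mul (hP Q).1).tendsto_integral hρ
  refine tendsto_nhds_unique hl ?_
  simp only [C_neg, ← sub_eq_add_neg] at hr
  refine hr.congr fun m => ?_
  exact (hρ.integral_scaleDeriv_step (hG m) (hstep m none) (hmem m Q)).symm

end IsGammaLaw

end

end GammaCurrent

namespace GammaCurrent

noncomputable section

open MvPolynomial Filter Topology

/-! ### Functional derivatives of polynomial functionals -/

variable {X : Type*} [MeasurableSpace X] {α : Measure X} {ρ : Measure (SFiniteMeasure X)}

/-- The formal counterpart of the functional derivative at `x`: the derivation `X_g ↦ g(x)`. -/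
def diracDeriv (x : X) :
    Derivation ℂ (MvPolynomial (testFunctions α) ℂ) (MvPolynomial (testFunctions α) ℂ) :=
  mkDerivation ℂ fun g => C ((g : X → ℂ) x)

@[simp] lemma diracDeriv_X (x : X) (g : testFunctions α) :
    diracDeriv x (MvPolynomial.X g) = C ((g : X → ℂ) x) := mkDerivation_X _ _ _

/-- Finiteness of `μ` on the support of `g` makes `g` integrable for both summands, so that the
integral is additive. -/
lemma pairing_addDirac (g : testFunctions α) {μ : SFiniteMeasure X}
    (hμ : μ.1 {x | (g : X → ℂ) x ≠ 0} < ∞) (x : X) {t : ℝ} (ht : 0 ≤ t) :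
    pairing g (addDirac μ x t) = pairing g μ + t * (g : X → ℂ) x := by
  have h1 : Integrable (g : X → ℂ) (t.toNNReal • Measure.dirac x) :=
    integrable_of_support_lt_top g (measure_lt_top _ _)
  rw [pairing, addDirac, integral_add_measure (integrable_of_support_lt_top g hμ) h1,
    integral_smul_nnreal_measure,
    integral_dirac' _ _ (testFunctions_measurable g).stronglyMeasurable, NNReal.smul_def,
    Real.coe_toNNReal _ ht, Complex.real_smul]
  rfl

/-- The exceptional set only has to make the supports of the variables occurring in `P` finite, so
it can be chosen independently of `x` and `t`. This is needed because the functional derivatives are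
integrated over `x` for fixed `μ`. -/
lemma IsGammaLaw.ae_evalPoly_addDirac (hρ : IsGammaLaw α ρ)
    (P : MvPolynomial (testFunctions α) ℂ) :
    ∀ᵐ μ ∂ρ, ∀ x, ∀ t : ℝ, 0 ≤ t → evalPoly P (addDirac μ x t)
      = eval (fun g => pairing g μ + t * (g : X → ℂ) x) P := by
  induction P using MvPolynomial.induction_on with
  | C c => exact ae_of_all _ fun μ x t _ => by rw [evalPoly_C, eval_C]
  | add p q hp hq =>
    filter_upwards [hp, hq] with μ hμ hμ' x t ht
    rw [evalPoly_add, map_add, hμ x t ht, hμ' x t ht]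
  | mul_X p g hp =>
    filter_upwards [hp, hρ.ae_support_lt_top g] with μ hμ hg x t ht
    rw [evalPoly_mul, map_mul, evalPoly_X, eval_X, hμ x t ht, pairing_addDirac g hg x ht]

lemma hasDerivAt_eval_shift (y : testFunctions α → ℂ) (x : X)
    (P : MvPolynomial (testFunctions α) ℂ) (t : ℝ) :
    HasDerivAt (fun t : ℝ => eval (fun g => y g + t * (g : X → ℂ) x) P)
      (eval (fun g => y g + t * (g : X → ℂ) x) (diracDeriv x P)) t := by
  induction P using MvPolynomial.induction_on with
  | C c =>
    rw [← algebraMap_eq, Derivation.map_algebraMap, map_zero]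
    simp only [algebraMap_eq, eval_C]
    exact hasDerivAt_const t c
  | add p q hp hq =>
    simp only [map_add]
    exact hp.add hq
  | mul_X p g hp =>
    have hg : HasDerivAt (fun t : ℝ => y g + t * (g : X → ℂ) x) ((g : X → ℂ) x) t := by
      simpa using ((Complex.ofRealCLM.hasDerivAt (x := t)).mul_const ((g : X → ℂ) x)).const_add (y g)
    simp only [Derivation.leibniz, diracDeriv_X, smul_eq_mul, map_add, map_mul, eval_X, eval_C]
    exact (hp.mul hg).congr_deriv (by ring)

lemma funcDeriv_evalPoly {P : MvPolynomial (testFunctions α) ℂ} {μ : SFiniteMeasure X} {x : X}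
    (h : ∀ t : ℝ, 0 ≤ t → evalPoly P (addDirac μ x t)
      = eval (fun g => pairing g μ + t * (g : X → ℂ) x) P) :
    funcDeriv (evalPoly P) x μ = evalPoly (diracDeriv x P) μ := by
  have hE : EqOn (fun t : ℝ => evalPoly P (addDirac μ x t))
      (fun t : ℝ => eval (fun g => pairing g μ + t * (g : X → ℂ) x) P) (Ici 0) := fun t ht => h t ht
  rw [funcDeriv, derivWithin_congr hE (h 0 le_rfl),
    (hasDerivAt_eval_shift _ x P 0).hasDerivWithinAt.derivWithin (uniqueDiffOn_Ici 0 0 self_mem_Ici)]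
  simp [evalPoly]

lemma funcDeriv2_evalPoly {P : MvPolynomial (testFunctions α) ℂ} {μ : SFiniteMeasure X} {x : X}
    (h : ∀ t : ℝ, 0 ≤ t → evalPoly P (addDirac μ x t)
      = eval (fun g => pairing g μ + t * (g : X → ℂ) x) P) :
    funcDeriv2 (evalPoly P) x μ = evalPoly (diracDeriv x (diracDeriv x P)) μ := by
  have hE : EqOn (fun t : ℝ => evalPoly P (addDirac μ x t))
      (fun t : ℝ => eval (fun g => pairing g μ + t * (g : X → ℂ) x) P) (Ici 0) := fun t ht => h t ht
  -- The first derivative is needed on the whole half-line, not only at `0`, since it is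
  -- differentiated once more.
  have h1 : ∀ t ∈ Ici (0 : ℝ),
      iteratedDerivWithin 1 (fun t : ℝ => evalPoly P (addDirac μ x t)) (Ici 0) t
        = eval (fun g => pairing g μ + t * (g : X → ℂ) x) (diracDeriv x P) := fun t ht => by
    rw [iteratedDerivWithin_one, derivWithin_congr hE (h t ht),
      (hasDerivAt_eval_shift _ x P t).hasDerivWithinAt.derivWithin (uniqueDiffOn_Ici 0 t ht)]
  rw [funcDeriv2, iteratedDerivWithin_succ, derivWithin_congr h1 (h1 0 self_mem_Ici),
    (hasDerivAt_eval_shift _ x _ 0).hasDerivWithinAt.derivWithin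
      (uniqueDiffOn_Ici 0 0 self_mem_Ici)]
  simp [evalPoly]

/-! ### Integrals of functional derivatives -/

/-- The dependence on `x` sits in finitely many scalar factors `g(x)`; integrating over `x` against
`φ` therefore yields integrals of the products `φ g`. -/
lemma diracDeriv_eq_sum (x : X) (P : MvPolynomial (testFunctions α) ℂ) :
    diracDeriv x P
      = (gradient (testFunctions α) P).sum fun g w => (g : X → ℂ) x • w := by
  have h := eq_of_one_of_X_mul (S := (diracDeriv x).toLinearMap)
    (T := (Finsupp.lsum ℂ fun g : testFunctions α => (g : X → ℂ) x • LinearMap.id) ∘ₗ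
      (gradient (testFunctions α)).toLinearMap) (by simp) (fun g Q hQ => ?_) P
  · rw [LinearMap.comp_apply, Finsupp.coe_lsum] at h
    exact h
  · simp only [LinearMap.comp_apply, Derivation.coeFn_coe] at hQ ⊢
    rw [Derivation.leibniz, gradient_X_mul, map_add, hQ, diracDeriv_X, smul_eq_mul, smul_eq_mul]
    congr 1
    · generalize gradient (testFunctions α) Q = w
      induction w using Finsupp.induction_linear with
      | zero => simp
      | add u v hu hv => rw [smul_add, map_add, map_add, mul_add, hu, hv]
      | single h w =>
        rw [Finsupp.smul_single, Finsupp.lsum_single, Finsupp.lsum_single, smul_eq_mul,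
          LinearMap.smul_apply, LinearMap.smul_apply, LinearMap.id_apply, LinearMap.id_apply,
          mul_smul_comm]
    · simp [mul_comm Q, C_mul_eq_smul]

lemma evalPoly_sum {ι : Type*} (s : Finset ι) (w : ι → MvPolynomial (testFunctions α) ℂ)
    (μ : SFiniteMeasure X) : evalPoly (∑ i ∈ s, w i) μ = ∑ i ∈ s, evalPoly (w i) μ := by
  simp [evalPoly]

lemma measure_support_mul_lt_top {φ g : testFunctions α} {ν : Measure X}
    (h : ν {x | (φ : X → ℂ) x ≠ 0} < ∞) : ν {x | ((φ * g : testFunctions α) : X → ℂ) x ≠ 0} < ∞ := by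
  refine (measure_mono fun x hx => ?_).trans_lt h
  intro h0
  exact hx (mul_eq_zero_of_left h0 _)

lemma integrable_mul_evalPoly_diracDeriv {φ : testFunctions α} {ν : Measure X}
    (hν : ν {x | (φ : X → ℂ) x ≠ 0} < ∞) (P : MvPolynomial (testFunctions α) ℂ)
    (μ : SFiniteMeasure X) :
    Integrable (fun x => (φ : X → ℂ) x * evalPoly (diracDeriv x P) μ) ν ∧
    ∫ x, (φ : X → ℂ) x * evalPoly (diracDeriv x P) μ ∂ν
      = (gradient (testFunctions α) P).sum fun g w =>
        (∫ x, ((φ * g : testFunctions α) : X → ℂ) x ∂ν) * evalPoly w μ := by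
  have h1 : (fun x => (φ : X → ℂ) x * evalPoly (diracDeriv x P) μ)
      = fun x => ∑ g ∈ (gradient (testFunctions α) P).support,
        ((φ * g : testFunctions α) : X → ℂ) x * evalPoly (gradient (testFunctions α) P g) μ := by
    funext x
    rw [diracDeriv_eq_sum, Finsupp.sum, evalPoly_sum, Finset.mul_sum]
    refine Finset.sum_congr rfl fun g _ => ?_
    rw [evalPoly_smul, ← mul_assoc]
    rfl
  have h2 : ∀ g : testFunctions α, Integrable (fun x => ((φ * g : testFunctions α) : X → ℂ) x
      * evalPoly (gradient (testFunctions α) P g) μ) ν := fun g =>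
    (integrable_of_support_lt_top (φ * g) (measure_support_mul_lt_top hν)).mul_const _
  rw [h1]
  refine ⟨integrable_finsetSum _ fun g _ => h2 g, ?_⟩
  rw [integral_finsetSum _ fun g _ => h2 g]
  exact Finset.sum_congr rfl fun g _ => integral_mul_const _ _

lemma integral_mul_evalPoly_diracDeriv {φ : testFunctions α} {μ : SFiniteMeasure X}
    (hμ : μ.1 {x | (φ : X → ℂ) x ≠ 0} < ∞) (P : MvPolynomial (testFunctions α) ℂ) :
    ∫ x, (φ : X → ℂ) x * evalPoly (diracDeriv x P) μ ∂μ.1 = evalPoly (scaleDeriv φ P) μ := by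
  rw [(integrable_mul_evalPoly_diracDeriv hμ P μ).2, ← contract_gradient, contract,
    Finsupp.coe_lsum]
  simp only [Finsupp.sum, evalPoly_sum]
  refine Finset.sum_congr rfl fun g _ => ?_
  rw [LinearMap.mulLeft_apply, evalPoly_mul, evalPoly_X]
  rfl

/-- Only one of the two derivatives at `x` is expanded. Integrating the other one against `φ g`
gives `D_{φg}`, which is exactly the divergence form of `lowerOp`. -/
lemma integral_lowering {φ : testFunctions α} {μ : SFiniteMeasure X}
    (hμ : μ.1 {x | (φ : X → ℂ) x ≠ 0} < ∞) (P : MvPolynomial (testFunctions α) ℂ) :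
    (∫ x, (φ : X → ℂ) x * evalPoly (diracDeriv x (diracDeriv x P)) μ ∂μ.1)
      + ∫ x, (φ : X → ℂ) x * evalPoly (diracDeriv x P) μ ∂α
      = evalPoly (lowerOp (controlMean α) φ P) μ := by
  have h1 : (fun x => (φ : X → ℂ) x * evalPoly (diracDeriv x (diracDeriv x P)) μ)
      = fun x => ∑ g ∈ (gradient (testFunctions α) P).support,
        ((φ * g : testFunctions α) : X → ℂ) x
          * evalPoly (diracDeriv x (gradient (testFunctions α) P g)) μ := by
    funext x
    rw [diracDeriv_eq_sum x P, Finsupp.sum, map_sum, evalPoly_sum, Finset.mul_sum]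
    refine Finset.sum_congr rfl fun g _ => ?_
    rw [Derivation.map_smul, evalPoly_smul, ← mul_assoc]
    rfl
  rw [h1, integral_finsetSum _ fun g _ =>
      (integrable_mul_evalPoly_diracDeriv (measure_support_mul_lt_top hμ) _ μ).1,
    (integrable_mul_evalPoly_diracDeriv (testFunctions_support_lt_top φ) P μ).2,
    Finsupp.sum, ← Finset.sum_add_distrib, lowerOp, LinearMap.comp_apply, divergence,
    Finsupp.coe_lsum]
  simp only [Finsupp.sum, evalPoly_sum]
  refine Finset.sum_congr rfl fun g _ => ?_
  rw [integral_mul_evalPoly_diracDeriv (measure_support_mul_lt_top hμ)]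
  simp [controlMean]

/-- The formal counterpart of the raising operator. -/
def raiseOp (φ : testFunctions α) :
    MvPolynomial (testFunctions α) ℂ →ₗ[ℂ] MvPolynomial (testFunctions α) ℂ :=
  lowerOp (controlMean α) φ - (2 : ℂ) • (scaleDeriv φ).toLinearMap
    + LinearMap.mulLeft ℂ (MvPolynomial.X φ) - controlMean α φ • LinearMap.id

/-- The formal counterpart of the neutral operator. -/
def neutralOp (φ : testFunctions α) :
    MvPolynomial (testFunctions α) ℂ →ₗ[ℂ] MvPolynomial (testFunctions α) ℂ :=
  -lowerOp (controlMean α) φ + (scaleDeriv φ).toLinearMap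
    + ((1 / 2 : ℂ) * controlMean α φ) • LinearMap.id

namespace IsGammaLaw

lemma loweringExpr_evalPoly (hρ : IsGammaLaw α ρ) (φ : testFunctions α)
    (P : MvPolynomial (testFunctions α) ℂ) :
    loweringExpr α φ (evalPoly P) =ᵐ[ρ] evalPoly (lowerOp (controlMean α) (star φ) P) := by
  filter_upwards [hρ.ae_evalPoly_addDirac P, hρ.ae_support_lt_top (star φ)] with μ hP hφ
  rw [loweringExpr, ← integral_lowering hφ]
  simp only [funcDeriv2_evalPoly (hP _), funcDeriv_evalPoly (hP _)]
  rfl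

lemma raisingExpr_evalPoly (hρ : IsGammaLaw α ρ) (φ : testFunctions α)
    (P : MvPolynomial (testFunctions α) ℂ) :
    raisingExpr α φ (evalPoly P) =ᵐ[ρ] evalPoly (raiseOp φ P) := by
  filter_upwards [hρ.ae_evalPoly_addDirac P, hρ.ae_support_lt_top φ] with μ hP hφ
  have h1 := integral_lowering hφ P
  have h2 := integral_mul_evalPoly_diracDeriv hφ P
  simp only [raisingExpr, funcDeriv2_evalPoly (hP _), funcDeriv_evalPoly (hP _), raiseOp,
    LinearMap.sub_apply, LinearMap.add_apply, LinearMap.smul_apply, LinearMap.mulLeft_apply,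
    LinearMap.id_apply, evalPoly_sub, evalPoly_add, evalPoly_smul, evalPoly_mul, evalPoly_X,
    Derivation.coeFn_coe, ← h1, h2]
  simp only [pairing, controlMean]
  ring

lemma neutralExpr_evalPoly (hρ : IsGammaLaw α ρ) (φ : testFunctions α)
    (P : MvPolynomial (testFunctions α) ℂ) :
    neutralExpr α φ (evalPoly P) =ᵐ[ρ] evalPoly (neutralOp φ P) := by
  filter_upwards [hρ.ae_evalPoly_addDirac P, hρ.ae_support_lt_top φ] with μ hP hφ
  have h1 := integral_lowering hφ P
  have h2 := integral_mul_evalPoly_diracDeriv hφ P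
  have h3 : evalPoly (-lowerOp (controlMean α) φ P) μ
      = -evalPoly (lowerOp (controlMean α) φ P) μ := by
    rw [← zero_sub, evalPoly_sub, evalPoly_zero, zero_sub]
  simp only [neutralExpr, funcDeriv2_evalPoly (hP _), funcDeriv_evalPoly (hP _), neutralOp,
    LinearMap.neg_apply, LinearMap.add_apply, LinearMap.smul_apply,
    LinearMap.id_apply, evalPoly_add, evalPoly_smul, h3, Derivation.coeFn_coe, ← h1, h2]
  simp only [controlMean]
  ring

end IsGammaLaw

end

end GammaCurrent

namespace GammaCurrent

noncomputable section

/-! ### Monic Laguerre polynomials -/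

section Laguerre

open Polynomial

lemma coeff_monicLaguerre (a : ℝ) (n j : ℕ) :
    (monicLaguerre a n).coeff j
      = (-1) ^ (n + j) * (n.choose j : ℝ) * (ascPochhammer ℝ (n - j)).eval (a + 1 + j) := by
  rw [monicLaguerre, finsetSum_coeff]
  simp only [coeff_C_mul_X_pow]
  rw [Finset.sum_ite_eq]
  split_ifs with h
  · rfl
  · rw [Nat.choose_eq_zero_of_lt (by simpa using h)]
    simp

lemma natDegree_monicLaguerre_le (a : ℝ) (n : ℕ) : (monicLaguerre a n).natDegree ≤ n := by
  refine natDegree_le_iff_coeff_eq_zero.2 fun j hj => ?_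
  rw [coeff_monicLaguerre, Nat.choose_eq_zero_of_lt hj]
  simp

lemma coeff_monicLaguerre_self (a : ℝ) (n : ℕ) : (monicLaguerre a n).coeff n = 1 := by
  rw [coeff_monicLaguerre]
  simp [← two_mul]

lemma monic_monicLaguerre (a : ℝ) (n : ℕ) : (monicLaguerre a n).Monic :=
  monic_of_natDegree_le_of_coeff_eq_one n (natDegree_monicLaguerre_le a n)
    (coeff_monicLaguerre_self a n)

lemma natDegree_monicLaguerre (a : ℝ) (n : ℕ) : (monicLaguerre a n).natDegree = n :=
  natDegree_eq_of_le_of_coeff_ne_zero (natDegree_monicLaguerre_le a n)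
    (by rw [coeff_monicLaguerre_self]; exact one_ne_zero)

/-- The raising operator on polynomials in one variable. -/
def raisePoly (β : ℝ) (p : ℝ[X]) : ℝ[X] :=
  X * derivative (derivative p) + (C β - 2 * X) * derivative p + (X - C β) * p

/-- The lowering operator on polynomials in one variable. -/
def lowerPoly (β : ℝ) (p : ℝ[X]) : ℝ[X] :=
  X * derivative (derivative p) + C β * derivative p

lemma cast_choose_succ_mul (n k : ℕ) :
    (n.choose (k + 1) : ℝ) * (k + 1) = n.choose k * (n - k) := by
  rcases le_or_gt k n with h | h
  · rw [← Nat.cast_sub h]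
    exact_mod_cast Nat.choose_succ_right_eq n k
  · rw [Nat.choose_eq_zero_of_lt h, Nat.choose_eq_zero_of_lt (h.trans (Nat.lt_succ_self k))]
    simp

lemma ascPochhammer_eval_succ_left (x : ℝ) (m : ℕ) :
    (ascPochhammer ℝ (m + 1)).eval x = x * (ascPochhammer ℝ m).eval (x + 1) := by
  simp [ascPochhammer_succ_left]

lemma ascPochhammer_eval_succ_right (x : ℝ) (m : ℕ) :
    (ascPochhammer ℝ (m + 1)).eval x = (ascPochhammer ℝ m).eval x * (x + m) := by
  simp [ascPochhammer_succ_right]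

/-- The binomial factor is kept on both sides so that the identity survives truncated subtraction:
for `j ≥ n` both sides vanish. -/
lemma choose_mul_ascPochhammer (β : ℝ) (n j : ℕ) :
    (n.choose (j + 1) : ℝ) * ((β + j) * (ascPochhammer ℝ (n - (j + 1))).eval (β + (j + 1 : ℕ)))
      = n.choose (j + 1) * (ascPochhammer ℝ (n - j)).eval (β + j) := by
  rcases Nat.lt_or_ge j n with h | h
  · obtain ⟨d, rfl⟩ := Nat.exists_eq_add_of_lt h
    rw [show j + d + 1 - (j + 1) = d by omega, show j + d + 1 - j = d + 1 by omega,
      ascPochhammer_eval_succ_left, Nat.cast_succ, add_assoc β]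
  · rw [Nat.choose_eq_zero_of_lt (Nat.lt_succ_of_le h)]
    simp

/-- Comparison of coefficients, by Pascal's rule, `(k+1) C(n,k+1) = (n-k) C(n,k)`, and splitting off
the first or last factor of the rising factorial. -/
lemma monicLaguerre_succ (β : ℝ) (n : ℕ) :
    monicLaguerre (β - 1) (n + 1) = raisePoly β (monicLaguerre (β - 1) n) := by
  ext j
  have hc : ∀ m i : ℕ, (monicLaguerre (β - 1) m).coeff i
      = (-1) ^ (m + i) * (m.choose i : ℝ) * (ascPochhammer ℝ (m - i)).eval (β + i) := fun m i => by
    rw [coeff_monicLaguerre, sub_add_cancel]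
  have htop : ∀ i, i ≤ n → (ascPochhammer ℝ (n + 1 - i)).eval (β + i)
      = (ascPochhammer ℝ (n - i)).eval (β + i) * (β + n) := fun i hi => by
    rw [Nat.succ_sub hi, ascPochhammer_eval_succ_right, Nat.cast_sub hi]
    ring
  rcases j with _ | k
  · have h1 := choose_mul_ascPochhammer β n 0
    have h2 := cast_choose_succ_mul n 0
    have h3 := htop 0 (Nat.zero_le n)
    simp only [raisePoly, sub_mul, coeff_add, coeff_sub, mul_assoc, mul_coeff_zero, coeff_C_zero,
      coeff_X_zero, coeff_derivative, hc]
    rw [h3]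
    simp only [Nat.cast_zero, add_zero, zero_add, Nat.choose_zero_right, Nat.cast_one, mul_one,
      one_mul, zero_mul, mul_zero, sub_zero, pow_succ] at h1 h2 h3 ⊢
    linear_combination (-1) ^ n * h1 + (-1) ^ n * (ascPochhammer ℝ n).eval β * h2
  · rcases Nat.lt_or_ge n (k + 1) with hk | hk
    -- Coefficients of index above `n`: only multiplication by `X` contributes, and it does so only
    -- at the top degree `n + 1`.
    · have h0 : (n.choose (k + 1) : ℝ) = 0 := by
        rw [Nat.choose_eq_zero_of_lt hk, Nat.cast_zero]
      have h0' : (n.choose (k + 2) : ℝ) = 0 := by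
        rw [Nat.choose_eq_zero_of_lt (by omega), Nat.cast_zero]
      have h4 : (n.choose k : ℝ) * (ascPochhammer ℝ (n - k)).eval (β + k) = n.choose k := by
        rcases Nat.lt_or_ge n k with hk' | hk'
        · rw [Nat.choose_eq_zero_of_lt hk']; simp
        · rw [Nat.sub_eq_zero_of_le (by omega)]; simp
      simp only [raisePoly, sub_mul, coeff_add, coeff_sub, mul_assoc, coeff_X_mul, coeff_C_mul,
        coeff_derivative, hc, h0, h0', coeff_ofNat_mul]
      rw [Nat.sub_eq_zero_of_le (show n + 1 ≤ k + 1 by omega), h4, Nat.choose_succ_succ,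
        Nat.cast_add, h0, ascPochhammer_zero, eval_one]
      ring
    · have h1 := choose_mul_ascPochhammer β n (k + 1)
      have h2 := cast_choose_succ_mul n (k + 1)
      have h2' := cast_choose_succ_mul n k
      have h3 := htop (k + 1) hk
      have h5 : (ascPochhammer ℝ (n - k)).eval (β + k)
          = (β + k) * (ascPochhammer ℝ (n - (k + 1))).eval (β + (k + 1 : ℕ)) := by
        rw [show n - k = n - (k + 1) + 1 by omega, ascPochhammer_eval_succ_left, Nat.cast_succ,
          add_assoc β]
      simp only [raisePoly, sub_mul, coeff_add, coeff_sub, mul_assoc, coeff_X_mul, coeff_C_mul,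
        coeff_derivative, hc, coeff_ofNat_mul]
      rw [h3, h5, Nat.choose_succ_succ, Nat.cast_add]
      push_cast at h1 h2 h2' ⊢
      simp only [pow_succ, pow_add]
      generalize eval (β + (k + 1)) (ascPochhammer ℝ (n - (k + 1))) = A at *
      generalize eval (β + (k + 1 + 1)) (ascPochhammer ℝ (n - (k + 1 + 1))) = B at *
      linear_combination (-(-1) ^ n * (-1) ^ k * ((k : ℝ) + 2)) * h1
        - ((-1) ^ n * (-1) ^ k * A) * h2 - ((-1) ^ n * (-1) ^ k * A) * h2'

/-- Integration of polynomials against the weight `x^(β-1) e^(-x)`. -/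
def gammaFunctional {β : ℝ} (hβ : 0 < β) : ℝ[X] →ₗ[ℝ] ℝ :=
  have hint : ∀ p : ℝ[X], IntegrableOn
      (fun x : ℝ => p.eval x * (x ^ (β - 1) * Real.exp (-x))) (Ioi 0) := fun p => by
    induction p using Polynomial.induction_on' with
    | add p q hp hq =>
      simp only [eval_add, add_mul]
      exact hp.add hq
    | monomial k c =>
      simp only [eval_monomial, mul_assoc]
      exact (integrableOn_pow_mul_gammaWeight hβ k).const_mul c
  { toFun := fun p => ∫ x in Ioi (0 : ℝ), p.eval x * (x ^ (β - 1) * Real.exp (-x))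
    map_add' := fun p q => by
      simp only [eval_add, add_mul]
      exact integral_add (hint p) (hint q)
    map_smul' := fun c p => by
      simp only [eval_smul, smul_eq_mul, mul_assoc, RingHom.id_apply]
      exact integral_const_mul _ _ }

lemma gammaFunctional_apply {β : ℝ} (hβ : 0 < β) (p : ℝ[X]) : gammaFunctional hβ p
    = ∫ x in Ioi (0 : ℝ), p.eval x * (x ^ (β - 1) * Real.exp (-x)) := rfl

lemma gammaFunctional_monomial {β : ℝ} (hβ : 0 < β) (k : ℕ) (c : ℝ) :
    gammaFunctional hβ (monomial k c) = c * Real.Gamma (β + k) := by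
  rw [gammaFunctional_apply, ← integral_pow_mul_gammaWeight hβ, ← integral_const_mul]
  simp only [eval_monomial, mul_assoc]

/-- One-variable integration by parts, checked on monomials, where it is `Γ(s + 1) = s Γ(s)`. -/
lemma gammaFunctional_X_mul_derivative {β : ℝ} (hβ : 0 < β) (p : ℝ[X]) :
    gammaFunctional hβ (X * derivative p) = gammaFunctional hβ ((X - C β) * p) := by
  induction p using Polynomial.induction_on' with
  | add p q hp hq => simp only [mul_add, map_add, hp, hq]
  | monomial k c =>
    have h1 : X * derivative (monomial k c) = monomial k (c * k) := by
      rcases k with _ | k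
      · simp
      · rw [derivative_monomial, Nat.add_sub_cancel, X_mul_monomial]
    rw [h1, sub_mul, X_mul_monomial, C_mul_monomial, map_sub, gammaFunctional_monomial,
      gammaFunctional_monomial, gammaFunctional_monomial, Nat.cast_succ, ← add_assoc,
      Real.Gamma_add_one (by positivity)]
    ring

/-- The difference of the two integrands is a combination of integration by parts expressions, for
the Wronskian `p q' - p' q` and for the product `p q`. -/
lemma gammaFunctional_mul_raisePoly {β : ℝ} (hβ : 0 < β) (p q : ℝ[X]) :
    gammaFunctional hβ (p * raisePoly β q) = gammaFunctional hβ (lowerPoly β p * q) := by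
  have h1 := gammaFunctional_X_mul_derivative hβ (p * derivative q - derivative p * q)
  have h2 := gammaFunctional_X_mul_derivative hβ (p * q)
  rw [← sub_eq_zero, ← map_sub] at h1 h2 ⊢
  have h3 : p * raisePoly β q - lowerPoly β p * q
      = (X * derivative (p * derivative q - derivative p * q)
        - (X - C β) * (p * derivative q - derivative p * q))
        - (X * derivative (p * q) - (X - C β) * (p * q)) := by
    simp only [raisePoly, lowerPoly, derivative_sub, derivative_mul]
    ring
  rw [h3, map_sub, h1, h2, sub_zero]

lemma degree_lowerPoly_lt (β : ℝ) {p : ℝ[X]} {n : ℕ} (hp : p.degree < (n + 1 : ℕ)) :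
    (lowerPoly β p).degree < n := by
  rw [degree_lt_iff_coeff_zero] at hp ⊢
  intro m hm
  have h1 := hp (m + 1) (by omega)
  rcases m with _ | m
  · simp [lowerPoly, coeff_derivative, h1]
  · simp [lowerPoly, coeff_derivative, coeff_X_mul, h1]

/-- Each raising step moves to the other factor as a lowering step, which drops the degree; after
`n` steps nothing is left. -/
lemma gammaFunctional_mul_monicLaguerre {β : ℝ} (hβ : 0 < β) (n : ℕ) {p : ℝ[X]}
    (hp : p.degree < n) : gammaFunctional hβ (p * monicLaguerre (β - 1) n) = 0 := by
  induction n generalizing p with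
  | zero =>
    have : p = 0 := by
      rw [← degree_eq_bot]
      exact Nat.WithBot.lt_zero_iff.1 (by exact_mod_cast hp)
    rw [this, zero_mul, map_zero]
  | succ n ih =>
    rw [monicLaguerre_succ, gammaFunctional_mul_raisePoly]
    exact ih (degree_lowerPoly_lt β hp)

lemma integral_monicLaguerre_mul {β : ℝ} (hβ : 0 < β) {m n : ℕ} (hmn : m ≠ n) :
    ∫ x in Ioi (0 : ℝ), (monicLaguerre (β - 1) m).eval x *
      (monicLaguerre (β - 1) n).eval x * (x ^ (β - 1) * Real.exp (-x)) = 0 := by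
  have hdeg : ∀ k : ℕ, (monicLaguerre (β - 1) k).degree = k := fun k => by
    rw [degree_eq_natDegree (monic_monicLaguerre _ k).ne_zero, natDegree_monicLaguerre]
  simp only [← eval_mul]
  rw [← gammaFunctional_apply hβ]
  rcases lt_or_gt_of_ne hmn with h | h
  · exact gammaFunctional_mul_monicLaguerre hβ n (by rw [hdeg]; exact_mod_cast h)
  · rw [mul_comm]
    exact gammaFunctional_mul_monicLaguerre hβ m (by rw [hdeg]; exact_mod_cast h)

end Laguerre

end

end GammaCurrent

namespace GammaCurrent

noncomputable section

open MvPolynomial Filter Topology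

/-! ### Totality of the polynomial functionals -/

variable {X : Type*} [MeasurableSpace X] {α : Measure X} {ρ : Measure (SFiniteMeasure X)}

lemma pairing_star (f : testFunctions α) (μ : SFiniteMeasure X) :
    pairing (star f) μ = conj (pairing f μ) := integral_conj

lemma pairing_smul (c : ℂ) (f : testFunctions α) (μ : SFiniteMeasure X) :
    pairing (c • f) μ = c * pairing f μ := integral_const_mul c _

lemma pairing_zero (μ : SFiniteMeasure X) : pairing (0 : testFunctions α) μ = 0 :=
  integral_zero X ℂ

lemma pairing_indicatorTest {B : Set X} (hB : MeasurableSet B) (hfin : α B < ∞)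
    (μ : SFiniteMeasure X) : pairing (indicatorTest α B hB hfin) μ = (mass B μ : ℂ) := by
  rw [pairing, indicatorTest, integral_indicator_const _ hB]
  simp [mass, measureReal_def]

lemma star_indicatorTest {B : Set X} (hB : MeasurableSet B) (hfin : α B < ∞) :
    star (indicatorTest α B hB hfin) = indicatorTest α B hB hfin := by
  refine Subtype.ext (funext fun x => ?_)
  change conj (B.indicator (fun _ => (1 : ℂ)) x) = B.indicator (fun _ => (1 : ℂ)) x
  by_cases hx : x ∈ B <;> simp [hx]

lemma pairing_eq_ofReal {f : testFunctions α} (hf : star f = f) (μ : SFiniteMeasure X) :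
    pairing f μ = ((pairing f μ).re : ℂ) := by
  have h := pairing_star f μ
  rw [hf] at h
  exact (Complex.conj_eq_iff_re.1 h.symm).symm

namespace IsGammaLaw

lemma pairing_add_ae (hρ : IsGammaLaw α ρ) (f g : testFunctions α) :
    ∀ᵐ μ ∂ρ, pairing (f + g) μ = pairing f μ + pairing g μ := by
  filter_upwards [hρ.ae_support_lt_top f, hρ.ae_support_lt_top g] with μ hf hg
  exact integral_add (integrable_of_support_lt_top f hf) (integrable_of_support_lt_top g hg)

lemma pairing_sum_ae (hρ : IsGammaLaw α ρ) {ι : Type*} (s : Finset ι) (f : ι → testFunctions α) :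
    ∀ᵐ μ ∂ρ, pairing (∑ i ∈ s, f i) μ = ∑ i ∈ s, pairing (f i) μ := by
  classical
  induction s using Finset.induction_on with
  | empty => exact ae_of_all _ fun μ => by simp [pairing_zero]
  | insert i s hi ih =>
    filter_upwards [ih, hρ.pairing_add_ae (f i) (∑ j ∈ s, f j)] with μ h1 h2
    rw [Finset.sum_insert hi, Finset.sum_insert hi, h2, h1]

variable [IsProbabilityMeasure ρ]

lemma memLp_exp_mass (hρ : IsGammaLaw α ρ) {B : Set X} (hB : MeasurableSet B) (hfin : α B ≠ ∞)
    {t : ℝ} {n : ℕ} (hn : n ≠ 0) (ht : n * t < 1) :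
    MemLp (fun μ => Real.exp (t * mass B μ)) n ρ := by
  rw [← integrable_norm_rpow_iff _ (by exact_mod_cast hn) (by simp)]
  · refine (hρ.integrable_exp_mass hB hfin ht).congr (ae_of_all _ fun μ => ?_)
    simp only [Real.norm_eq_abs, Real.abs_exp, ENNReal.toReal_natCast, Real.rpow_natCast]
    rw [← Real.exp_nat_mul, mul_assoc]
  · exact (Real.continuous_exp.measurable.comp
      ((measurable_mass hB).const_mul t)).aestronglyMeasurable

/-- The exponential series of a small multiple of `i μ(f)` can be integrated term by term against
a square integrable function. -/
lemma integral_cexp_add_eq_zero (hρ : IsGammaLaw α ρ) {f : testFunctions α} (hf : star f = f)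
    {K : ℝ} (hK : ∀ x, ‖(f : X → ℂ) x‖ ≤ K) {t : ℝ} (ht0 : 0 ≤ t) (ht : 4 * (t * K) < 1)
    {g : SFiniteMeasure X → ℂ} (hg : MemLp g 2 ρ) {s : ℝ}
    (h : ∀ P : MvPolynomial (testFunctions α) ℂ,
      ∫ μ, Complex.exp (s * pairing f μ * Complex.I) * (evalPoly P μ * g μ) ∂ρ = 0)
    (P : MvPolynomial (testFunctions α) ℂ) :
    ∫ μ, Complex.exp ((s + t : ℝ) * pairing f μ * Complex.I) * (evalPoly P μ * g μ) ∂ρ = 0 := by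
  set S : Set X := {x | (f : X → ℂ) x ≠ 0} with hS
  have hSm : MeasurableSet S := testFunctions_measurableSet f
  have hSα : α S ≠ ∞ := (testFunctions_support_lt_top f).ne
  have hpm := hρ.aestronglyMeasurable_pairing f
  have hexpm : AEStronglyMeasurable (fun μ => Complex.exp (s * pairing f μ * Complex.I)) ρ :=
    Complex.continuous_exp.comp_aestronglyMeasurable
      ((hpm.const_mul (s : ℂ)).mul_const Complex.I)
  have hnorm : ∀ μ, ‖Complex.exp (s * pairing f μ * Complex.I)‖ = 1 := fun μ => by
    rw [pairing_eq_ofReal hf μ, ← Complex.ofReal_mul, Complex.norm_exp_ofReal_mul_I]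
  have hbound : Integrable (fun μ => Real.exp (t * K * mass S μ) * ‖evalPoly P μ‖ * ‖g μ‖) ρ := by
    -- Hölder with `1/4 + 1/4 + 1/2`: as `g` is only in `L²`, the exponential majorant must lie in
    -- `L⁴`. This is where `4 t K < 1` comes from.
    have h4 : MemLp (fun μ => Real.exp (t * K * mass S μ)) (2 * 2 : ℕ) ρ :=
      hρ.memLp_exp_mass hSm hSα (by norm_num) (by push_cast; linarith)
    have := holderTriple_two_mul 2
    have h2 : MemLp (fun μ => Real.exp (t * K * mass S μ) * ‖evalPoly P μ‖) (2 : ℕ) ρ :=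
      (hρ.memLp_evalPoly P (2 * 2)).norm.mul h4
    rw [Nat.cast_ofNat] at h2
    exact h2.integrable_mul hg.norm
  have hlim : Tendsto (fun n => ∫ μ, (∑ k ∈ Finset.range n,
        (t * pairing f μ * Complex.I) ^ k / (k.factorial : ℂ)) *
          (Complex.exp (s * pairing f μ * Complex.I) * (evalPoly P μ * g μ)) ∂ρ) atTop
      (𝓝 (∫ μ, Complex.exp (t * pairing f μ * Complex.I) *
          (Complex.exp (s * pairing f μ * Complex.I) * (evalPoly P μ * g μ)) ∂ρ)) := by
    refine tendsto_integral_of_dominated_convergence _ (fun n => ?_) hbound (fun n => ?_)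
      (ae_of_all _ fun μ => ?_)
    · refine AEStronglyMeasurable.mul ?_ (hexpm.mul
        ((hρ.memLp_evalPoly P 0).aestronglyMeasurable.mul hg.aestronglyMeasurable))
      have hc : Continuous fun z : ℂ => ∑ k ∈ Finset.range n,
          (t * z * Complex.I) ^ k / (k.factorial : ℂ) := by fun_prop
      exact hc.comp_aestronglyMeasurable hpm
    · filter_upwards [hρ.ae_support_lt_top f] with μ hμ
      rw [norm_mul, norm_mul, hnorm, one_mul, norm_mul, ← mul_assoc]
      gcongr
      have h1 : ‖(t : ℂ) * pairing f μ * Complex.I‖ ≤ t * K * mass S μ := by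
        rw [norm_mul, norm_mul, Complex.norm_I, mul_one, Complex.norm_real, Real.norm_of_nonneg ht0,
          mul_assoc]
        exact mul_le_mul_of_nonneg_left (norm_pairing_le f hK (by simp [hS]) hμ) ht0
      calc ‖∑ k ∈ Finset.range n, (t * pairing f μ * Complex.I) ^ k / (k.factorial : ℂ)‖
          ≤ ∑ k ∈ Finset.range n, ‖(t : ℂ) * pairing f μ * Complex.I‖ ^ k / k.factorial := by
            refine (norm_sum_le _ _).trans (Finset.sum_le_sum fun k _ => ?_)
            rw [norm_div, norm_pow, Complex.norm_natCast]
        _ ≤ Real.exp ‖(t : ℂ) * pairing f μ * Complex.I‖ :=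
            Real.sum_le_exp_of_nonneg (norm_nonneg _) n
        _ ≤ Real.exp (t * K * mass S μ) := Real.exp_le_exp.2 h1
    · refine Tendsto.mul_const _ ?_
      rw [Complex.exp_eq_exp_ℂ]
      exact (NormedSpace.expSeries_div_hasSum_exp (t * pairing f μ * Complex.I)).tendsto_sum_nat
  have hint : ∀ Q : MvPolynomial (testFunctions α) ℂ,
      Integrable (fun μ => Complex.exp (s * pairing f μ * Complex.I) * (evalPoly Q μ * g μ)) ρ :=
    fun Q => by
      have h2 : MemLp (evalPoly Q) 2 ρ := by exact_mod_cast hρ.memLp_evalPoly Q 2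
      exact (h2.integrable_mul hg).bdd_mul hexpm (ae_of_all _ fun μ => (hnorm μ).le)
  have hzero : ∀ n, ∫ μ, (∑ k ∈ Finset.range n,
        (t * pairing f μ * Complex.I) ^ k / (k.factorial : ℂ)) *
          (Complex.exp (s * pairing f μ * Complex.I) * (evalPoly P μ * g μ)) ∂ρ = 0 := fun n => by
    have h1 : (fun μ => (∑ k ∈ Finset.range n,
        (t * pairing f μ * Complex.I) ^ k / (k.factorial : ℂ)) *
          (Complex.exp (s * pairing f μ * Complex.I) * (evalPoly P μ * g μ)))
        = fun μ => ∑ k ∈ Finset.range n, ((t * Complex.I) ^ k / (k.factorial : ℂ)) *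
          (Complex.exp (s * pairing f μ * Complex.I) *
            (evalPoly (MvPolynomial.X f ^ k * P) μ * g μ)) := by
      funext μ
      rw [Finset.sum_mul]
      refine Finset.sum_congr rfl fun k _ => ?_
      rw [evalPoly_mul, evalPoly_pow, evalPoly_X]
      ring
    rw [h1, integral_finsetSum _ fun k _ => (hint _).const_mul _]
    refine Finset.sum_eq_zero fun k _ => ?_
    rw [integral_const_mul, h, mul_zero]
  simp only [hzero] at hlim
  rw [← tendsto_nhds_unique hlim tendsto_const_nhds]
  congr 1 with μ
  have hexp : Complex.exp ((s + t : ℝ) * pairing f μ * Complex.I)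
      = Complex.exp (t * pairing f μ * Complex.I) * Complex.exp (s * pairing f μ * Complex.I) := by
    rw [← Complex.exp_add]
    congr 1
    push_cast
    ring
  rw [hexp, mul_assoc]

/-- The termwise integration needs a small increment, so the frequency goes from `0` to `1` in `N >
4K` steps of size `1/N`. Keeping an arbitrary polynomial factor is what allows the step to be
iterated. -/
lemma integral_cexp_mul_eq_zero (hρ : IsGammaLaw α ρ) {f : testFunctions α} (hf : star f = f)
    {g : SFiniteMeasure X → ℂ} (hg : MemLp g 2 ρ)
    (h : ∀ P : MvPolynomial (testFunctions α) ℂ, ∫ μ, evalPoly P μ * g μ ∂ρ = 0) :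
    ∫ μ, Complex.exp (pairing f μ * Complex.I) * g μ ∂ρ = 0 := by
  obtain ⟨K, hK0, hK⟩ := testFunctions_bounded f
  obtain ⟨N, hN⟩ := exists_nat_gt (4 * K)
  have hN0 : (0 : ℝ) < N := lt_of_le_of_lt (by positivity) hN
  have hstep : ∀ j : ℕ, ∀ P : MvPolynomial (testFunctions α) ℂ,
      ∫ μ, Complex.exp ((j * (1 / N) : ℝ) * pairing f μ * Complex.I) * (evalPoly P μ * g μ) ∂ρ
        = 0 := fun j => by
    induction j with
    | zero => intro P; simpa using h P
    | succ j ih =>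
      intro P
      rw [Nat.cast_succ, add_mul, one_mul]
      refine hρ.integral_cexp_add_eq_zero hf hK (by positivity) ?_ hg ih P
      rw [one_div, ← mul_assoc, mul_comm 4, mul_assoc, inv_mul_lt_iff₀ hN0, mul_one]
      exact hN
  have h1 := hstep N 1
  rw [mul_one_div_cancel hN0.ne'] at h1
  simpa using h1

end IsGammaLaw

/-- The measurable sets of finite `α`-measure. -/
abbrev FiniteSet (α : Measure X) := {B : Set X // MeasurableSet B ∧ α B < ∞}

/-- The `σ`-algebra on the space of measures is generated by the masses of the sets of finite
`α`-measure. -/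
lemma measurableSpace_eq_iSup [SigmaFinite α] :
    (Subtype.instMeasurableSpace : MeasurableSpace (SFiniteMeasure X))
      = ⨆ B : FiniteSet α, MeasurableSpace.comap (fun μ : SFiniteMeasure X => μ.1 B.1)
          inferInstance := by
  refine le_antisymm ?_ (iSup_le fun B => (measurable_apply B.2.1).comap_le)
  set m0 := ⨆ B : FiniteSet α, MeasurableSpace.comap (fun μ : SFiniteMeasure X => μ.1 B.1)
          inferInstance with hm0
  refine MeasurableSpace.comap_le_iff_le_map.2 ?_
  have hfin : ∀ B : FiniteSet α, @Measurable _ _ m0 _ fun μ : SFiniteMeasure X => μ.1 B.1 :=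
    fun B => measurable_iff_comap_le.2
      (le_iSup (fun B : FiniteSet α => MeasurableSpace.comap
        (fun μ : SFiniteMeasure X => μ.1 B.1) inferInstance) B)
  have hval : @Measurable _ _ m0 _ (Subtype.val : SFiniteMeasure X → Measure X) := by
    refine @Measure.measurable_of_measurable_coe X (SFiniteMeasure X) _ m0 _ fun s hs => ?_
    -- By σ-finiteness of `α`, the mass of any measurable set is a supremum of masses of sets of
    -- finite `α`-measure.
    have h1 : (fun μ : SFiniteMeasure X => μ.1 s)
        = fun μ => ⨆ n, μ.1 (s ∩ spanningSets α n) := by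
      funext μ
      rw [← Monotone.measure_iUnion (s := fun n => s ∩ spanningSets α n), ← inter_iUnion,
        iUnion_spanningSets, inter_univ]
      exact fun i j hij => inter_subset_inter_right _ (monotone_spanningSets α hij)
    rw [h1]
    exact Measurable.iSup (mδ := m0) fun n =>
      hfin ⟨s ∩ spanningSets α n, hs.inter (measurableSet_spanningSets α n),
        (measure_mono inter_subset_right).trans_lt (measure_spanningSets_lt_top α n)⟩
  exact fun s hs => hval hs

/-- A finite combination of indicators with real coefficients. -/
def realStep (t : Finset (FiniteSet α)) (c : t → ℝ) : testFunctions α :=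
  ∑ B : t, (c B : ℂ) • indicatorTest α B.1.1 B.1.2.1 B.1.2.2

lemma star_realStep (t : Finset (FiniteSet α)) (c : t → ℝ) : star (realStep t c) = realStep t c := by
  simp only [realStep, star_sum, star_smul, star_indicatorTest]
  simp

namespace IsGammaLaw

variable [IsProbabilityMeasure ρ]

omit [IsProbabilityMeasure ρ] in
-- Taking `f` to be real combinations of indicators gives the characteristic functions of all finite
-- vectors of masses. These determine the joint laws, and the cylinder sets form a generating
-- π-system.
lemma ext_of_forall_integral_cexp [SigmaFinite α] (hρ : IsGammaLaw α ρ)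
    {ν₁ ν₂ : Measure (SFiniteMeasure X)} [IsFiniteMeasure ν₁] [IsFiniteMeasure ν₂]
    (h₁ : ν₁ ≪ ρ) (h₂ : ν₂ ≪ ρ)
    (h : ∀ f : testFunctions α, star f = f →
      ∫ μ, Complex.exp (pairing f μ * Complex.I) ∂ν₁
        = ∫ μ, Complex.exp (pairing f μ * Complex.I) ∂ν₂) : ν₁ = ν₂ := by
  classical
  let Y : (t : Finset (FiniteSet α)) → SFiniteMeasure X → EuclideanSpace ℝ t := fun t μ =>
    WithLp.toLp 2 fun B => mass B.1.1 μ
  have hYm : ∀ t, Measurable (Y t) := fun t =>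
    (WithLp.measurable_toLp 2 _).comp (measurable_pi_lambda _ fun B => measurable_mass B.1.2.1)
  have hY : ∀ t, ν₁.map (Y t) = ν₂.map (Y t) := fun t => by
    refine Measure.ext_of_charFun (funext fun c => ?_)
    have hint : ∀ ν : Measure (SFiniteMeasure X), ν ≪ ρ → charFun (ν.map (Y t)) c
        = ∫ μ, Complex.exp (pairing (realStep t c.ofLp) μ * Complex.I) ∂ν := fun ν hν => by
      rw [charFun_apply, integral_map (hYm t).aemeasurable (by fun_prop)]
      refine integral_congr_ae (hν.ae_le ?_)
      filter_upwards [hρ.pairing_sum_ae Finset.univ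
        fun B : t => (c.ofLp B : ℂ) • indicatorTest α B.1.1 B.1.2.1 B.1.2.2] with μ hμ
      rw [realStep, hμ, PiLp.inner_apply]
      simp only [pairing_smul, pairing_indicatorTest, Y]
      push_cast
      simp
    rw [hint ν₁ h₁, hint ν₂ h₂]
    exact h _ (star_realStep t _)
  have hae : ∀ t : Finset (FiniteSet α), ∀ᵐ μ ∂ρ, ∀ B ∈ t, μ.1 B.1 < ∞ := fun t =>
    (ae_ball_iff t.countable_toSet).2 fun B _ => hρ.ae_lt_top B.2.1 B.2.2.ne
  refine ext_of_generate_finite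
    (piiUnionInter (fun B : FiniteSet α => {s | MeasurableSet[MeasurableSpace.comap
      (fun μ : SFiniteMeasure X => μ.1 B.1) inferInstance] s}) univ) ?_
    (isPiSystem_piiUnionInter _ (fun B => @MeasurableSpace.isPiSystem_measurableSet _ (_)) _) ?_ ?_
  · rw [generateFrom_piiUnionInter_measurableSet (fun B : FiniteSet α => MeasurableSpace.comap
      (fun μ : SFiniteMeasure X => μ.1 B.1) inferInstance)]
    simpa using measurableSpace_eq_iSup
  · rintro s ⟨t, -, A, hA, rfl⟩
    choose! A' hA'm hA' using hA
    -- A condition on extended masses is rewritten for real masses; the two agree almost everywhere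
    -- since these masses are finite.
    let Z : Set (EuclideanSpace ℝ t) := ⋂ B : t, {y | ENNReal.ofReal (y.ofLp B) ∈ A' B.1}
    have hZm : MeasurableSet Z := MeasurableSet.iInter fun B =>
      (ENNReal.measurable_ofReal.comp (by fun_prop)) (hA'm B.1 B.2)
    have hset : ∀ ν : Measure (SFiniteMeasure X), ν ≪ ρ →
        ν (⋂ B ∈ t, A B) = ν.map (Y t) Z := fun ν hν => by
      rw [Measure.map_apply (hYm t) hZm]
      refine measure_congr (hν.ae_le ?_)
      filter_upwards [hae t] with μ hμ
      have hiff : μ ∈ (⋂ B ∈ t, A B) ↔ μ ∈ Y t ⁻¹' Z := by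
        have hB : ∀ B ∈ t, (μ ∈ A B ↔ ENNReal.ofReal (mass B.1 μ) ∈ A' B) := fun B hB => by
          rw [← hA' B hB, mem_preimage, mass, ENNReal.ofReal_toReal (hμ B hB).ne]
        simp only [mem_iInter, mem_preimage, Z, Y]
        exact ⟨fun H B => (hB B.1 B.2).1 (H B.1 B.2), fun H B hBt => (hB B hBt).2 (H ⟨B, hBt⟩)⟩
      exact propext hiff
    rw [hset ν₁ h₁, hset ν₂ h₂, hY]
  -- The empty family of masses yields the equality of the total masses.
  · have h0 := hY ∅
    have h1 := congrArg (fun m => m univ) h0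
    simpa [Measure.map_apply (hYm ∅) MeasurableSet.univ] using h1

/-- The measures with densities `r⁺` and `r⁻` have the same Fourier transform, hence coincide, and
`r⁺ = r⁻` forces `r = 0`. -/
lemma ae_eq_zero_of_forall_integral_cexp [SigmaFinite α] (hρ : IsGammaLaw α ρ)
    {r : SFiniteMeasure X → ℝ} (hr : Integrable r ρ)
    (h : ∀ f : testFunctions α, star f = f →
      ∫ μ, Complex.exp (pairing f μ * Complex.I) * (r μ : ℂ) ∂ρ = 0) : r =ᵐ[ρ] 0 := by
  have hfin₁ := isFiniteMeasure_withDensity_ofReal hr.2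
  have hfin₂ := isFiniteMeasure_withDensity_ofReal hr.neg.2
  have hm₁ : AEMeasurable (fun μ => ENNReal.ofReal (r μ)) ρ := hr.1.aemeasurable.ennreal_ofReal
  have hm₂ : AEMeasurable (fun μ => ENNReal.ofReal ((-r) μ)) ρ :=
    hr.neg.1.aemeasurable.ennreal_ofReal
  have heq := hρ.ext_of_forall_integral_cexp (withDensity_absolutelyContinuous ρ _)
    (withDensity_absolutelyContinuous ρ _) (ν₁ := ρ.withDensity fun μ => ENNReal.ofReal (r μ))
    (ν₂ := ρ.withDensity fun μ => ENNReal.ofReal ((-r) μ)) fun f hf => by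
      have hint : ∀ u : SFiniteMeasure X → ℝ, Integrable u ρ → Integrable
          (fun μ => (ENNReal.ofReal (u μ)).toReal • Complex.exp (pairing f μ * Complex.I)) ρ :=
        fun u hu => by
          have h1 : Integrable (fun μ => ((max (u μ) 0 : ℝ) : ℂ)) ρ := hu.pos_part.ofReal
          have h2 : AEStronglyMeasurable (fun μ => Complex.exp (pairing f μ * Complex.I)) ρ :=
            Complex.continuous_exp.comp_aestronglyMeasurable
              ((hρ.aestronglyMeasurable_pairing f).mul_const Complex.I)
          refine (h1.bdd_mul h2 (c := 1) (ae_of_all _ fun μ => ?_)).congr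
            (ae_of_all _ fun μ => ?_)
          · rw [pairing_eq_ofReal hf μ, Complex.norm_exp_ofReal_mul_I]
          · simp only [ENNReal.toReal_ofReal', Complex.real_smul]
            rw [mul_comm]
      rw [integral_withDensity_eq_integral_toReal_smul₀ hm₁ (by simp),
        integral_withDensity_eq_integral_toReal_smul₀ hm₂ (by simp), ← sub_eq_zero,
        ← integral_sub (hint r hr) (hint (-r) hr.neg), ← h f hf]
      congr 1 with μ
      rw [← sub_smul, ENNReal.toReal_ofReal', ENNReal.toReal_ofReal', Pi.neg_apply,
        max_zero_sub_max_neg_zero_eq_self, Complex.real_smul, mul_comm]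
  rw [withDensity_eq_iff_of_sigmaFinite hm₁ hm₂] at heq
  filter_upwards [heq] with μ hμ
  rw [Pi.neg_apply] at hμ
  rcases le_total (r μ) 0 with h0 | h0
  · rw [ENNReal.ofReal_of_nonpos h0] at hμ
    exact le_antisymm h0 (by simpa using ENNReal.ofReal_eq_zero.1 hμ.symm)
  · rw [ENNReal.ofReal_of_nonpos (neg_nonpos.2 h0)] at hμ
    exact le_antisymm (ENNReal.ofReal_eq_zero.1 hμ) h0

/-- A square integrable function that is orthogonal to all polynomial functionals vanishes. -/
theorem ae_eq_zero_of_forall_integral_evalPoly [SigmaFinite α] (hρ : IsGammaLaw α ρ)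
    {g : SFiniteMeasure X → ℂ} (hg : MemLp g 2 ρ)
    (h : ∀ P : MvPolynomial (testFunctions α) ℂ, ∫ μ, evalPoly P μ * g μ ∂ρ = 0) :
    g =ᵐ[ρ] 0 := by
  have hgi : Integrable g ρ := hg.integrable one_le_two
  have hexpm : ∀ f : testFunctions α,
      AEStronglyMeasurable (fun μ => Complex.exp (pairing f μ * Complex.I)) ρ := fun f =>
    Complex.continuous_exp.comp_aestronglyMeasurable
      ((hρ.aestronglyMeasurable_pairing f).mul_const Complex.I)
  have hint : ∀ f : testFunctions α, star f = f → ∀ u : SFiniteMeasure X → ℂ, Integrable u ρ →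
      Integrable (fun μ => Complex.exp (pairing f μ * Complex.I) * u μ) ρ := fun f hf u hu =>
    hu.bdd_mul (hexpm f) (c := 1) (ae_of_all _ fun μ => by
      rw [pairing_eq_ofReal hf μ, Complex.norm_exp_ofReal_mul_I])
  have h1 : ∀ f : testFunctions α, star f = f →
      ∫ μ, Complex.exp (pairing f μ * Complex.I) * g μ ∂ρ = 0 := fun f hf =>
    hρ.integral_cexp_mul_eq_zero hf hg h
  -- Conjugating the identity for `-f` shows that `conj g` satisfies it too, so real and imaginary
  -- parts can be treated separately.
  have h2 : ∀ f : testFunctions α, star f = f →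
      ∫ μ, Complex.exp (pairing f μ * Complex.I) * conj (g μ) ∂ρ = 0 := fun f hf => by
    have h3 := congrArg conj (h1 ((-1 : ℂ) • f) (by simp [hf]))
    rw [← integral_conj, map_zero] at h3
    rw [← h3]
    congr 1 with μ
    rw [map_mul, ← Complex.exp_conj, map_mul, Complex.conj_I, pairing_smul, map_mul,
      ← pairing_star, hf]
    simp
  have hgc : Integrable (fun μ => conj (g μ)) ρ :=
    Complex.conjLIE.toContinuousLinearEquiv.toContinuousLinearMap.integrable_comp hgi
  have hre : (fun μ => (g μ).re) =ᵐ[ρ] 0 := by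
    refine hρ.ae_eq_zero_of_forall_integral_cexp hgi.re fun f hf => ?_
    have h4 := integral_add (hint f hf _ hgi) (hint f hf _ hgc)
    rw [h1 f hf, h2 f hf, add_zero] at h4
    rw [← mul_zero (1 / 2 : ℂ), ← h4, ← integral_const_mul]
    congr 1 with μ
    rw [← mul_add, Complex.add_conj]
    push_cast
    ring
  have him : (fun μ => (g μ).im) =ᵐ[ρ] 0 := by
    refine hρ.ae_eq_zero_of_forall_integral_cexp hgi.im fun f hf => ?_
    have h4 := integral_sub (hint f hf _ hgi) (hint f hf _ hgc)
    rw [h1 f hf, h2 f hf, sub_zero] at h4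
    rw [← mul_zero (-Complex.I / 2 : ℂ), ← h4, ← integral_const_mul]
    congr 1 with μ
    rw [← mul_sub, Complex.sub_conj]
    push_cast
    linear_combination (Complex.exp (pairing f μ * Complex.I) * (g μ).im) * Complex.I_mul_I
  filter_upwards [hre, him] with μ hr hi
  exact Complex.ext hr hi

end IsGammaLaw

end

end GammaCurrent

namespace GammaCurrent

noncomputable section

open MvPolynomial Filter Topology

/-! ### The operators on the domain -/

variable {X : Type*} [MeasurableSpace X] {α : Measure X} {ρ : Measure (SFiniteMeasure X)}

/-- Complex conjugation of formal polynomials. -/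
def polyStar : MvPolynomial (testFunctions α) ℂ →+* MvPolynomial (testFunctions α) ℂ :=
  eval₂Hom (C.comp (starRingEnd ℂ)) fun g => MvPolynomial.X (star g)

@[simp] lemma polyStar_C (c : ℂ) :
    polyStar (C c : MvPolynomial (testFunctions α) ℂ) = C (conj c) := by simp [polyStar]

@[simp] lemma polyStar_X (g : testFunctions α) :
    polyStar (MvPolynomial.X g) = MvPolynomial.X (star g) := by simp [polyStar]

lemma evalPoly_polyStar (P : MvPolynomial (testFunctions α) ℂ) (μ : SFiniteMeasure X) :
    evalPoly (polyStar P) μ = conj (evalPoly P μ) := by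
  induction P using MvPolynomial.induction_on with
  | C c => rw [polyStar_C, evalPoly_C, evalPoly_C]
  | add p q hp hq => rw [map_add, evalPoly_add, evalPoly_add, hp, hq, map_add]
  | mul_X p g hp =>
    rw [map_mul, polyStar_X, evalPoly_mul, evalPoly_mul, evalPoly_X, evalPoly_X, hp, pairing_star,
      map_mul]

lemma controlMean_star (f : testFunctions α) :
    controlMean α (star f) = conj (controlMean α f) := integral_conj

lemma controlMean_add (f g : testFunctions α) :
    controlMean α (f + g) = controlMean α f + controlMean α g :=
  integral_add (integrable_testFunctions f) (integrable_testFunctions g)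

lemma controlMean_smul (c : ℂ) (f : testFunctions α) :
    controlMean α (c • f) = c * controlMean α f := integral_const_mul c _

lemma controlMean_zero : controlMean α (0 : testFunctions α) = 0 := integral_zero X ℂ

lemma polyStar_scaleDeriv (φ : testFunctions α) (P : MvPolynomial (testFunctions α) ℂ) :
    polyStar (scaleDeriv φ P) = scaleDeriv (star φ) (polyStar P) := by
  have hC : ∀ (ψ : testFunctions α) (c : ℂ), scaleDeriv ψ (C c) = 0 := fun ψ c => by
    rw [← algebraMap_eq, Derivation.map_algebraMap]
  induction P using MvPolynomial.induction_on with
  | C c => rw [polyStar_C, hC, hC, map_zero]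
  | add p q hp hq => simp only [map_add, hp, hq]
  | mul_X p g hp =>
    rw [mul_comm, scaleDeriv_X_mul, map_mul, polyStar_X, scaleDeriv_X_mul, map_add, map_mul,
      map_mul, polyStar_X, polyStar_X, hp, star_mul']

lemma polyStar_lowerOp (φ : testFunctions α) (P : MvPolynomial (testFunctions α) ℂ) :
    polyStar (lowerOp (controlMean α) φ P)
      = lowerOp (controlMean α) (star φ) (polyStar P) := by
  have hC : ∀ (ψ : testFunctions α) (c : ℂ), lowerOp (controlMean α) ψ (C c) = 0 := fun ψ c => by
    rw [← mul_one (C c), C_mul_eq_smul, map_smul, lowerOp_one, smul_zero]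
  induction P using MvPolynomial.induction_on with
  | C c => rw [polyStar_C, hC, hC, map_zero]
  | add p q hp hq => simp only [map_add, hp, hq]
  | mul_X p g hp =>
    rw [mul_comm, lowerOp_X_mul, map_mul, polyStar_X, lowerOp_X_mul]
    simp only [map_add, map_mul, polyStar_X, polyStar_C, hp, polyStar_scaleDeriv, star_mul',
      map_ofNat, ← controlMean_star]

namespace IsGammaLaw

variable [IsProbabilityMeasure ρ] (hρ : IsGammaLaw α ρ)

include hρ in
lemma memLp_two_evalPoly (P : MvPolynomial (testFunctions α) ℂ) : MemLp (evalPoly P) 2 ρ := by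
  exact_mod_cast hρ.memLp_evalPoly P 2

/-- The class of a polynomial functional in the domain. -/
def toDomain : MvPolynomial (testFunctions α) ℂ →ₗ[ℂ] polyDomain α ρ where
  toFun P := ⟨(hρ.memLp_two_evalPoly P).toLp (evalPoly P), evalPoly P,
    (mem_polyFunctionals_iff_evalPoly _).2 ⟨P, rfl⟩, MemLp.coeFn_toLp _⟩
  map_add' P Q := by
    refine Subtype.ext (Lp.ext ?_)
    refine (hρ.memLp_two_evalPoly (P + Q)).coeFn_toLp.trans
      (EventuallyEq.trans ?_ (Lp.coeFn_add _ _).symm)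
    filter_upwards [(hρ.memLp_two_evalPoly P).coeFn_toLp, (hρ.memLp_two_evalPoly Q).coeFn_toLp]
      with μ h1 h2
    rw [evalPoly_add, Pi.add_apply, h1, h2]
  map_smul' c P := by
    refine Subtype.ext (Lp.ext ?_)
    refine (hρ.memLp_two_evalPoly (c • P)).coeFn_toLp.trans
      (EventuallyEq.trans ?_ (Lp.coeFn_smul _ _).symm)
    filter_upwards [(hρ.memLp_two_evalPoly P).coeFn_toLp] with μ h1
    rw [evalPoly_smul, Pi.smul_apply, h1]
    rfl

lemma coeFn_toDomain (P : MvPolynomial (testFunctions α) ℂ) :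
    ((hρ.toDomain P : polyDomain α ρ) : Lp ℂ 2 ρ) =ᵐ[ρ] evalPoly P :=
  (hρ.memLp_two_evalPoly P).coeFn_toLp

lemma eq_toDomain {v : polyDomain α ρ} {P : MvPolynomial (testFunctions α) ℂ}
    (h : (v : Lp ℂ 2 ρ) =ᵐ[ρ] evalPoly P) : v = hρ.toDomain P :=
  Subtype.ext (Lp.ext (h.trans (hρ.coeFn_toDomain P).symm))

lemma toDomain_surjective : Function.Surjective hρ.toDomain := by
  rintro ⟨v, F, hF, hv⟩
  obtain ⟨P, rfl⟩ := (mem_polyFunctionals_iff_evalPoly _).1 hF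
  exact ⟨P, (hρ.eq_toDomain hv).symm⟩

lemma toDomain_congr {P Q : MvPolynomial (testFunctions α) ℂ}
    (h : ∀ᵐ μ ∂ρ, evalPoly P μ = evalPoly Q μ) : hρ.toDomain P = hρ.toDomain Q :=
  hρ.eq_toDomain ((hρ.coeFn_toDomain P).trans h)

lemma inner_toDomain (P Q : MvPolynomial (testFunctions α) ℂ) :
    inner ℂ (hρ.toDomain P : Lp ℂ 2 ρ) (hρ.toDomain Q : Lp ℂ 2 ρ)
      = hρ.expectation (polyStar P * Q) := by
  rw [L2.inner_def]
  refine integral_congr_ae ?_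
  filter_upwards [hρ.coeFn_toDomain P, hρ.coeFn_toDomain Q] with μ h1 h2
  rw [h1, h2, evalPoly_mul, evalPoly_polyStar, RCLike.inner_apply, mul_comm]

/-- Nullity becomes orthogonality to all polynomials (test with the conjugate of `P`), a condition
that operators with a transpose visibly preserve. -/
lemma toDomain_eq_zero_iff {P : MvPolynomial (testFunctions α) ℂ} :
    hρ.toDomain P = 0 ↔ ∀ Q, hρ.expectation (Q * P) = 0 := by
  constructor
  · intro h Q
    have h1 := hρ.coeFn_toDomain P
    rw [h] at h1
    refine integral_eq_zero_of_ae ?_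
    filter_upwards [h1, Lp.coeFn_zero ℂ 2 ρ] with μ h2 h3
    rw [evalPoly_mul, ← h2]
    change _ * ((0 : Lp ℂ 2 ρ) : SFiniteMeasure X → ℂ) μ = 0
    rw [h3, Pi.zero_apply, mul_zero]
  · intro h
    have h1 := hρ.inner_toDomain P P
    rw [h, inner_self_eq_zero] at h1
    exact Subtype.ext h1

/-- An operator on formal polynomials that has a transpose acts on the domain. -/
def descend (T S : MvPolynomial (testFunctions α) ℂ →ₗ[ℂ] MvPolynomial (testFunctions α) ℂ)
    (hTS : ∀ F G, hρ.expectation (S F * G) = hρ.expectation (F * T G)) :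
    Module.End ℂ (polyDomain α ρ) :=
  -- `E(Q · T P) = E(S Q · P) = 0` for every `Q`.
  have hker : ∀ P, hρ.toDomain P = 0 → hρ.toDomain (T P) = 0 := fun P hP => by
    rw [toDomain_eq_zero_iff] at hP ⊢
    intro Q
    rw [← hTS]
    exact hP _
  have hcongr : ∀ P Q, hρ.toDomain P = hρ.toDomain Q → hρ.toDomain (T P) = hρ.toDomain (T Q) :=
    fun P Q h => by
      rw [← sub_eq_zero, ← map_sub] at h ⊢
      rw [← map_sub]
      exact hker _ h
  have hinv : ∀ v, hρ.toDomain (Function.surjInv hρ.toDomain_surjective v) = v :=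
    Function.surjInv_eq hρ.toDomain_surjective
  { toFun := fun v => hρ.toDomain (T (Function.surjInv hρ.toDomain_surjective v))
    map_add' := fun u v => by
      rw [← map_add, ← map_add]
      exact hcongr _ _ (by rw [hinv, map_add, hinv, hinv])
    map_smul' := fun c v => by
      rw [RingHom.id_apply, ← map_smul, ← map_smul]
      exact hcongr _ _ (by rw [hinv, map_smul, hinv]) }

lemma descend_toDomain
    (T S : MvPolynomial (testFunctions α) ℂ →ₗ[ℂ] MvPolynomial (testFunctions α) ℂ)
    (hTS : ∀ F G, hρ.expectation (S F * G) = hρ.expectation (F * T G))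
    (P : MvPolynomial (testFunctions α) ℂ) :
    hρ.descend T S hTS (hρ.toDomain P) = hρ.toDomain (T P) := by
  change hρ.toDomain (T (Function.surjInv hρ.toDomain_surjective _)) = _
  rw [← sub_eq_zero, ← map_sub, ← map_sub, toDomain_eq_zero_iff]
  intro Q
  rw [← hTS]
  refine hρ.toDomain_eq_zero_iff.1 ?_ _
  rw [map_sub, Function.surjInv_eq hρ.toDomain_surjective, sub_self]

include hρ in
lemma expectation_lowerOp_mul (φ : testFunctions α) (F G : MvPolynomial (testFunctions α) ℂ) :
    hρ.expectation (lowerOp (controlMean α) φ F * G) = hρ.expectation (F * raiseOp φ G) := by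
  rw [hρ.integrationByParts.lowerOp_mul]
  congr 2
  simp only [raiseOp, LinearMap.sub_apply, LinearMap.add_apply, LinearMap.smul_apply,
    LinearMap.mulLeft_apply, LinearMap.id_apply, Derivation.coeFn_coe, two_mul_eq_smul, sub_mul,
    C_mul_eq_smul]
  abel

include hρ in
-- The transpose of `-L_φ` is `-L_φ + 2 D_φ - X_φ + α(φ)` and that of `D_φ` is `X_φ - α(φ) - D_φ`;
-- their sum is again `D_φ - L_φ`.
lemma expectation_neutralOp_mul (φ : testFunctions α) (F G : MvPolynomial (testFunctions α) ℂ) :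
    hρ.expectation (neutralOp φ F * G) = hρ.expectation (F * neutralOp φ G) := by
  have h1 := hρ.expectation_lowerOp_mul φ F G
  have h2 := hρ.integrationByParts.scaleDeriv_mul φ F G
  simp only [neutralOp, raiseOp, LinearMap.neg_apply, LinearMap.sub_apply, LinearMap.add_apply,
    LinearMap.smul_apply, LinearMap.mulLeft_apply, LinearMap.id_apply, Derivation.coeFn_coe,
    mul_add, mul_sub, add_mul, neg_mul, mul_neg, map_add, map_sub, map_neg, smul_mul_assoc,
    mul_smul_comm, map_smul, smul_eq_mul, sub_mul, C_mul_eq_smul] at h1 h2 ⊢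
  rw [h1, h2]
  ring

/-- Multiplication by a polynomial functional. -/
def mulOp (Q : MvPolynomial (testFunctions α) ℂ) : Module.End ℂ (polyDomain α ρ) :=
  hρ.descend (LinearMap.mulLeft ℂ Q) (LinearMap.mulLeft ℂ Q) fun F G => by
    rw [LinearMap.mulLeft_apply, LinearMap.mulLeft_apply, mul_comm Q, mul_assoc]

/-- The first order operator `F ↦ ∫ φ(x) δF/δμ(x) μ(dx)`. -/
def derivOp (φ : testFunctions α) : Module.End ℂ (polyDomain α ρ) :=
  hρ.descend (scaleDeriv φ).toLinearMap
    (LinearMap.mulLeft ℂ (MvPolynomial.X φ - C (controlMean α φ)) - (scaleDeriv φ).toLinearMap)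
    fun F G => by
      have h := hρ.integrationByParts.scaleDeriv_mul φ G F
      simp only [LinearMap.sub_apply, LinearMap.mulLeft_apply, Derivation.coeFn_coe]
      rw [mul_comm _ G, ← h, mul_comm]

/-- The second order operator `F ↦ ∫ φ(x) δ²F/δμ(x)² μ(dx) + ∫ φ(x) δF/δμ(x) α(dx)`. -/
def secondOp (φ : testFunctions α) : Module.End ℂ (polyDomain α ρ) :=
  hρ.descend (lowerOp (controlMean α) φ) (raiseOp φ) fun F G => by
    rw [mul_comm, ← hρ.expectation_lowerOp_mul, mul_comm]

@[simp] lemma mulOp_toDomain (Q P : MvPolynomial (testFunctions α) ℂ) :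
    hρ.mulOp Q (hρ.toDomain P) = hρ.toDomain (Q * P) := hρ.descend_toDomain _ _ _ P

@[simp] lemma derivOp_toDomain (φ : testFunctions α) (P : MvPolynomial (testFunctions α) ℂ) :
    hρ.derivOp φ (hρ.toDomain P) = hρ.toDomain (scaleDeriv φ P) := hρ.descend_toDomain _ _ _ P

@[simp] lemma secondOp_toDomain (φ : testFunctions α) (P : MvPolynomial (testFunctions α) ℂ) :
    hρ.secondOp φ (hρ.toDomain P) = hρ.toDomain (lowerOp (controlMean α) φ P) :=
  hρ.descend_toDomain _ _ _ P

lemma end_ext {S T : Module.End ℂ (polyDomain α ρ)}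
    (h : ∀ P, S (hρ.toDomain P) = T (hρ.toDomain P)) : S = T := by
  refine LinearMap.ext fun v => ?_
  obtain ⟨P, rfl⟩ := hρ.toDomain_surjective v
  exact h P

/-! ### Relations between the operators on the domain -/

lemma mulOp_mul (P Q : MvPolynomial (testFunctions α) ℂ) :
    hρ.mulOp (P * Q) = hρ.mulOp P * hρ.mulOp Q :=
  hρ.end_ext fun R => by simp [mul_assoc]

lemma mulOp_add (P Q : MvPolynomial (testFunctions α) ℂ) :
    hρ.mulOp (P + Q) = hρ.mulOp P + hρ.mulOp Q :=
  hρ.end_ext fun R => by simp [add_mul]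

lemma mulOp_comm (P Q : MvPolynomial (testFunctions α) ℂ) :
    hρ.mulOp P * hρ.mulOp Q = hρ.mulOp Q * hρ.mulOp P := by
  rw [← mulOp_mul, ← mulOp_mul, mul_comm]

lemma mulOp_congr {P Q : MvPolynomial (testFunctions α) ℂ}
    (h : ∀ᵐ μ ∂ρ, evalPoly P μ = evalPoly Q μ) : hρ.mulOp P = hρ.mulOp Q :=
  hρ.end_ext fun R => by
    rw [mulOp_toDomain, mulOp_toDomain]
    exact hρ.toDomain_congr (h.mono fun μ hμ => by rw [evalPoly_mul, evalPoly_mul, hμ])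

/-- False for formal polynomials, where the variables are independent; true on classes because `μ(f
+ g) = μ(f) + μ(g)` almost surely. -/
lemma mulOp_X_add (f g : testFunctions α) : hρ.mulOp (MvPolynomial.X (f + g))
    = hρ.mulOp (MvPolynomial.X f) + hρ.mulOp (MvPolynomial.X g) := by
  rw [← mulOp_add]
  refine hρ.mulOp_congr ?_
  filter_upwards [hρ.pairing_add_ae f g] with μ h
  rw [evalPoly_add, evalPoly_X, evalPoly_X, evalPoly_X, h]

lemma mulOp_X_smul (c : ℂ) (f : testFunctions α) : hρ.mulOp (MvPolynomial.X (c • f))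
    = c • hρ.mulOp (MvPolynomial.X f) := by
  have h : hρ.mulOp (MvPolynomial.X (c • f)) = hρ.mulOp (c • MvPolynomial.X f) :=
    hρ.mulOp_congr (ae_of_all _ fun μ => by
      rw [evalPoly_smul, evalPoly_X, evalPoly_X, pairing_smul])
  rw [h]
  exact hρ.end_ext fun R => by simp

lemma derivOp_mul_mulOp (φ g : testFunctions α) :
    hρ.derivOp φ * hρ.mulOp (MvPolynomial.X g)
      = hρ.mulOp (MvPolynomial.X g) * hρ.derivOp φ + hρ.mulOp (MvPolynomial.X (φ * g)) :=
  hρ.end_ext fun P => by simp [scaleDeriv_X_mul, -Derivation.leibniz]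

lemma secondOp_mul_mulOp (φ g : testFunctions α) :
    hρ.secondOp φ * hρ.mulOp (MvPolynomial.X g)
      = hρ.mulOp (MvPolynomial.X g) * hρ.secondOp φ + (2 : ℂ) • hρ.derivOp (φ * g)
        + controlMean α (φ * g) • 1 :=
  hρ.end_ext fun P => by
    simp [lowerOp_X_mul, two_mul_eq_smul, C_mul_eq_smul]

lemma derivOp_comm (φ θ : testFunctions α) :
    hρ.derivOp φ * hρ.derivOp θ = hρ.derivOp θ * hρ.derivOp φ :=
  hρ.end_ext fun P => by simp [scaleDeriv_comm φ θ]

lemma derivOp_mul_secondOp (φ θ : testFunctions α) :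
    hρ.derivOp θ * hρ.secondOp φ = hρ.secondOp φ * hρ.derivOp θ - hρ.secondOp (θ * φ) :=
  hρ.end_ext fun P => by simp [scaleDeriv_lowerOp]

lemma secondOp_comm (φ θ : testFunctions α) :
    hρ.secondOp φ * hρ.secondOp θ = hρ.secondOp θ * hρ.secondOp φ :=
  hρ.end_ext fun P => by simp [lowerOp_comm _ φ θ]

/-- Operators on the domain agree if they agree at the vacuum and the agreement is preserved by
multiplications. -/
lemma end_ext_mulOp {S T : Module.End ℂ (polyDomain α ρ)}
    (h1 : S (hρ.toDomain 1) = T (hρ.toDomain 1))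
    (hX : ∀ g v, S v = T v →
      (S * hρ.mulOp (MvPolynomial.X g)) v = (T * hρ.mulOp (MvPolynomial.X g)) v) : S = T :=
  hρ.end_ext (eq_of_one_of_X_mul (S := S ∘ₗ hρ.toDomain) (T := T ∘ₗ hρ.toDomain) h1 fun g P h => by
    have := hX g _ h
    simpa using this)

lemma secondOp_one (φ : testFunctions α) : hρ.secondOp φ (hρ.toDomain 1) = 0 := by simp

/-- Both sides kill the vacuum and have the same commutators with multiplications, by `mulOp_X_add`.
The later linearity lemmas follow the same pattern. -/
lemma derivOp_add (f g : testFunctions α) :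
    hρ.derivOp (f + g) = hρ.derivOp f + hρ.derivOp g := by
  refine hρ.end_ext_mulOp (by simp) fun h v hv => ?_
  rw [LinearMap.add_apply] at hv
  rw [add_mul, derivOp_mul_mulOp, derivOp_mul_mulOp, derivOp_mul_mulOp, add_mul, mulOp_X_add]
  simp only [LinearMap.add_apply, Module.End.mul_apply, hv, map_add]
  abel

lemma derivOp_smul (c : ℂ) (f : testFunctions α) :
    hρ.derivOp (c • f) = c • hρ.derivOp f := by
  refine hρ.end_ext_mulOp (by simp) fun h v hv => ?_
  rw [LinearMap.smul_apply] at hv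
  rw [smul_mul_assoc, derivOp_mul_mulOp, derivOp_mul_mulOp, smul_mul_assoc, mulOp_X_smul]
  simp only [LinearMap.add_apply, Module.End.mul_apply, hv, map_smul, LinearMap.smul_apply,
    smul_add]

lemma secondOp_add (f g : testFunctions α) :
    hρ.secondOp (f + g) = hρ.secondOp f + hρ.secondOp g := by
  refine hρ.end_ext_mulOp (by simp) fun h v hv => ?_
  rw [LinearMap.add_apply] at hv
  rw [add_mul, secondOp_mul_mulOp, secondOp_mul_mulOp, secondOp_mul_mulOp, add_mul, derivOp_add,
    controlMean_add]
  simp only [LinearMap.add_apply, Module.End.mul_apply, hv, map_add, LinearMap.smul_apply,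
    smul_add, add_smul]
  abel

lemma secondOp_smul (c : ℂ) (f : testFunctions α) :
    hρ.secondOp (c • f) = c • hρ.secondOp f := by
  refine hρ.end_ext_mulOp (by simp) fun h v hv => ?_
  rw [LinearMap.smul_apply] at hv
  rw [smul_mul_assoc, secondOp_mul_mulOp, secondOp_mul_mulOp, smul_mul_assoc, derivOp_smul,
    controlMean_smul]
  simp only [LinearMap.add_apply, Module.End.mul_apply, hv, map_smul, LinearMap.smul_apply,
    smul_add, smul_smul, mul_comm c]

/-- The raising operators. -/
def raising (φ : testFunctions α) : Module.End ℂ (polyDomain α ρ) :=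
  hρ.secondOp φ - (2 : ℂ) • hρ.derivOp φ + hρ.mulOp (MvPolynomial.X φ) - controlMean α φ • 1

/-- The lowering operators. -/
def lowering (φ : testFunctions α) : Module.End ℂ (polyDomain α ρ) := hρ.secondOp (star φ)

/-- The neutral operators. -/
def neutral (φ : testFunctions α) : Module.End ℂ (polyDomain α ρ) :=
  hρ.derivOp φ - hρ.secondOp φ + ((1 / 2 : ℂ) * controlMean α φ) • 1

lemma raising_toDomain (φ : testFunctions α) (P : MvPolynomial (testFunctions α) ℂ) :
    hρ.raising φ (hρ.toDomain P) = hρ.toDomain (raiseOp φ P) := by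
  simp [raising, raiseOp]

lemma lowering_toDomain (φ : testFunctions α) (P : MvPolynomial (testFunctions α) ℂ) :
    hρ.lowering φ (hρ.toDomain P) = hρ.toDomain (lowerOp (controlMean α) (star φ) P) := by
  simp [lowering]

lemma neutral_toDomain (φ : testFunctions α) (P : MvPolynomial (testFunctions α) ℂ) :
    hρ.neutral φ (hρ.toDomain P) = hρ.toDomain (neutralOp φ P) := by
  simp [neutral, neutralOp, sub_eq_neg_add]

lemma isGivenBy_of_toDomain {T : Module.End ℂ (polyDomain α ρ)}
    {A : (SFiniteMeasure X → ℂ) → SFiniteMeasure X → ℂ}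
    {S : MvPolynomial (testFunctions α) ℂ →ₗ[ℂ] MvPolynomial (testFunctions α) ℂ}
    (hT : ∀ P, T (hρ.toDomain P) = hρ.toDomain (S P))
    (hA : ∀ P, A (evalPoly P) =ᵐ[ρ] evalPoly (S P)) : IsGivenBy T A := by
  intro F hF v hv
  obtain ⟨P, rfl⟩ := (mem_polyFunctionals_iff_evalPoly _).1 hF
  rw [hρ.eq_toDomain hv, hT]
  exact (hρ.coeFn_toDomain _).trans (hA P).symm

end IsGammaLaw

end

end GammaCurrent

namespace GammaCurrent

noncomputable section

open MvPolynomial Filter Topology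

/-! ### The Fock representation -/

variable {X : Type*} [MeasurableSpace X] {α : Measure X} {ρ : Measure (SFiniteMeasure X)}

namespace IsGammaLaw

variable [IsProbabilityMeasure ρ] (hρ : IsGammaLaw α ρ)

lemma vacuum_eq : vacuum α ρ = hρ.toDomain 1 := by
  refine hρ.eq_toDomain ?_
  refine (Lp.coeFn_const 2 ρ (1 : ℂ)).trans (ae_of_all _ fun μ => ?_)
  rw [evalPoly_one, Function.const_apply]

include hρ in
-- Testing against conjugated polynomials turns orthogonality in the sesquilinear sense into the
-- vanishing of `∫ P h dρ` for all `P`.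
lemma dense_polyDomain [SigmaFinite α] : Dense (polyDomain α ρ : Set (Lp ℂ 2 ρ)) := by
  rw [Submodule.dense_iff_topologicalClosure_eq_top, Submodule.topologicalClosure_eq_top_iff,
    Submodule.eq_bot_iff]
  intro h hh
  rw [Submodule.mem_orthogonal] at hh
  refine Lp.ext (EventuallyEq.trans ?_ (Lp.coeFn_zero ℂ 2 ρ).symm)
  refine hρ.ae_eq_zero_of_forall_integral_evalPoly (Lp.memLp h) fun P => ?_
  have h1 := hh _ (hρ.toDomain (polyStar P)).2
  rw [L2.inner_def] at h1
  rw [← h1]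
  refine integral_congr_ae ?_
  filter_upwards [hρ.coeFn_toDomain (polyStar P)] with μ hμ
  rw [hμ, evalPoly_polyStar, RCLike.inner_apply, Complex.conj_conj, mul_comm]

/-- The span of the vectors obtained from the vacuum by raising operators. -/
def fockSpan : Submodule ℂ (polyDomain α ρ) :=
  Submodule.span ℂ {v | ∃ l : List (testFunctions α), v = (l.map hρ.raising).prod (vacuum α ρ)}

lemma raising_mem_fockSpan (φ : testFunctions α) {v : polyDomain α ρ} (hv : v ∈ hρ.fockSpan) :
    hρ.raising φ v ∈ hρ.fockSpan := by
  induction hv using Submodule.span_induction with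
  | mem v h =>
    obtain ⟨l, rfl⟩ := h
    exact Submodule.subset_span ⟨φ :: l, by simp⟩
  | zero => rw [map_zero]; exact zero_mem _
  | add u v _ _ hu hv => rw [map_add]; exact add_mem hu hv
  | smul c v _ hv => rw [map_smul]; exact Submodule.smul_mem _ c hv

lemma vacuum_mem_fockSpan : hρ.toDomain 1 ∈ hρ.fockSpan :=
  Submodule.subset_span ⟨[], by rw [← vacuum_eq]; simp⟩

/-- Solve the definition of the raising operator for the top term: `X_g Q = K⁺(g) Q - L_g Q + 2 D_g
Q + α(g) Q`, where `Q`, `L_g Q` and `D_g Q` have degree at most `n`. -/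
lemma toDomain_mem_fockSpan_of_degreeLE (n : ℕ) {P : MvPolynomial (testFunctions α) ℂ}
    (hP : P ∈ degreeLE (testFunctions α) n) : hρ.toDomain P ∈ hρ.fockSpan := by
  induction n generalizing P with
  | zero =>
    induction hP using Submodule.span_induction with
    | mem P h =>
      obtain ⟨l, hl, rfl⟩ := h
      rw [List.length_eq_zero_iff.1 (Nat.le_zero.1 hl)]
      simpa using hρ.vacuum_mem_fockSpan
    | zero => rw [map_zero]; exact zero_mem _
    | add u v _ _ hu hv => rw [map_add]; exact add_mem hu hv
    | smul c v _ hv => rw [map_smul]; exact Submodule.smul_mem _ c hv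
  | succ n ih =>
    induction hP using Submodule.span_induction with
    | mem P h =>
      obtain ⟨l, hl, rfl⟩ := h
      rcases l with _ | ⟨g, l⟩
      · simpa using hρ.vacuum_mem_fockSpan
      · have hm : (l.map (MvPolynomial.X : testFunctions α → MvPolynomial _ ℂ)).prod
            ∈ degreeLE (testFunctions α) n :=
          Submodule.subset_span ⟨l, by simpa using hl, rfl⟩
        rw [List.map_cons, List.prod_cons]
        generalize (l.map (MvPolynomial.X : testFunctions α → MvPolynomial _ ℂ)).prod = Q at hm
        have h1 : hρ.toDomain (MvPolynomial.X g * Q)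
            = hρ.raising g (hρ.toDomain Q) - hρ.toDomain (lowerOp (controlMean α) g Q)
              + (2 : ℂ) • hρ.toDomain (scaleDeriv g Q) + controlMean α g • hρ.toDomain Q := by
          simp only [raising, LinearMap.sub_apply, LinearMap.add_apply, LinearMap.smul_apply,
            secondOp_toDomain, derivOp_toDomain, mulOp_toDomain, Module.End.one_apply]
          abel
        rw [h1]
        exact add_mem (add_mem (sub_mem (hρ.raising_mem_fockSpan g (ih hm))
          (ih (lowerOp_mem_degreeLE _ g hm)))
          (Submodule.smul_mem _ _ (ih (scaleDeriv_mem_degreeLE g hm))))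
          (Submodule.smul_mem _ _ (ih hm))
    | zero => rw [map_zero]; exact zero_mem _
    | add u v _ _ hu hv => rw [map_add]; exact add_mem hu hv
    | smul c v _ hv => rw [map_smul]; exact Submodule.smul_mem _ c hv

lemma mem_fockSpan (v : polyDomain α ρ) : v ∈ hρ.fockSpan := by
  obtain ⟨P, rfl⟩ := hρ.toDomain_surjective v
  obtain ⟨n, hn⟩ := exists_mem_degreeLE P
  exact hρ.toDomain_mem_fockSpan_of_degreeLE n hn

lemma dense_fockSpan [SigmaFinite α] : Dense (Submodule.span ℂ
    {v : Lp ℂ 2 ρ | ∃ l : List (testFunctions α),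
      v = ((l.map hρ.raising).prod (vacuum α ρ) : polyDomain α ρ)} : Set (Lp ℂ 2 ρ)) := by
  refine hρ.dense_polyDomain.mono fun v hv => ?_
  have h1 : (polyDomain α ρ).subtype ⟨v, hv⟩ ∈ hρ.fockSpan.map (polyDomain α ρ).subtype :=
    Submodule.mem_map_of_mem (hρ.mem_fockSpan ⟨v, hv⟩)
  rw [fockSpan, Submodule.map_span] at h1
  refine Submodule.span_mono ?_ h1
  rintro _ ⟨_, ⟨l, rfl⟩, rfl⟩
  exact ⟨l, rfl⟩

/-! ### Commutation and adjoint relations -/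

/-- With `ψ = φ̄ θ`: `[L_φ̄, -2 D_θ] = -2 L_ψ` and `[L_φ̄, M_θ] = 2 D_ψ + α(ψ)`, which add up to `2
K⁰(ψ)`. -/
lemma comm_lowering_raising (φ θ : testFunctions α) :
    hρ.lowering φ * hρ.raising θ - hρ.raising θ * hρ.lowering φ
      = (2 : ℂ) • hρ.neutral (star φ * θ) := by
  simp only [lowering, raising, neutral, mul_add, mul_sub, add_mul, sub_mul, smul_mul_assoc,
    mul_smul_comm, mul_one, one_mul, secondOp_mul_mulOp, derivOp_mul_secondOp,
    hρ.secondOp_comm (star φ) θ, mul_comm θ (star φ)]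
  module

/-- With `ψ = φ θ`: `[D_φ, L_θ] + [D_φ, M_θ] + 2 [L_φ, D_θ] - [L_φ, M_θ] = -L_ψ + M_ψ + 2 L_ψ - 2
D_ψ - α(ψ) = K⁺(ψ)`. -/
lemma comm_neutral_raising (φ θ : testFunctions α) :
    hρ.neutral φ * hρ.raising θ - hρ.raising θ * hρ.neutral φ = hρ.raising (φ * θ) := by
  simp only [raising, neutral, mul_add, mul_sub, add_mul, sub_mul,
    smul_mul_assoc, mul_smul_comm, mul_one, one_mul, secondOp_mul_mulOp, derivOp_mul_mulOp,
    derivOp_mul_secondOp, hρ.secondOp_comm φ θ, hρ.derivOp_comm φ θ, mul_comm θ φ]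
  module

lemma comm_neutral_lowering (φ θ : testFunctions α) :
    hρ.neutral φ * hρ.lowering θ - hρ.lowering θ * hρ.neutral φ
      = -hρ.lowering (star φ * θ) := by
  simp only [lowering, neutral, mul_add, add_mul, mul_sub, sub_mul, smul_mul_assoc,
    mul_smul_comm, mul_one, one_mul, derivOp_mul_secondOp, hρ.secondOp_comm φ (star θ), star_mul',
    star_star]
  module

/-- The cross commutators depend on `φ` and `θ` only through `φ θ`, so they cancel under
antisymmetrization. -/
lemma comm_raising (φ θ : testFunctions α) :
    hρ.raising φ * hρ.raising θ - hρ.raising θ * hρ.raising φ = 0 := by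
  simp only [raising, mul_add, mul_sub, add_mul, sub_mul,
    smul_mul_assoc, mul_smul_comm, mul_one, one_mul, secondOp_mul_mulOp, derivOp_mul_mulOp,
    derivOp_mul_secondOp, hρ.secondOp_comm φ θ, hρ.derivOp_comm φ θ, mul_comm θ φ,
    hρ.mulOp_comm (MvPolynomial.X φ) (MvPolynomial.X θ)]
  module

lemma comm_neutral (φ θ : testFunctions α) :
    hρ.neutral φ * hρ.neutral θ - hρ.neutral θ * hρ.neutral φ = 0 := by
  simp only [neutral, mul_add, add_mul, mul_sub, sub_mul,
    smul_mul_assoc, mul_smul_comm, mul_one, one_mul, derivOp_mul_secondOp, hρ.secondOp_comm φ θ,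
    hρ.derivOp_comm φ θ, mul_comm θ φ]
  module

lemma adjoint_neutral (φ : testFunctions α) (f g : polyDomain α ρ) :
    inner ℂ (f : Lp ℂ 2 ρ) (hρ.neutral φ g : Lp ℂ 2 ρ)
      = inner ℂ (hρ.neutral (star φ) f : Lp ℂ 2 ρ) (g : Lp ℂ 2 ρ) := by
  obtain ⟨F, rfl⟩ := hρ.toDomain_surjective f
  obtain ⟨G, rfl⟩ := hρ.toDomain_surjective g
  have h : polyStar (neutralOp (star φ) F) = neutralOp φ (polyStar F) := by
    simp only [neutralOp, LinearMap.add_apply, LinearMap.neg_apply, LinearMap.smul_apply,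
      LinearMap.id_apply, Derivation.coeFn_coe, ← C_mul_eq_smul, map_add, map_neg,
      map_mul polyStar, polyStar_lowerOp, polyStar_scaleDeriv, polyStar_C, star_star,
      controlMean_star, map_mul (starRingEnd ℂ), Complex.conj_conj, map_div₀, map_one, map_ofNat]
  rw [neutral_toDomain, neutral_toDomain, inner_toDomain, inner_toDomain, h,
    expectation_neutralOp_mul]

lemma adjoint_raising (φ : testFunctions α) (f g : polyDomain α ρ) :
    inner ℂ (f : Lp ℂ 2 ρ) (hρ.raising φ g : Lp ℂ 2 ρ)
      = inner ℂ (hρ.lowering φ f : Lp ℂ 2 ρ) (g : Lp ℂ 2 ρ) := by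
  obtain ⟨F, rfl⟩ := hρ.toDomain_surjective f
  obtain ⟨G, rfl⟩ := hρ.toDomain_surjective g
  rw [raising_toDomain, lowering_toDomain, inner_toDomain, inner_toDomain, polyStar_lowerOp,
    star_star, expectation_lowerOp_mul]

theorem isFockRepresentation [SigmaFinite α] : IsFockRepresentation α (polyDomain α ρ)
    hρ.raising hρ.lowering hρ.neutral (vacuum α ρ) where
  dense_domain := hρ.dense_polyDomain
  raising_add φ θ := by
    simp only [raising, secondOp_add, derivOp_add, mulOp_X_add, controlMean_add]
    module
  raising_smul c φ := by
    simp only [raising, secondOp_smul, derivOp_smul, mulOp_X_smul, controlMean_smul]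
    module
  neutral_add φ θ := by
    simp only [neutral, secondOp_add, derivOp_add, controlMean_add]
    module
  neutral_smul c φ := by
    simp only [neutral, secondOp_smul, derivOp_smul, controlMean_smul]
    module
  lowering_add φ θ := by simp only [lowering, star_add, secondOp_add]
  lowering_smul c φ := by simp only [lowering, star_smul, secondOp_smul, Complex.star_def]
  comm_lowering_raising := hρ.comm_lowering_raising
  comm_neutral_raising := hρ.comm_neutral_raising
  comm_neutral_lowering := hρ.comm_neutral_lowering
  comm_raising := hρ.comm_raising
  comm_lowering φ θ := by
    rw [lowering, lowering, hρ.secondOp_comm, sub_self]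
  comm_neutral := hρ.comm_neutral
  adjoint_neutral := hρ.adjoint_neutral
  adjoint_raising := hρ.adjoint_raising
  norm_vacuum := by
    change ‖Lp.const 2 ρ (1 : ℂ)‖ = 1
    have h := Lp.norm_const' (μ := ρ) (p := 2) (1 : ℂ) (by norm_num) (by norm_num)
    refine h.trans ?_
    simp
  lowering_vacuum φ := by rw [vacuum_eq hρ, lowering, secondOp_one]
  cyclic := hρ.dense_fockSpan

/-! ### Laguerre polynomials of the masses -/

/-- A real polynomial in the variable `μ(φ)`. -/
def singlePoly (φ : testFunctions α) (p : Polynomial ℝ) : MvPolynomial (testFunctions α) ℂ :=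
  (p.map Complex.ofRealHom).aeval (MvPolynomial.X φ)

lemma singlePoly_add (φ : testFunctions α) (p q : Polynomial ℝ) :
    singlePoly φ (p + q) = singlePoly φ p + singlePoly φ q := by simp [singlePoly]

lemma singlePoly_monomial (φ : testFunctions α) (k : ℕ) (c : ℝ) :
    singlePoly φ (Polynomial.monomial k c) = (c : ℂ) • MvPolynomial.X φ ^ k := by
  simp [singlePoly, Polynomial.map_monomial, Polynomial.aeval_monomial, smul_eq_C_mul]

lemma evalPoly_singlePoly_indicatorTest {B : Set X} (hB : MeasurableSet B) (hfin : α B < ∞)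
    (p : Polynomial ℝ) (μ : SFiniteMeasure X) :
    evalPoly (singlePoly (indicatorTest α B hB hfin) p) μ = ((p.eval (mass B μ) : ℝ) : ℂ) := by
  induction p using Polynomial.induction_on' with
  | add p q hp hq =>
    rw [singlePoly_add, evalPoly_add, hp, hq, Polynomial.eval_add, Complex.ofReal_add]
  | monomial k c =>
    rw [singlePoly_monomial, evalPoly_smul, evalPoly_pow, evalPoly_X, pairing_indicatorTest,
      Polynomial.eval_monomial]
    push_cast
    rfl

/-- Idempotency gives `X_{φφ} = X_φ`, so `D_φ` acts on powers of the single variable `X_φ` as `x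
d/dx`. -/
lemma scaleDeriv_X_pow {φ : testFunctions α} (hφ : φ * φ = φ) (k : ℕ) :
    scaleDeriv φ (MvPolynomial.X φ ^ k) = (k : ℂ) • MvPolynomial.X φ ^ k := by
  induction k with
  | zero => simp
  | succ k ih =>
    rw [pow_succ', scaleDeriv_X_mul, ih, hφ]
    push_cast
    rw [add_smul, one_smul, mul_smul_comm]

lemma lowerOp_X_pow {φ : testFunctions α} (hφ : φ * φ = φ) (k : ℕ) :
    lowerOp (controlMean α) φ (MvPolynomial.X φ ^ (k + 1))
      = ((k + 1) * (k + controlMean α φ) : ℂ) • MvPolynomial.X φ ^ k := by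
  induction k with
  | zero =>
    rw [pow_succ', lowerOp_X_mul]
    simp [hφ, smul_eq_C_mul]
  | succ k ih =>
    rw [pow_succ', lowerOp_X_mul, ih, hφ, scaleDeriv_X_pow hφ, two_mul_eq_smul, C_mul_eq_smul,
      mul_smul_comm, ← pow_succ']
    push_cast
    module

lemma raiseOp_singlePoly {φ : testFunctions α} (hφ : φ * φ = φ) {β : ℝ}
    (hβ : controlMean α φ = β) (p : Polynomial ℝ) :
    raiseOp φ (singlePoly φ p) = singlePoly φ (raisePoly β p) := by
  induction p using Polynomial.induction_on' with
  | add p q hp hq =>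
    rw [singlePoly_add, map_add, hp, hq, ← singlePoly_add]
    congr 1
    simp only [raisePoly, Polynomial.derivative_add]
    ring
  | monomial k c =>
    have hX : ∀ (j : ℕ) (d : ℝ), singlePoly φ (Polynomial.X * Polynomial.monomial j d)
        = (d : ℂ) • MvPolynomial.X φ ^ (j + 1) := fun j d => by
      rw [Polynomial.X_mul_monomial, singlePoly_monomial]
    have hsub : ∀ p q : Polynomial ℝ, singlePoly φ (p - q) = singlePoly φ p - singlePoly φ q :=
      fun p q => by simp [singlePoly]
    have hC : ∀ (b : ℝ) (p : Polynomial ℝ),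
        singlePoly φ (Polynomial.C b * p) = (b : ℂ) • singlePoly φ p := fun b p => by
      simp [singlePoly, smul_eq_C_mul]
    have h2 : ∀ p : Polynomial ℝ, singlePoly φ (2 * p) = (2 : ℂ) • singlePoly φ p := fun p => by
      rw [two_mul, singlePoly_add, two_smul]
    rw [singlePoly_monomial, map_smul, raisePoly]
    simp only [singlePoly_add, sub_mul, hsub, hC, mul_assoc, h2, Polynomial.derivative_monomial, hX,
      singlePoly_monomial, raiseOp, LinearMap.sub_apply, LinearMap.add_apply, LinearMap.smul_apply,
      LinearMap.mulLeft_apply, LinearMap.id_apply, Derivation.coeFn_coe, scaleDeriv_X_pow hφ,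
      hβ, ← pow_succ']
    -- The exponents `k - 1` and `k - 2` from the derivatives are truncated, so `k = 0` and `k = 1`
    -- are separate cases.
    rcases k with _ | k
    · simp
      module
    · rw [lowerOp_X_pow hφ, hβ]
      rcases k with _ | k
      · simp
        module
      · simp only [Nat.add_sub_cancel]
        push_cast
        module

lemma raising_pow_vacuum {φ : testFunctions α} (hφ : φ * φ = φ) {β : ℝ}
    (hβ : controlMean α φ = β) (n : ℕ) :
    (hρ.raising φ ^ n) (hρ.toDomain 1)
      = hρ.toDomain (singlePoly φ (monicLaguerre (β - 1) n)) := by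
  induction n with
  | zero => simp [monicLaguerre, singlePoly]
  | succ n ih =>
    rw [pow_succ', Module.End.mul_apply, ih, raising_toDomain, raiseOp_singlePoly hφ hβ,
      ← monicLaguerre_succ]

lemma mulOp_X_zero : hρ.mulOp (MvPolynomial.X (0 : testFunctions α)) = 0 := by
  rw [← zero_smul ℂ (0 : testFunctions α), mulOp_X_smul, zero_smul]

lemma derivOp_zero : hρ.derivOp (0 : testFunctions α) = 0 := by
  rw [← zero_smul ℂ (0 : testFunctions α), derivOp_smul, zero_smul]

/-- Every term of the commutator with `X_g` carries the product `φ g`, which is zero. -/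
lemma commute_raising_mulOp_X {φ g : testFunctions α} (h : φ * g = 0) :
    Commute (hρ.raising φ) (hρ.mulOp (MvPolynomial.X g)) := by
  rw [Commute, SemiconjBy, ← sub_eq_zero]
  simp only [raising, mul_add, mul_sub, add_mul, sub_mul, smul_mul_assoc, mul_smul_comm, mul_one,
    one_mul, secondOp_mul_mulOp, derivOp_mul_mulOp, h, derivOp_zero, mulOp_X_zero, controlMean_zero,
    hρ.mulOp_comm (MvPolynomial.X φ) (MvPolynomial.X g)]
  module

lemma commute_raising_mulOp_singlePoly {φ g : testFunctions α} (h : φ * g = 0)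
    (p : Polynomial ℝ) : Commute (hρ.raising φ) (hρ.mulOp (singlePoly g p)) := by
  have hone : hρ.mulOp 1 = 1 := hρ.end_ext fun P => by simp
  have hsmul : ∀ (c : ℂ) (Q : MvPolynomial (testFunctions α) ℂ),
      hρ.mulOp (c • Q) = c • hρ.mulOp Q := fun c Q => hρ.end_ext fun P => by simp
  induction p using Polynomial.induction_on' with
  | add p q hp hq =>
    rw [singlePoly_add, mulOp_add]
    exact hp.add_right hq
  | monomial k c =>
    rw [singlePoly_monomial, hsmul]
    refine Commute.smul_right ?_ _
    induction k with
    | zero => rw [pow_zero, hone]; exact Commute.one_right _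
    | succ k ih =>
      rw [pow_succ, mulOp_mul]
      exact ih.mul_right (hρ.commute_raising_mulOp_X h)

/-- Each factor commutes with multiplication by the polynomials already created in the other
variables, so it acts on the vacuum alone and contributes its own Laguerre polynomial. -/
lemma prod_raising_pow_vacuum {l : ℕ} (φ : Fin l → testFunctions α) (hφ : ∀ i, φ i * φ i = φ i)
    (hdisj : Pairwise fun i j => φ i * φ j = 0) (β : Fin l → ℝ)
    (hβ : ∀ i, controlMean α (φ i) = β i) (n : Fin l → ℕ) :
    (List.ofFn fun i => hρ.raising (φ i) ^ n i).prod (hρ.toDomain 1)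
      = hρ.toDomain (∏ i, singlePoly (φ i) (monicLaguerre (β i - 1) (n i))) := by
  induction l with
  | zero => simp
  | succ l ih =>
    have h1 := ih (fun i => φ i.succ) (fun i => hφ _)
      (fun i j hij => hdisj ((Fin.succ_injective l).ne hij)) (fun i => β i.succ) (fun i => hβ _)
      (fun i => n i.succ)
    have hcomm : ∀ s : Finset (Fin l), Commute (hρ.raising (φ 0) ^ n 0) (hρ.mulOp
        (∏ i ∈ s, singlePoly (φ i.succ) (monicLaguerre (β i.succ - 1) (n i.succ)))) := fun s => by
      classical
      induction s using Finset.induction_on with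
      | empty =>
        rw [Finset.prod_empty, show hρ.mulOp 1 = 1 from hρ.end_ext fun P => by simp]
        exact Commute.one_right _
      | insert i s hi ihs =>
        rw [Finset.prod_insert hi, mulOp_mul]
        exact ((hρ.commute_raising_mulOp_singlePoly (hdisj (Fin.succ_ne_zero i).symm)
          _).pow_left _).mul_right ihs
    rw [List.ofFn_succ, List.prod_cons, Module.End.mul_apply, h1, Fin.prod_univ_succ,
      ← mul_one (∏ i : Fin l, singlePoly (φ i.succ) _), ← mulOp_toDomain, ← Module.End.mul_apply,
      (hcomm Finset.univ).eq, Module.End.mul_apply, hρ.raising_pow_vacuum (hφ 0) (hβ 0),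
      mulOp_toDomain, mul_one, mul_comm]

end IsGammaLaw

/-! ### Indicators as idempotent and mutually orthogonal test functions -/

lemma indicatorTest_mul_self {B : Set X} (hB : MeasurableSet B) (hfin : α B < ∞) :
    indicatorTest α B hB hfin * indicatorTest α B hB hfin = indicatorTest α B hB hfin := by
  refine Subtype.ext (funext fun x => ?_)
  change B.indicator (fun _ => (1 : ℂ)) x * B.indicator (fun _ => (1 : ℂ)) x
    = B.indicator (fun _ => (1 : ℂ)) x
  by_cases hx : x ∈ B <;> simp [hx]

lemma indicatorTest_mul_of_disjoint {A B : Set X} (hA : MeasurableSet A) (hAfin : α A < ∞)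
    (hB : MeasurableSet B) (hBfin : α B < ∞) (h : Disjoint A B) :
    indicatorTest α A hA hAfin * indicatorTest α B hB hBfin = 0 := by
  refine Subtype.ext (funext fun x => ?_)
  change A.indicator (fun _ => (1 : ℂ)) x * B.indicator (fun _ => (1 : ℂ)) x = 0
  by_cases hx : x ∈ A
  · simp [Set.disjoint_left.1 h hx]
  · simp [hx]

lemma controlMean_indicatorTest {B : Set X} (hB : MeasurableSet B) (hfin : α B < ∞) :
    controlMean α (indicatorTest α B hB hfin) = ((α B).toReal : ℂ) := by
  rw [controlMean, indicatorTest, integral_indicator_const _ hB]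
  simp [measureReal_def]

end

end GammaCurrent

/-! ### The main theorem -/

open GammaCurrent in
theorem theorem3p5 {X : Type*} [MeasurableSpace X] (α : Measure X) [SigmaFinite α]
    (ρ : Measure (SFiniteMeasure X)) [IsProbabilityMeasure ρ] (hρ : IsGammaLaw α ρ) :
    -- polynomials are square-integrable
    (∀ F ∈ polyFunctionals α, MemLp F 2 ρ) ∧
    -- the polynomials `ℒ_n^{(β-1)}` are the monic Laguerre polynomials
    (∀ β : ℝ, 0 < β → ∀ n : ℕ, (monicLaguerre (β - 1) n).Monic ∧
      (monicLaguerre (β - 1) n).natDegree = n ∧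
      ∀ m : ℕ, m ≠ n → ∫ x in Ioi (0 : ℝ), (monicLaguerre (β - 1) m).eval x *
        (monicLaguerre (β - 1) n).eval x * (x ^ (β - 1) * Real.exp (-x)) = 0) ∧
    ∃ Kp Km K0 : testFunctions α → Module.End ℂ (polyDomain α ρ),
      (∀ φ, IsGivenBy (Kp φ) (raisingExpr α φ)) ∧
      (∀ φ, IsGivenBy (Km φ) (loweringExpr α φ)) ∧
      (∀ φ, IsGivenBy (K0 φ) (neutralExpr α φ)) ∧
      IsFockRepresentation α (polyDomain α ρ) Kp Km K0 (vacuum α ρ) ∧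
      ∀ (l : ℕ) (B : Fin l → Set X) (hB : ∀ i, MeasurableSet (B i)) (hfin : ∀ i, α (B i) < ∞)
        (n : Fin l → ℕ), (∀ i, 0 < α (B i)) → Pairwise (fun i j => Disjoint (B i) (B j)) →
        (((List.ofFn fun i => Kp (indicatorTest α (B i) (hB i) (hfin i)) ^ n i).prod
            (vacuum α ρ) : polyDomain α ρ) : Lp ℂ 2 ρ) =ᵐ[ρ]
          fun μ => ∏ i, (((monicLaguerre ((α (B i)).toReal - 1) (n i)).eval
            (μ.1 (B i)).toReal : ℝ) : ℂ) := by
  refine ⟨fun F hF => ?_, fun β hβ n => ⟨monic_monicLaguerre _ n, natDegree_monicLaguerre _ n,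
    fun m hm => integral_monicLaguerre_mul hβ hm⟩, hρ.raising, hρ.lowering, hρ.neutral,
    fun φ => hρ.isGivenBy_of_toDomain (hρ.raising_toDomain φ) (hρ.raisingExpr_evalPoly φ),
    fun φ => hρ.isGivenBy_of_toDomain (hρ.lowering_toDomain φ) (hρ.loweringExpr_evalPoly φ),
    fun φ => hρ.isGivenBy_of_toDomain (hρ.neutral_toDomain φ) (hρ.neutralExpr_evalPoly φ),
    hρ.isFockRepresentation, fun l B hB hfin n _ hdisj => ?_⟩
  · obtain ⟨P, rfl⟩ := (mem_polyFunctionals_iff_evalPoly F).1 hF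
    exact hρ.memLp_two_evalPoly P
  · rw [hρ.vacuum_eq, hρ.prod_raising_pow_vacuum _ (fun i => indicatorTest_mul_self (hB i) (hfin i))
      (fun i j hij => indicatorTest_mul_of_disjoint (hB i) (hfin i) (hB j) (hfin j) (hdisj hij)) _
      (fun i => controlMean_indicatorTest (hB i) (hfin i))]
    refine (hρ.coeFn_toDomain _).trans (Filter.Eventually.of_forall fun μ => ?_)
    have h : evalPoly (∏ i, IsGammaLaw.singlePoly (indicatorTest α (B i) (hB i) (hfin i))
        (monicLaguerre ((α (B i)).toReal - 1) (n i))) μ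
        = ∏ i, evalPoly (IsGammaLaw.singlePoly (indicatorTest α (B i) (hB i) (hfin i))
          (monicLaguerre ((α (B i)).toReal - 1) (n i))) μ := by
      simp only [evalPoly, map_prod]
    rw [h]
    exact Finset.prod_congr rfl fun i _ =>
      IsGammaLaw.evalPoly_singlePoly_indicatorTest (hB i) (hfin i) _ μ
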